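/- Let $n\ge 0$ be an integer and work over $\mathbb{Q}(v,t)$. For $1\le i,j\le n-1$ put $\langle i,i\rangle=1$, $\langle i+1,i\rangle=-1$, $\langle i,j\rangle=0$ in all other cases, and $i\cdot j=\langle i,j\rangle+\langle j,i\rangle$. Let $U=U_{v,t}(sl_n)$ be the associative unital $\mathbb{Q}(v,t)$-algebra generated by $E_i,F_i,K_i^{\pm1},K_i'^{\pm1}$ $(1\le i<n)$ subject to the following relations. * All $K_i^{\pm1},K_j'^{\pm1}$ commute with each other, and $K_i^{\pm1}K_i^{\mp1}=1=K_i'^{\pm1}K_i'^{\mp1}$. * $K_iE_jK_i^{-1}=v^{i\cdot j}t^{\langle i,j\rangle-\langle j,i\rangle}E_j$, $\;K_i'E_jK_i'^{-1}=v^{-i\cdot j}t^{\langle i,j\rangle-\langle j,i\rangle}E_j$, $\;K_iF_jK_i^{-1}=v^{-i\cdot j}t^{\langle j,i\rangle-\langle i,j\rangle}F_j$, $\;K_i'F_jK_i'^{-1}=v^{i\cdot j}t^{\langle j,i\rangle-\langle i,j\rangle}F_j$. * $E_iF_j-F_jE_i=\delta_{ij}\dfrac{K_i-K_i'}{v-v^{-1}}$.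 * $[E_i,E_j]=[F_i,F_j]=0$ if $|i-j|>1$. * $E_i^2E_{i+1}-t(v+v^{-1})E_iE_{i+1}E_i+t^2E_{i+1}E_i^2=0$ and $E_iE_{i+1}^2-t(v+v^{-1})E_{i+1}E_iE_{i+1}+t^2E_{i+1}^2E_i=0$. * $F_i^2F_{i+1}-t^{-1}(v+v^{-1})F_iF_{i+1}F_i+t^{-2}F_{i+1}F_i^2=0$ and $F_iF_{i+1}^2-t^{-1}(v+v^{-1})F_{i+1}F_iF_{i+1}+t^{-2}F_{i+1}^2F_i=0$. It is a Hopf algebra with $\Delta(K_i^{\pm1})=K_i^{\pm1}\otimes K_i^{\pm1}$, $\Delta(K_i'^{\pm1})=K_i'^{\pm1}\otimes K_i'^{\pm1}$, $\Delta(E_i)=E_i\otimes1+K_i\otimes E_i$, $\Delta(F_i)=1\otimes F_i+F_i\otimes K_i'$; $\varepsilon(K_i^{\pm1})=\varepsilon(K_i'^{\pm1})=1$, $\varepsilon(E_i)=\varepsilon(F_i)=0$; $S(K_i^{\pm1})=K_i^{\mp1}$, $S(K_i'^{\pm1})=K_i'^{\mp1}$, $S(E_i)=-K_i^{-1}E_i$,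 $S(F_i)=-F_iK_i'^{-1}$. Let $\mathcal B$ and $\mathcal B'$ be the Hopf subalgebras of $U$ generated by the $E_i,K_i^{\pm1}$ and by the $F_i,K_i'^{\pm1}$ respectively, and let $\mathcal B'^{coop}$ be $\mathcal B'$ with the opposite comultiplication. A Hopf pairing of $H$ and $H'$ is a bilinear form $(-,-)$ on $H'\times H$ with $(1,h)=\varepsilon(h)$, $(h',1)=\varepsilon(h')$, $(h',hk)=\sum(h'_{(1)},h)(h'_{(2)},k)$ and $(h'k',h)=\sum(h',h_{(1)})(k',h_{(2)})$. Then there is a unique Hopf pairing $(-,-):\mathcal B'^{coop}\times\mathcal B\to\mathbb{Q}(v,t)$ such that, for all $1\le i,j<n$, $$(F_i,E_j)=\frac{\delta_{ij}}{v^{-1}-v},\qquad (K_i',K_j)=v^{j\cdot i}t^{\langle j,i\rangle-\langle i,j\rangle},\qquad (F_i,K_j)=(K_i',E_j)=0.$$ Let $D$ be the Drinfeld double of $\mathcal B$ and $\mathcal B'^{coop}$ with respect to this pairing: the Hopf algebra with underlying coalgebra the tensor product $\mathcal B\otimes\mathcal B'$ (both factors carrying the coalgebra structure of $U$), unit $1\otimes1$,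 multiplication $$(a\otimes f)(a'\otimes f')=\sum\bigl(S(f_{(1)}),a'_{(1)}\bigr)\bigl(f_{(3)},a'_{(3)}\bigr)\,aa'_{(2)}\otimes f_{(2)}f'$$ and antipode $S(a\otimes f)=(1\otimes S(f))(S(a)\otimes1)$, where the Sweedler components and $S$ on the right-hand sides are those of $U$. Then $D$ is isomorphic to $U_{v,t}(sl_n)$ as a Hopf algebra. -/

import Mathlib

open scoped TensorProduct

noncomputable section

namespace TwoParam

variable {k : Type*} [Field k]

/-- The matrix `Ω` of type `A_{n-1}`, i.e. the form `⟨i, j⟩`: `1` on the diagonal, `-1` directly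
below the diagonal, `0` elsewhere. The index `i : Fin (n - 1)` stands for `i + 1` in `1, …, n-1`. -/
def Om {n : ℕ} (i j : Fin (n - 1)) : ℤ :=
  if i = j then 1 else if (i : ℕ) = (j : ℕ) + 1 then -1 else 0

/-- `i · j = ⟨i, j⟩ + ⟨j, i⟩`. -/
def dot {n : ℕ} (i j : Fin (n - 1)) : ℤ := Om i j + Om j i

/-- The generating symbols of the two-parameter quantum algebra. -/
inductive Gen (n : ℕ) : Type
  | E (i : Fin (n - 1))
  | F (i : Fin (n - 1))
  | K (i : Fin (n - 1))
  | Kinv (i : Fin (n - 1))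
  | K' (i : Fin (n - 1))
  | Kinv' (i : Fin (n - 1))

/-- The symbols `K_i^{±1}`, `K_i'^{±1}`. -/
def Gen.IsTorus {n : ℕ} : Gen n → Prop
  | .E _ => False
  | .F _ => False
  | _ => True

/-- The generating symbol, inside the free algebra. -/
abbrev gen (k : Type*) [Field k] {n : ℕ} (x : Gen n) : FreeAlgebra k (Gen n) := FreeAlgebra.ι k x

/-- The defining relations of the two-parameter quantum algebra, with parameters `v`, `t`. -/
inductive Rel (v t : kˣ) (n : ℕ) : FreeAlgebra k (Gen n) → FreeAlgebra k (Gen n) → Prop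
  | torus_comm (x y : Gen n) (hx : x.IsTorus) (hy : y.IsTorus) :
      Rel v t n (gen k x * gen k y) (gen k y * gen k x)
  | K_Kinv (i : Fin (n - 1)) : Rel v t n (gen k (.K i) * gen k (.Kinv i)) 1
  | Kinv_K (i : Fin (n - 1)) : Rel v t n (gen k (.Kinv i) * gen k (.K i)) 1
  | K'_Kinv' (i : Fin (n - 1)) : Rel v t n (gen k (.K' i) * gen k (.Kinv' i)) 1
  | Kinv'_K' (i : Fin (n - 1)) : Rel v t n (gen k (.Kinv' i) * gen k (.K' i)) 1
  | K_E (i j : Fin (n - 1)) : Rel v t n (gen k (.K i) * gen k (.E j) * gen k (.Kinv i))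
      (((v ^ dot i j * t ^ (Om i j - Om j i) : kˣ) : k) • gen k (.E j))
  | K'_E (i j : Fin (n - 1)) : Rel v t n (gen k (.K' i) * gen k (.E j) * gen k (.Kinv' i))
      (((v ^ (-dot i j) * t ^ (Om i j - Om j i) : kˣ) : k) • gen k (.E j))
  | K_F (i j : Fin (n - 1)) : Rel v t n (gen k (.K i) * gen k (.F j) * gen k (.Kinv i))
      (((v ^ (-dot i j) * t ^ (Om j i - Om i j) : kˣ) : k) • gen k (.F j))
  | K'_F (i j : Fin (n - 1)) : Rel v t n (gen k (.K' i) * gen k (.F j) * gen k (.Kinv' i))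
      (((v ^ dot i j * t ^ (Om j i - Om i j) : kˣ) : k) • gen k (.F j))
  | E_F (i j : Fin (n - 1)) : Rel v t n (gen k (.E i) * gen k (.F j) - gen k (.F j) * gen k (.E i))
      (if i = j then ((v : k) - (v : k)⁻¹)⁻¹ • (gen k (.K i) - gen k (.K' i)) else 0)
  | E_E (i j : Fin (n - 1)) (h : 1 < |(i : ℤ) - (j : ℤ)|) :
      Rel v t n (gen k (.E i) * gen k (.E j) - gen k (.E j) * gen k (.E i)) 0
  | F_F (i j : Fin (n - 1)) (h : 1 < |(i : ℤ) - (j : ℤ)|) :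
      Rel v t n (gen k (.F i) * gen k (.F j) - gen k (.F j) * gen k (.F i)) 0
  | serre_E₁ (i j : Fin (n - 1)) (h : (j : ℕ) = (i : ℕ) + 1) : Rel v t n
      (gen k (.E i) ^ 2 * gen k (.E j)
        - ((t : k) * ((v : k) + (v : k)⁻¹)) • (gen k (.E i) * gen k (.E j) * gen k (.E i))
        + (t : k) ^ 2 • (gen k (.E j) * gen k (.E i) ^ 2)) 0
  | serre_E₂ (i j : Fin (n - 1)) (h : (j : ℕ) = (i : ℕ) + 1) : Rel v t n
      (gen k (.E i) * gen k (.E j) ^ 2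
        - ((t : k) * ((v : k) + (v : k)⁻¹)) • (gen k (.E j) * gen k (.E i) * gen k (.E j))
        + (t : k) ^ 2 • (gen k (.E j) ^ 2 * gen k (.E i))) 0
  | serre_F₁ (i j : Fin (n - 1)) (h : (j : ℕ) = (i : ℕ) + 1) : Rel v t n
      (gen k (.F i) ^ 2 * gen k (.F j)
        - ((t : k)⁻¹ * ((v : k) + (v : k)⁻¹)) • (gen k (.F i) * gen k (.F j) * gen k (.F i))
        + ((t : k)⁻¹) ^ 2 • (gen k (.F j) * gen k (.F i) ^ 2)) 0
  | serre_F₂ (i j : Fin (n - 1)) (h : (j : ℕ) = (i : ℕ) + 1) : Rel v t n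
      (gen k (.F i) * gen k (.F j) ^ 2
        - ((t : k)⁻¹ * ((v : k) + (v : k)⁻¹)) • (gen k (.F j) * gen k (.F i) * gen k (.F j))
        + ((t : k)⁻¹) ^ 2 • (gen k (.F j) ^ 2 * gen k (.F i))) 0

/-- The two-parameter quantum algebra `U_{v,t}(sl_n)` over `k`. -/
def QAlg (v t : kˣ) (n : ℕ) : Type _ := RingQuot (Rel v t n)

namespace QAlg

variable (v t : kˣ) (n : ℕ)

instance : Ring (QAlg v t n) := inferInstanceAs (Ring (RingQuot (Rel v t n)))
instance : Algebra k (QAlg v t n) := inferInstanceAs (Algebra k (RingQuot (Rel v t n)))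

/-- The quotient map from the free algebra. -/
def mk : FreeAlgebra k (Gen n) →ₐ[k] QAlg v t n := RingQuot.mkAlgHom k (Rel v t n)

variable {n}

/-- The image of a generating symbol. -/
def of (x : Gen n) : QAlg v t n := mk v t n (gen k x)

def E (i : Fin (n - 1)) : QAlg v t n := of v t (.E i)
def F (i : Fin (n - 1)) : QAlg v t n := of v t (.F i)
def K (i : Fin (n - 1)) : QAlg v t n := of v t (.K i)
def Kinv (i : Fin (n - 1)) : QAlg v t n := of v t (.Kinv i)
def K' (i : Fin (n - 1)) : QAlg v t n := of v t (.K' i)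
def Kinv' (i : Fin (n - 1)) : QAlg v t n := of v t (.Kinv' i)

variable {v t}

lemma mk_eq {a b : FreeAlgebra k (Gen n)} (h : Rel v t n a b) : mk v t n a = mk v t n b :=
  RingQuot.mkAlgHom_rel k h

/-- Elements `e x` of an algebra indexed by the generating symbols satisfy the defining
relations of the two-parameter quantum algebra. -/
structure Sat (v t : kˣ) {n : ℕ} {A : Type*} [Ring A] [Algebra k A] (e : Gen n → A) : Prop where
  comm (x y : Gen n) (hx : x.IsTorus) (hy : y.IsTorus) : e x * e y = e y * e x
  K_Kinv (i : Fin (n - 1)) : e (.K i) * e (.Kinv i) = 1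
  Kinv_K (i : Fin (n - 1)) : e (.Kinv i) * e (.K i) = 1
  K'_Kinv' (i : Fin (n - 1)) : e (.K' i) * e (.Kinv' i) = 1
  Kinv'_K' (i : Fin (n - 1)) : e (.Kinv' i) * e (.K' i) = 1
  K_E (i j : Fin (n - 1)) : e (.K i) * e (.E j) * e (.Kinv i) =
      (((v ^ dot i j * t ^ (Om i j - Om j i) : kˣ) : k) • e (.E j))
  K'_E (i j : Fin (n - 1)) : e (.K' i) * e (.E j) * e (.Kinv' i) =
      (((v ^ (-dot i j) * t ^ (Om i j - Om j i) : kˣ) : k) • e (.E j))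
  K_F (i j : Fin (n - 1)) : e (.K i) * e (.F j) * e (.Kinv i) =
      (((v ^ (-dot i j) * t ^ (Om j i - Om i j) : kˣ) : k) • e (.F j))
  K'_F (i j : Fin (n - 1)) : e (.K' i) * e (.F j) * e (.Kinv' i) =
      (((v ^ dot i j * t ^ (Om j i - Om i j) : kˣ) : k) • e (.F j))
  E_F (i j : Fin (n - 1)) : e (.E i) * e (.F j) - e (.F j) * e (.E i) =
      (if i = j then ((v : k) - (v : k)⁻¹)⁻¹ • (e (.K i) - e (.K' i)) else 0)
  E_E (i j : Fin (n - 1)) (h : 1 < |(i : ℤ) - (j : ℤ)|) :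
      e (.E i) * e (.E j) - e (.E j) * e (.E i) = 0
  F_F (i j : Fin (n - 1)) (h : 1 < |(i : ℤ) - (j : ℤ)|) :
      e (.F i) * e (.F j) - e (.F j) * e (.F i) = 0
  serre_E₁ (i j : Fin (n - 1)) (h : (j : ℕ) = (i : ℕ) + 1) :
      (e (.E i) ^ 2 * e (.E j)
        - ((t : k) * ((v : k) + (v : k)⁻¹)) • (e (.E i) * e (.E j) * e (.E i))
        + (t : k) ^ 2 • (e (.E j) * e (.E i) ^ 2)) = 0
  serre_E₂ (i j : Fin (n - 1)) (h : (j : ℕ) = (i : ℕ) + 1) :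
      (e (.E i) * e (.E j) ^ 2
        - ((t : k) * ((v : k) + (v : k)⁻¹)) • (e (.E j) * e (.E i) * e (.E j))
        + (t : k) ^ 2 • (e (.E j) ^ 2 * e (.E i))) = 0
  serre_F₁ (i j : Fin (n - 1)) (h : (j : ℕ) = (i : ℕ) + 1) :
      (e (.F i) ^ 2 * e (.F j)
        - ((t : k)⁻¹ * ((v : k) + (v : k)⁻¹)) • (e (.F i) * e (.F j) * e (.F i))
        + ((t : k)⁻¹) ^ 2 • (e (.F j) * e (.F i) ^ 2)) = 0
  serre_F₂ (i j : Fin (n - 1)) (h : (j : ℕ) = (i : ℕ) + 1) :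
      (e (.F i) * e (.F j) ^ 2
        - ((t : k)⁻¹ * ((v : k) + (v : k)⁻¹)) • (e (.F j) * e (.F i) * e (.F j))
        + ((t : k)⁻¹) ^ 2 • (e (.F j) ^ 2 * e (.F i))) = 0

lemma sat_of (v t : kˣ) {n : ℕ} : Sat v t (of v t (n := n)) where
  comm x y hx hy := by simpa [of] using mk_eq (Rel.torus_comm (v := v) (t := t) x y hx hy)
  K_Kinv i := by simpa [of] using mk_eq (Rel.K_Kinv (v := v) (t := t) i)
  Kinv_K i := by simpa [of] using mk_eq (Rel.Kinv_K (v := v) (t := t) i)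
  K'_Kinv' i := by simpa [of] using mk_eq (Rel.K'_Kinv' (v := v) (t := t) i)
  Kinv'_K' i := by simpa [of] using mk_eq (Rel.Kinv'_K' (v := v) (t := t) i)
  K_E i j := by simpa only [map_mul, map_smul, of] using mk_eq (Rel.K_E (v := v) (t := t) i j)
  K'_E i j := by simpa only [map_mul, map_smul, of] using mk_eq (Rel.K'_E (v := v) (t := t) i j)
  K_F i j := by simpa only [map_mul, map_smul, of] using mk_eq (Rel.K_F (v := v) (t := t) i j)
  K'_F i j := by simpa only [map_mul, map_smul, of] using mk_eq (Rel.K'_F (v := v) (t := t) i j)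
  E_F i j := by
    simpa only [map_mul, map_smul, map_sub, map_zero, apply_ite (mk v t n), of]
      using mk_eq (Rel.E_F (v := v) (t := t) i j)
  E_E i j h := by
    simpa only [map_mul, map_sub, map_zero, of] using mk_eq (Rel.E_E (v := v) (t := t) i j h)
  F_F i j h := by
    simpa only [map_mul, map_sub, map_zero, of] using mk_eq (Rel.F_F (v := v) (t := t) i j h)
  serre_E₁ i j h := by
    simpa only [map_mul, map_sub, map_zero, map_add, map_pow, map_smul, of]
      using mk_eq (Rel.serre_E₁ (v := v) (t := t) i j h)
  serre_E₂ i j h := by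
    simpa only [map_mul, map_sub, map_zero, map_add, map_pow, map_smul, of]
      using mk_eq (Rel.serre_E₂ (v := v) (t := t) i j h)
  serre_F₁ i j h := by
    simpa only [map_mul, map_sub, map_zero, map_add, map_pow, map_smul, of]
      using mk_eq (Rel.serre_F₁ (v := v) (t := t) i j h)
  serre_F₂ i j h := by
    simpa only [map_mul, map_sub, map_zero, map_add, map_pow, map_smul, of]
      using mk_eq (Rel.serre_F₂ (v := v) (t := t) i j h)

section lift

variable {A : Type*} [Ring A] [Algebra k A]

/-- The universal property of the two-parameter quantum algebra. -/
def lift (e : Gen n → A) (he : Sat v t e) : QAlg v t n →ₐ[k] A :=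
  RingQuot.liftAlgHom k ⟨FreeAlgebra.lift k e, by
    intro x y h
    induction h with
    | torus_comm x y hx hy => simpa using he.comm x y hx hy
    | K_Kinv i => simpa using he.K_Kinv i
    | Kinv_K i => simpa using he.Kinv_K i
    | K'_Kinv' i => simpa using he.K'_Kinv' i
    | Kinv'_K' i => simpa using he.Kinv'_K' i
    | K_E i j => simpa only [map_mul, map_smul, FreeAlgebra.lift_ι_apply] using he.K_E i j
    | K'_E i j => simpa only [map_mul, map_smul, FreeAlgebra.lift_ι_apply] using he.K'_E i j
    | K_F i j => simpa only [map_mul, map_smul, FreeAlgebra.lift_ι_apply] using he.K_F i j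
    | K'_F i j => simpa only [map_mul, map_smul, FreeAlgebra.lift_ι_apply] using he.K'_F i j
    | E_F i j =>
      simpa only [map_mul, map_smul, map_sub, map_zero, FreeAlgebra.lift_ι_apply,
        apply_ite (FreeAlgebra.lift k e)] using he.E_F i j
    | E_E i j h =>
      simpa only [map_mul, map_sub, map_zero, FreeAlgebra.lift_ι_apply] using he.E_E i j h
    | F_F i j h =>
      simpa only [map_mul, map_sub, map_zero, FreeAlgebra.lift_ι_apply] using he.F_F i j h
    | serre_E₁ i j h =>
      simpa only [map_mul, map_smul, map_sub, map_zero, map_add, map_pow,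
        FreeAlgebra.lift_ι_apply] using he.serre_E₁ i j h
    | serre_E₂ i j h =>
      simpa only [map_mul, map_smul, map_sub, map_zero, map_add, map_pow,
        FreeAlgebra.lift_ι_apply] using he.serre_E₂ i j h
    | serre_F₁ i j h =>
      simpa only [map_mul, map_smul, map_sub, map_zero, map_add, map_pow,
        FreeAlgebra.lift_ι_apply] using he.serre_F₁ i j h
    | serre_F₂ i j h =>
      simpa only [map_mul, map_smul, map_sub, map_zero, map_add, map_pow,
        FreeAlgebra.lift_ι_apply] using he.serre_F₂ i j h⟩

@[simp] lemma lift_of (e : Gen n → A) (he : Sat v t e) (x : Gen n) :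
    lift e he (of v t x) = e x := by
  unfold lift of mk
  exact (RingQuot.liftAlgHom_mkAlgHom_apply _ _ _ _).trans (FreeAlgebra.lift_ι_apply _ _)

lemma hom_ext {f g : QAlg v t n →ₐ[k] A} (h : ∀ x, f (of v t x) = g (of v t x)) : f = g :=
  RingQuot.ringQuot_ext' k f g (FreeAlgebra.hom_ext (funext h))

end lift

lemma adjoin_of : Algebra.adjoin k (Set.range (of v t (n := n))) = ⊤ := by
  have h : (mk v t n).range = ⊤ :=
    (AlgHom.range_eq_top _).2 (RingQuot.mkAlgHom_surjective k (Rel v t n))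
  rw [← h, ← Algebra.map_top, ← FreeAlgebra.adjoin_range_ι, AlgHom.map_adjoin, ← Set.range_comp]
  rfl

end QAlg

end TwoParam

namespace TwoParam

variable {k : Type*} [Field k]

section serre

variable {A : Type*} [Ring A] [Algebra k A]

lemma serre_add {x₁ x₂ y₁ y₂ : A} {q p r : k} (hq : q ≠ 0) (hp : p ≠ 0) (hr : r = q⁻¹ * p⁻¹)
    (h₁₁ : y₁ * x₁ = q • (x₁ * y₁)) (h₁₂ : y₁ * x₂ = p • (x₂ * y₁))
    (h₂₁ : y₂ * x₁ = r • (x₁ * y₂)) :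
    (x₁ + y₁) ^ 2 * (x₂ + y₂) - ((1 + q) * p) • ((x₁ + y₁) * (x₂ + y₂) * (x₁ + y₁))
        + (q * p ^ 2) • ((x₂ + y₂) * (x₁ + y₁) ^ 2) =
      (x₁ ^ 2 * x₂ - ((1 + q) * p) • (x₁ * x₂ * x₁) + (q * p ^ 2) • (x₂ * x₁ ^ 2)) +
      (y₁ ^ 2 * y₂ - ((1 + q) * p) • (y₁ * y₂ * y₁) + (q * p ^ 2) • (y₂ * y₁ ^ 2)) := by
  have g₁₁ (z : A) : y₁ * (x₁ * z) = q • (x₁ * (y₁ * z)) := by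
    rw [← mul_assoc, h₁₁, smul_mul_assoc, mul_assoc]
  have g₁₂ (z : A) : y₁ * (x₂ * z) = p • (x₂ * (y₁ * z)) := by
    rw [← mul_assoc, h₁₂, smul_mul_assoc, mul_assoc]
  have g₂₁ (z : A) : y₂ * (x₁ * z) = r • (x₁ * (y₂ * z)) := by
    rw [← mul_assoc, h₂₁, smul_mul_assoc, mul_assoc]
  simp only [pow_two, mul_add, add_mul, mul_assoc, g₁₁, g₁₂, g₂₁, h₁₁, h₁₂, h₂₁,
    mul_smul_comm, smul_mul_assoc, smul_add, smul_smul]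
  subst hr
  match_scalars <;> field_simp <;> ring

/-- If `S(x) = -g x` with `g` commuting with the `x`'s up to scalars, the antipode preserves the
quantum Serre relation, with the order reversed. -/
lemma serre_anti {x₁ x₂ g₁ g₂ : A} {q p r : k} (hq : q ≠ 0) (hp : p ≠ 0) (hr : r = q⁻¹ * p⁻¹)
    (hg : g₁ * g₂ = g₂ * g₁)
    (h₁₁ : x₁ * g₁ = q • (g₁ * x₁)) (h₁₂ : x₂ * g₁ = p • (g₁ * x₂))
    (h₂₁ : x₁ * g₂ = r • (g₂ * x₁)) :
    (-(g₂ * x₂)) * (-(g₁ * x₁)) ^ 2 -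
        ((1 + q) * p) • ((-(g₁ * x₁)) * (-(g₂ * x₂)) * (-(g₁ * x₁)))
        + (q * p ^ 2) • ((-(g₁ * x₁)) ^ 2 * (-(g₂ * x₂))) =
      -(g₁ * g₁ * g₂) *
        (x₁ ^ 2 * x₂ - ((1 + q) * p) • (x₁ * x₂ * x₁) + (q * p ^ 2) • (x₂ * x₁ ^ 2)) := by
  have k₁₁ (z : A) : x₁ * (g₁ * z) = q • (g₁ * (x₁ * z)) := by
    rw [← mul_assoc, h₁₁, smul_mul_assoc, mul_assoc]
  have k₁₂ (z : A) : x₂ * (g₁ * z) = p • (g₁ * (x₂ * z)) := by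
    rw [← mul_assoc, h₁₂, smul_mul_assoc, mul_assoc]
  have k₂₁ (z : A) : x₁ * (g₂ * z) = r • (g₂ * (x₁ * z)) := by
    rw [← mul_assoc, h₂₁, smul_mul_assoc, mul_assoc]
  have kg (z : A) : g₂ * (g₁ * z) = g₁ * (g₂ * z) := by
    rw [← mul_assoc, ← hg, mul_assoc]
  simp only [pow_two, mul_add, add_mul, mul_assoc, k₁₁, k₁₂, k₂₁, kg,
    mul_smul_comm, smul_mul_assoc, smul_smul, neg_mul, mul_neg, mul_sub, smul_neg]
  subst hr
  match_scalars <;> field_simp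

/-- The quantum Serre expression `a² b - s (v + v⁻¹) a b a + s² b a²`. -/
def srr (v s : k) (a b : A) : A :=
  a ^ 2 * b - (s * (v + v⁻¹)) • (a * b * a) + s ^ 2 • (b * a ^ 2)

lemma srr_flip {v s : k} (hs : s ≠ 0) (a b : A) :
    a * b ^ 2 - (s * (v + v⁻¹)) • (b * a * b) + s ^ 2 • (b ^ 2 * a) = s ^ 2 • srr v s⁻¹ b a := by
  unfold srr
  match_scalars <;> field_simp

lemma srr_add {v s : k} (hv : v ≠ 0) (hs : s ≠ 0) {x₁ x₂ y₁ y₂ : A}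
    (h₁₁ : y₁ * x₁ = v ^ 2 • (x₁ * y₁)) (h₁₂ : y₁ * x₂ = (v⁻¹ * s) • (x₂ * y₁))
    (h₂₁ : y₂ * x₁ = (v⁻¹ * s⁻¹) • (x₁ * y₂)) :
    srr v s (x₁ + y₁) (x₂ + y₂) = srr v s x₁ x₂ + srr v s y₁ y₂ := by
  have := serre_add (pow_ne_zero 2 hv) (mul_ne_zero (inv_ne_zero hv) hs)
    (by field_simp) h₁₁ h₁₂ h₂₁
  have h1 : (1 + v ^ 2) * (v⁻¹ * s) = s * (v + v⁻¹) := by field_simp; ring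
  have h2 : v ^ 2 * (v⁻¹ * s) ^ 2 = s ^ 2 := by field_simp
  rw [h1, h2] at this
  exact this

lemma srr_anti {v s : k} (hv : v ≠ 0) (hs : s ≠ 0) {x₁ x₂ g₁ g₂ : A}
    (hg : g₁ * g₂ = g₂ * g₁)
    (h₁₁ : x₁ * g₁ = v ^ 2 • (g₁ * x₁)) (h₁₂ : x₂ * g₁ = (v⁻¹ * s) • (g₁ * x₂))
    (h₂₁ : x₁ * g₂ = (v⁻¹ * s⁻¹) • (g₂ * x₁)) (h : srr v s x₁ x₂ = 0) :
    srr v s (MulOpposite.op (-(g₁ * x₁))) (MulOpposite.op (-(g₂ * x₂))) = 0 := by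
  have := serre_anti (pow_ne_zero 2 hv) (mul_ne_zero (inv_ne_zero hv) hs)
    (by field_simp) hg h₁₁ h₁₂ h₂₁
  have h1 : (1 + v ^ 2) * (v⁻¹ * s) = s * (v + v⁻¹) := by field_simp; ring
  have h2 : v ^ 2 * (v⁻¹ * s) ^ 2 = s ^ 2 := by field_simp
  rw [h1, h2] at this
  unfold srr at h ⊢
  rw [h, mul_zero] at this
  apply MulOpposite.unop_injective
  simpa [mul_assoc] using this

lemma srr_smul {v s : k} (c : k) (a b : A) : srr v s (c • a) (c • b) = c ^ 3 • srr v s a b := by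
  unfold srr
  simp only [pow_two, smul_mul_assoc, mul_smul_comm, smul_smul]
  match_scalars <;> ring

end serre

lemma Om_self {n : ℕ} (i : Fin (n - 1)) : Om i i = 1 := by simp [Om]

lemma Om_succ {n : ℕ} {i j : Fin (n - 1)} (h : (j : ℕ) = i + 1) : Om i j = 0 ∧ Om j i = -1 := by
  have h1 : i ≠ j := by rintro rfl; omega
  have h2 : (i : ℕ) ≠ j + 1 := by omega
  simp [Om, h1, h1.symm, h]
  omega

lemma Om_far {n : ℕ} {i j : Fin (n - 1)} (h : 1 < |(i : ℤ) - (j : ℤ)|) :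
    Om i j = 0 ∧ Om j i = 0 := by
  have h1 : i ≠ j := by rintro rfl; simp at h
  have h2 : (i : ℕ) ≠ j + 1 := by intro h2; simp [h2] at h
  have h3 : (j : ℕ) ≠ i + 1 := by intro h2; simp [h2] at h
  simp [Om, h1, h1.symm, h2, h3]

namespace QAlg

variable {v t : kˣ} {n : ℕ} {A : Type*} [Ring A] [Algebra k A] {e : Gen n → A}

namespace Sat

lemma KE (he : Sat v t e) (i j : Fin (n - 1)) : e (.K i) * e (.E j) =
    ((v ^ dot i j * t ^ (Om i j - Om j i) : kˣ) : k) • (e (.E j) * e (.K i)) := by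
  rw [← smul_mul_assoc, ← he.K_E, mul_assoc _ (e (.Kinv i)), he.Kinv_K, mul_one]

lemma K'E (he : Sat v t e) (i j : Fin (n - 1)) : e (.K' i) * e (.E j) =
    ((v ^ (-dot i j) * t ^ (Om i j - Om j i) : kˣ) : k) • (e (.E j) * e (.K' i)) := by
  rw [← smul_mul_assoc, ← he.K'_E, mul_assoc _ (e (.Kinv' i)), he.Kinv'_K', mul_one]

lemma KF (he : Sat v t e) (i j : Fin (n - 1)) : e (.K i) * e (.F j) =
    ((v ^ (-dot i j) * t ^ (Om j i - Om i j) : kˣ) : k) • (e (.F j) * e (.K i)) := by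
  rw [← smul_mul_assoc, ← he.K_F, mul_assoc _ (e (.Kinv i)), he.Kinv_K, mul_one]

lemma K'F (he : Sat v t e) (i j : Fin (n - 1)) : e (.K' i) * e (.F j) =
    ((v ^ dot i j * t ^ (Om j i - Om i j) : kˣ) : k) • (e (.F j) * e (.K' i)) := by
  rw [← smul_mul_assoc, ← he.K'_F, mul_assoc _ (e (.Kinv' i)), he.Kinv'_K', mul_one]

lemma KE_self (he : Sat v t e) (i : Fin (n - 1)) :
    e (.K i) * e (.E i) = (v : k) ^ 2 • (e (.E i) * e (.K i)) := by
  simpa [dot, Om_self, zpow_two, pow_two] using he.KE i i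

lemma K'F_self (he : Sat v t e) (i : Fin (n - 1)) :
    e (.K' i) * e (.F i) = (v : k) ^ 2 • (e (.F i) * e (.K' i)) := by
  simpa [dot, Om_self, zpow_two, pow_two] using he.K'F i i

lemma KE_up (he : Sat v t e) {i j : Fin (n - 1)} (h : (j : ℕ) = (i : ℕ) + 1) :
    e (.K i) * e (.E j) = ((v : k)⁻¹ * t) • (e (.E j) * e (.K i)) := by
  simpa [dot, (Om_succ h).1, (Om_succ h).2] using he.KE i j

lemma KE_down (he : Sat v t e) {i j : Fin (n - 1)} (h : (j : ℕ) = (i : ℕ) + 1) :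
    e (.K j) * e (.E i) = ((v : k)⁻¹ * (t : k)⁻¹) • (e (.E i) * e (.K j)) := by
  simpa [dot, (Om_succ h).1, (Om_succ h).2] using he.KE j i

lemma K'F_up (he : Sat v t e) {i j : Fin (n - 1)} (h : (j : ℕ) = (i : ℕ) + 1) :
    e (.K' i) * e (.F j) = ((v : k)⁻¹ * (t : k)⁻¹) • (e (.F j) * e (.K' i)) := by
  simpa [dot, (Om_succ h).1, (Om_succ h).2] using he.K'F i j

lemma K'F_down (he : Sat v t e) {i j : Fin (n - 1)} (h : (j : ℕ) = (i : ℕ) + 1) :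
    e (.K' j) * e (.F i) = ((v : k)⁻¹ * t) • (e (.F i) * e (.K' j)) := by
  simpa [dot, (Om_succ h).1, (Om_succ h).2] using he.K'F j i

lemma KE_far (he : Sat v t e) {i j : Fin (n - 1)} (h : 1 < |(i : ℤ) - (j : ℤ)|) :
    e (.K i) * e (.E j) = e (.E j) * e (.K i) := by
  simpa [dot, (Om_far h).1, (Om_far h).2] using he.KE i j

lemma K'F_far (he : Sat v t e) {i j : Fin (n - 1)} (h : 1 < |(i : ℤ) - (j : ℤ)|) :
    e (.K' i) * e (.F j) = e (.F j) * e (.K' i) := by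
  simpa [dot, (Om_far h).1, (Om_far h).2] using he.K'F i j

lemma srrE₁ (he : Sat v t e) {i j : Fin (n - 1)} (h : (j : ℕ) = (i : ℕ) + 1) :
    srr (v : k) t (e (.E i)) (e (.E j)) = 0 := he.serre_E₁ i j h

lemma srrE₂ (he : Sat v t e) {i j : Fin (n - 1)} (h : (j : ℕ) = (i : ℕ) + 1) :
    srr (v : k) (t : k)⁻¹ (e (.E j)) (e (.E i)) = 0 := by
  have := he.serre_E₂ i j h
  rwa [srr_flip t.ne_zero, smul_eq_zero_iff_right (pow_ne_zero 2 t.ne_zero)] at this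

lemma srrF₁ (he : Sat v t e) {i j : Fin (n - 1)} (h : (j : ℕ) = (i : ℕ) + 1) :
    srr (v : k) (t : k)⁻¹ (e (.F i)) (e (.F j)) = 0 := he.serre_F₁ i j h

lemma srrF₂ (he : Sat v t e) {i j : Fin (n - 1)} (h : (j : ℕ) = (i : ℕ) + 1) :
    srr (v : k) t (e (.F j)) (e (.F i)) = 0 := by
  have := he.serre_F₂ i j h
  rwa [srr_flip (inv_ne_zero t.ne_zero), inv_inv,
    smul_eq_zero_iff_right (pow_ne_zero 2 (inv_ne_zero t.ne_zero))] at this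

end Sat

/-- The comultiplication on generators:
`K ↦ K ⊗ K`, `K' ↦ K' ⊗ K'`, `E ↦ E ⊗ 1 + K ⊗ E`, `F ↦ 1 ⊗ F + F ⊗ K'`. -/
def comulGen (e : Gen n → A) : Gen n → A ⊗[k] A
  | .E i => e (.E i) ⊗ₜ 1 + e (.K i) ⊗ₜ e (.E i)
  | .F i => 1 ⊗ₜ e (.F i) + e (.F i) ⊗ₜ e (.K' i)
  | .K i => e (.K i) ⊗ₜ e (.K i)
  | .Kinv i => e (.Kinv i) ⊗ₜ e (.Kinv i)
  | .K' i => e (.K' i) ⊗ₜ e (.K' i)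
  | .Kinv' i => e (.Kinv' i) ⊗ₜ e (.Kinv' i)

lemma comulGen_torus (e : Gen n → A) {x : Gen n} (hx : x.IsTorus) :
    comulGen (k := k) e x = e x ⊗ₜ e x := by
  cases x <;> first | rfl | exact hx.elim

lemma srr_tmul_left {v s : k} (a b : A) :
    srr v s (a ⊗ₜ[k] (1 : A)) (b ⊗ₜ 1) = srr v s a b ⊗ₜ[k] (1 : A) := by
  simp [srr, pow_two, TensorProduct.add_tmul, TensorProduct.sub_tmul, TensorProduct.smul_tmul']

lemma srr_tmul_right {v s : k} (a b : A) :
    srr v s ((1 : A) ⊗ₜ[k] a) (1 ⊗ₜ b) = (1 : A) ⊗ₜ[k] srr v s a b := by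
  simp [srr, pow_two, TensorProduct.tmul_add, TensorProduct.tmul_sub]

lemma srr_tmul_left' {v s : k} (a b g h : A) (hgh : g * h = h * g) :
    srr v s (a ⊗ₜ[k] g) (b ⊗ₜ h) = srr v s a b ⊗ₜ[k] (g * g * h) := by
  have h1 : g * h * g = g * g * h := by rw [mul_assoc, ← hgh, mul_assoc]
  have h2 : h * (g * g) = g * g * h := by rw [← mul_assoc, ← hgh, h1]
  simp [srr, pow_two, TensorProduct.add_tmul, TensorProduct.sub_tmul, TensorProduct.smul_tmul',
    h1, h2]

lemma srr_tmul_right' {v s : k} (a b g h : A) (hgh : g * h = h * g) :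
    srr v s (g ⊗ₜ[k] a) (h ⊗ₜ b) = (g * g * h) ⊗ₜ[k] srr v s a b := by
  have h1 : g * h * g = g * g * h := by rw [mul_assoc, ← hgh, mul_assoc]
  have h2 : h * (g * g) = g * g * h := by rw [← mul_assoc, ← hgh, h1]
  simp [srr, pow_two, TensorProduct.tmul_add, TensorProduct.tmul_sub, h1, h2]

lemma Sat.comm_KK (he : Sat v t e) (i j : Fin (n - 1)) :
    e (.K i) * e (.K j) = e (.K j) * e (.K i) := he.comm _ _ trivial trivial

lemma Sat.comm_K'K' (he : Sat v t e) (i j : Fin (n - 1)) :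
    e (.K' i) * e (.K' j) = e (.K' j) * e (.K' i) := he.comm _ _ trivial trivial

lemma Sat.comul_srrE (he : Sat v t e) {i j : Fin (n - 1)} {s : k} (hs : s ≠ 0)
    (h₁₂ : e (.K i) * e (.E j) = ((v : k)⁻¹ * s) • (e (.E j) * e (.K i)))
    (h₂₁ : e (.K j) * e (.E i) = ((v : k)⁻¹ * s⁻¹) • (e (.E i) * e (.K j)))
    (h : srr (v : k) s (e (.E i)) (e (.E j)) = 0) :
    srr (v : k) s (comulGen (k := k) e (.E i)) (comulGen (k := k) e (.E j)) = 0 := by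
  unfold comulGen
  rw [srr_add v.ne_zero hs, srr_tmul_left, srr_tmul_right' _ _ _ _ (he.comm_KK _ _), h]
  · simp
  · simp [he.KE_self, TensorProduct.smul_tmul']
  · simp [h₁₂, TensorProduct.smul_tmul']
  · simp [h₂₁, TensorProduct.smul_tmul']

lemma Sat.comul_srrF (he : Sat v t e) {i j : Fin (n - 1)} {s : k} (hs : s ≠ 0)
    (h₁₂ : e (.K' i) * e (.F j) = ((v : k)⁻¹ * s) • (e (.F j) * e (.K' i)))
    (h₂₁ : e (.K' j) * e (.F i) = ((v : k)⁻¹ * s⁻¹) • (e (.F i) * e (.K' j)))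
    (h : srr (v : k) s (e (.F i)) (e (.F j)) = 0) :
    srr (v : k) s (comulGen (k := k) e (.F i)) (comulGen (k := k) e (.F j)) = 0 := by
  unfold comulGen
  rw [srr_add v.ne_zero hs, srr_tmul_right, srr_tmul_left' _ _ _ _ (he.comm_K'K' _ _), h]
  · simp
  · simp [he.K'F_self]
  · simp [h₁₂]
  · simp [h₂₁]

lemma Sat.conj (he : Sat v t e) {x y z : Gen n} (hx : x.IsTorus) (hz : z.IsTorus)
    (hxy : e x * e y = 1) : e x * e z * e y = e z := by
  rw [he.comm _ _ hx hz, mul_assoc, hxy, mul_one]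

lemma Sat.comul (he : Sat v t e) : Sat v t (comulGen (k := k) e) where
  comm x y hx hy := by
    simp [comulGen_torus e hx, comulGen_torus e hy, he.comm x y hx hy]
  K_Kinv i := by simp [comulGen, he.K_Kinv, Algebra.TensorProduct.one_def]
  Kinv_K i := by simp [comulGen, he.Kinv_K, Algebra.TensorProduct.one_def]
  K'_Kinv' i := by simp [comulGen, he.K'_Kinv', Algebra.TensorProduct.one_def]
  Kinv'_K' i := by simp [comulGen, he.Kinv'_K', Algebra.TensorProduct.one_def]
  K_E i j := by
    simp only [comulGen, mul_add, add_mul, Algebra.TensorProduct.tmul_mul_tmul, he.K_E, mul_one,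
      he.K_Kinv, he.conj (x := .K i) (y := .Kinv i) (z := .K j) trivial trivial (he.K_Kinv i),
      smul_add, TensorProduct.tmul_smul, TensorProduct.smul_tmul']
  K'_E i j := by
    simp only [comulGen, mul_add, add_mul, Algebra.TensorProduct.tmul_mul_tmul, he.K'_E, mul_one,
      he.K'_Kinv', he.conj (x := .K' i) (y := .Kinv' i) (z := .K j) trivial trivial (he.K'_Kinv' i),
      smul_add, TensorProduct.tmul_smul, TensorProduct.smul_tmul']
  K_F i j := by
    simp only [comulGen, mul_add, add_mul, Algebra.TensorProduct.tmul_mul_tmul, he.K_F, mul_one,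
      he.K_Kinv, he.conj (x := .K i) (y := .Kinv i) (z := .K' j) trivial trivial (he.K_Kinv i),
      smul_add, TensorProduct.tmul_smul, TensorProduct.smul_tmul']
  K'_F i j := by
    simp only [comulGen, mul_add, add_mul, Algebra.TensorProduct.tmul_mul_tmul, he.K'_F, mul_one,
      he.K'_Kinv', he.conj (x := .K' i) (y := .Kinv' i) (z := .K' j) trivial trivial (he.K'_Kinv' i),
      smul_add, TensorProduct.tmul_smul, TensorProduct.smul_tmul']
  E_F i j := by
    have h1 : (e (.K i) * e (.F j)) ⊗ₜ[k] (e (.E i) * e (.K' j)) =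
        (e (.F j) * e (.K i)) ⊗ₜ[k] (e (.K' j) * e (.E i)) := by
      rw [he.KF, he.K'E, TensorProduct.tmul_smul, TensorProduct.smul_tmul']
      congr 3
      rw [dot, dot, add_comm (Om j i)]
    have h2 : comulGen (k := k) e (.E i) * comulGen e (.F j) -
        comulGen e (.F j) * comulGen e (.E i) =
        (e (.E i) * e (.F j) - e (.F j) * e (.E i)) ⊗ₜ e (.K' j) +
        e (.K i) ⊗ₜ (e (.E i) * e (.F j) - e (.F j) * e (.E i)) := by
      simp only [comulGen, mul_add, add_mul, Algebra.TensorProduct.tmul_mul_tmul, mul_one, one_mul,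
        TensorProduct.tmul_sub, TensorProduct.sub_tmul, h1]
      abel
    rw [h2, he.E_F]
    split_ifs with h
    · subst h
      rw [← TensorProduct.smul_tmul', TensorProduct.tmul_smul, ← smul_add,
        TensorProduct.sub_tmul, TensorProduct.tmul_sub]
      simp only [comulGen]
      congr 1
      abel
    · simp
  E_E i j h := by
    have h' : 1 < |(j : ℤ) - (i : ℤ)| := by rwa [abs_sub_comm]
    have h1 := sub_eq_zero.1 (he.E_E i j h)
    simp only [comulGen, mul_add, add_mul, Algebra.TensorProduct.tmul_mul_tmul, mul_one, one_mul,
      he.KE_far h, he.KE_far h', h1, he.comm_KK i j]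
    abel
  F_F i j h := by
    have h' : 1 < |(j : ℤ) - (i : ℤ)| := by rwa [abs_sub_comm]
    have h1 := sub_eq_zero.1 (he.F_F i j h)
    simp only [comulGen, mul_add, add_mul, Algebra.TensorProduct.tmul_mul_tmul, mul_one, one_mul,
      he.K'F_far h, he.K'F_far h', h1, he.comm_K'K' i j]
    abel
  serre_E₁ i j h := he.comul_srrE t.ne_zero (he.KE_up h) (he.KE_down h) (he.srrE₁ h)
  serre_E₂ i j h := by
    rw [srr_flip t.ne_zero, he.comul_srrE (inv_ne_zero t.ne_zero) (he.KE_down h)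
      (by simpa using he.KE_up h) (he.srrE₂ h), smul_zero]
  serre_F₁ i j h := he.comul_srrF (inv_ne_zero t.ne_zero) (he.K'F_up h)
    (by simpa using he.K'F_down h) (he.srrF₁ h)
  serre_F₂ i j h := by
    rw [srr_flip (inv_ne_zero t.ne_zero), inv_inv, he.comul_srrF t.ne_zero (he.K'F_down h)
      (he.K'F_up h) (he.srrF₂ h), smul_zero]

/-- The counit on generators: `1` on `K^{±1}`, `K'^{±1}`, and `0` on `E`, `F`. -/
def counitGen (k : Type*) [Field k] {n : ℕ} : Gen n → k
  | .E _ => 0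
  | .F _ => 0
  | _ => 1

lemma sat_counit (v t : kˣ) : Sat v t (counitGen k (n := n)) where
  comm x y hx hy := mul_comm _ _
  K_Kinv i := by simp [counitGen]
  Kinv_K i := by simp [counitGen]
  K'_Kinv' i := by simp [counitGen]
  Kinv'_K' i := by simp [counitGen]
  K_E i j := by simp [counitGen]
  K'_E i j := by simp [counitGen]
  K_F i j := by simp [counitGen]
  K'_F i j := by simp [counitGen]
  E_F i j := by simp [counitGen]
  E_E i j h := by simp [counitGen]
  F_F i j h := by simp [counitGen]
  serre_E₁ i j h := by simp [counitGen]
  serre_E₂ i j h := by simp [counitGen]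
  serre_F₁ i j h := by simp [counitGen]
  serre_F₂ i j h := by simp [counitGen]

/-- The antipode on generators, with values in the opposite algebra:
`K ↦ K⁻¹`, `K' ↦ K'⁻¹`, `E ↦ -K⁻¹ E`, `F ↦ -F K'⁻¹`. -/
def antipodeGen (e : Gen n → A) : Gen n → Aᵐᵒᵖ
  | .E i => .op (-(e (.Kinv i) * e (.E i)))
  | .F i => .op (-(e (.F i) * e (.Kinv' i)))
  | .K i => .op (e (.Kinv i))
  | .Kinv i => .op (e (.K i))
  | .K' i => .op (e (.Kinv' i))
  | .Kinv' i => .op (e (.K' i))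

lemma inv_comm_of {g h x : A} {c : k} (hgh : g * h = 1) (hhg : h * g = 1)
    (hc : g * x = c • (x * g)) : x * h = c • (h * x) := by
  calc x * h = h * (g * x) * h := by rw [← mul_assoc, hhg, one_mul]
    _ = c • (h * x) := by
      rw [hc, mul_smul_comm, smul_mul_assoc, mul_assoc, mul_assoc, hgh, mul_one]

lemma Sat.EKinv (he : Sat v t e) {i j : Fin (n - 1)} {c : k}
    (h : e (.K i) * e (.E j) = c • (e (.E j) * e (.K i))) :
    e (.E j) * e (.Kinv i) = c • (e (.Kinv i) * e (.E j)) :=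
  inv_comm_of (he.K_Kinv i) (he.Kinv_K i) h

lemma Sat.FKinv' (he : Sat v t e) {i j : Fin (n - 1)} {c : k}
    (h : e (.K' i) * e (.F j) = c • (e (.F j) * e (.K' i))) :
    e (.F j) * e (.Kinv' i) = c • (e (.Kinv' i) * e (.F j)) :=
  inv_comm_of (he.K'_Kinv' i) (he.Kinv'_K' i) h

lemma Sat.anti_srrE (he : Sat v t e) {i j : Fin (n - 1)} {s : k} (hs : s ≠ 0)
    (h₁₂ : e (.K i) * e (.E j) = ((v : k)⁻¹ * s) • (e (.E j) * e (.K i)))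
    (h₂₁ : e (.K j) * e (.E i) = ((v : k)⁻¹ * s⁻¹) • (e (.E i) * e (.K j)))
    (h : srr (v : k) s (e (.E i)) (e (.E j)) = 0) :
    srr (v : k) s (antipodeGen e (.E i)) (antipodeGen e (.E j)) = 0 :=
  srr_anti v.ne_zero hs (he.comm _ _ trivial trivial) (he.EKinv (he.KE_self i))
    (he.EKinv h₁₂) (he.EKinv h₂₁) h

lemma Sat.anti_srrF (he : Sat v t e) {i j : Fin (n - 1)} {s : k} (hs : s ≠ 0)
    (h₁₂ : e (.K' i) * e (.F j) = ((v : k)⁻¹ * s) • (e (.F j) * e (.K' i)))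
    (h₂₁ : e (.K' j) * e (.F i) = ((v : k)⁻¹ * s⁻¹) • (e (.F i) * e (.K' j)))
    (h : srr (v : k) s (e (.F i)) (e (.F j)) = 0) :
    srr (v : k) s (antipodeGen e (.F i)) (antipodeGen e (.F j)) = 0 := by
  have := srr_anti v.ne_zero hs (he.comm (.Kinv' i) (.Kinv' j) trivial trivial)
    (he.FKinv' (he.K'F_self i)) (he.FKinv' h₁₂) (he.FKinv' h₂₁) h
  simp only [antipodeGen]
  rw [he.FKinv' (he.K'F_self i), he.FKinv' (he.K'F_self j), ← smul_neg, ← smul_neg,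
    MulOpposite.op_smul, MulOpposite.op_smul, srr_smul, this, smul_zero]

lemma Sat.anti (he : Sat v t e) : Sat v t (antipodeGen e) where
  comm x y hx hy := by
    apply MulOpposite.unop_injective
    cases x <;> cases y <;> first | exact hx.elim | exact hy.elim |
      exact he.comm _ _ trivial trivial
  K_Kinv i := congrArg MulOpposite.op (he.K_Kinv i)
  Kinv_K i := congrArg MulOpposite.op (he.Kinv_K i)
  K'_Kinv' i := congrArg MulOpposite.op (he.K'_Kinv' i)
  Kinv'_K' i := congrArg MulOpposite.op (he.Kinv'_K' i)
  K_E i j := by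
    apply MulOpposite.unop_injective
    simp only [antipodeGen, MulOpposite.unop_mul, MulOpposite.unop_op, MulOpposite.unop_smul,
      neg_mul, mul_neg, smul_neg, neg_inj]
    rw [← mul_smul_comm, ← he.K_E, ← mul_assoc, ← mul_assoc, ← mul_assoc,
      he.comm (.K i) (.Kinv j) trivial trivial, mul_assoc (e (.Kinv j))]
  K'_E i j := by
    apply MulOpposite.unop_injective
    simp only [antipodeGen, MulOpposite.unop_mul, MulOpposite.unop_op, MulOpposite.unop_smul,
      neg_mul, mul_neg, smul_neg, neg_inj]
    rw [← mul_smul_comm, ← he.K'_E, ← mul_assoc, ← mul_assoc, ← mul_assoc,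
      he.comm (.K' i) (.Kinv j) trivial trivial, mul_assoc (e (.Kinv j))]
  K_F i j := by
    apply MulOpposite.unop_injective
    simp only [antipodeGen, MulOpposite.unop_mul, MulOpposite.unop_op, MulOpposite.unop_smul,
      neg_mul, mul_neg, smul_neg, neg_inj]
    rw [← smul_mul_assoc, ← he.K_F, mul_assoc, mul_assoc, mul_assoc,
      he.comm (.Kinv i) (.Kinv' j) trivial trivial]
  K'_F i j := by
    apply MulOpposite.unop_injective
    simp only [antipodeGen, MulOpposite.unop_mul, MulOpposite.unop_op, MulOpposite.unop_smul,
      neg_mul, mul_neg, smul_neg, neg_inj]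
    rw [← smul_mul_assoc, ← he.K'_F, mul_assoc, mul_assoc, mul_assoc,
      he.comm (.Kinv' i) (.Kinv' j) trivial trivial]
  E_F i j := by
    apply MulOpposite.unop_injective
    have h1 := inv_comm_of (he.K_Kinv i) (he.Kinv_K i) (he.KF i j)
    have h2 := inv_comm_of (he.K'_Kinv' j) (he.Kinv'_K' j) (he.K'E j i)
    have hc : v ^ (-dot i j) * t ^ (Om j i - Om i j) = v ^ (-dot j i) * t ^ (Om j i - Om i j) := by
      rw [dot, dot, add_comm (Om j i)]
    have h3 : e (.F j) * e (.Kinv' j) * (e (.Kinv i) * e (.E i)) =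
        e (.Kinv i) * (e (.F j) * e (.E i)) * e (.Kinv' j) := by
      rw [mul_assoc, ← mul_assoc (e (.Kinv' j)), he.comm (.Kinv' j) (.Kinv i) trivial trivial,
        mul_assoc (e (.Kinv i)), ← mul_assoc (e (.F j)), h1, smul_mul_assoc, mul_assoc,
        mul_assoc (e (.Kinv i)), mul_assoc (e (.F j)), h2, mul_smul_comm, mul_smul_comm, hc]
    have h4 : MulOpposite.unop (antipodeGen e (.E i) * antipodeGen e (.F j) -
        antipodeGen e (.F j) * antipodeGen e (.E i)) =
        -(e (.Kinv i) * (e (.E i) * e (.F j) - e (.F j) * e (.E i)) * e (.Kinv' j)) := by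
      simp only [antipodeGen, MulOpposite.unop_mul, MulOpposite.unop_op, MulOpposite.unop_sub,
        neg_mul, mul_neg, neg_neg, h3, mul_sub, sub_mul]
      simp only [mul_assoc]
      abel
    rw [h4, he.E_F]
    split_ifs with h
    · subst h
      simp only [antipodeGen, MulOpposite.unop_smul, MulOpposite.unop_op, MulOpposite.unop_sub,
        mul_smul_comm, smul_mul_assoc, mul_sub, sub_mul, he.Kinv_K, one_mul, mul_assoc,
        he.K'_Kinv', mul_one, ← smul_neg, neg_sub]
    · simp
  E_E i j h := by
    have h' : 1 < |(j : ℤ) - (i : ℤ)| := by rwa [abs_sub_comm]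
    have h1 := sub_eq_zero.1 (he.E_E i j h)
    have h2 := he.EKinv (c := 1) (by simpa using he.KE_far h)
    have h3 := he.EKinv (c := 1) (by simpa using he.KE_far h')
    rw [one_smul] at h2 h3
    have c1 : Commute (e (.Kinv i) * e (.E i)) (e (.Kinv j) * e (.E j)) := by
      apply Commute.mul_left <;> apply Commute.mul_right
      · exact he.comm _ _ trivial trivial
      · exact h2.symm
      · exact h3
      · exact h1
    apply MulOpposite.unop_injective
    simp [antipodeGen, c1.eq]
  F_F i j h := by
    have h' : 1 < |(j : ℤ) - (i : ℤ)| := by rwa [abs_sub_comm]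
    have h1 := sub_eq_zero.1 (he.F_F i j h)
    have h2 := he.FKinv' (c := 1) (by simpa using he.K'F_far h)
    have h3 := he.FKinv' (c := 1) (by simpa using he.K'F_far h')
    rw [one_smul] at h2 h3
    have c1 : Commute (e (.F i) * e (.Kinv' i)) (e (.F j) * e (.Kinv' j)) := by
      apply Commute.mul_left <;> apply Commute.mul_right
      · exact h1
      · exact h3
      · exact h2.symm
      · exact he.comm _ _ trivial trivial
    apply MulOpposite.unop_injective
    simp [antipodeGen, c1.eq]
  serre_E₁ i j h := he.anti_srrE t.ne_zero (he.KE_up h) (he.KE_down h) (he.srrE₁ h)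
  serre_E₂ i j h := by
    rw [srr_flip t.ne_zero, he.anti_srrE (inv_ne_zero t.ne_zero) (he.KE_down h)
      (by simpa using he.KE_up h) (he.srrE₂ h), smul_zero]
  serre_F₁ i j h := he.anti_srrF (inv_ne_zero t.ne_zero) (he.K'F_up h)
    (by simpa using he.K'F_down h) (he.srrF₁ h)
  serre_F₂ i j h := by
    rw [srr_flip (inv_ne_zero t.ne_zero), inv_inv, he.anti_srrF t.ne_zero (he.K'F_down h)
      (he.K'F_up h) (he.srrF₂ h), smul_zero]

end QAlg
end TwoParam

namespace TwoParam

variable {k : Type*} [Field k]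

section antipode

variable {A : Type*} [Ring A] [Bialgebra k A]

open Coalgebra

/-- An algebra anti-endomorphism of a bialgebra which satisfies the antipode axioms on a
generating set is an antipode. -/
abbrev hopfOfAnti (S : A →ₐ[k] Aᵐᵒᵖ) (s : Set A) (hs : Algebra.adjoin k s = ⊤)
    (h₁ : ∀ x ∈ s, LinearMap.mul' k A (((MulOpposite.opLinearEquiv k).symm.toLinearMap ∘ₗ
      S.toLinearMap).rTensor A (comul (R := k) x)) = algebraMap k A (counit x))
    (h₂ : ∀ x ∈ s, LinearMap.mul' k A (((MulOpposite.opLinearEquiv k).symm.toLinearMap ∘ₗ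
      S.toLinearMap).lTensor A (comul (R := k) x)) = algebraMap k A (counit x)) :
    HopfAlgebra k A where
  antipode := (MulOpposite.opLinearEquiv k).symm.toLinearMap ∘ₗ S.toLinearMap
  mul_antipode_rTensor_comul := by
    ext x
    have hx : x ∈ Algebra.adjoin k s := hs ▸ Algebra.mem_top
    change LinearMap.mul' k A (_root_.LinearMap.rTensor A _ (comul (R := k) x)) =
      algebraMap k A (counit x)
    induction hx using Algebra.adjoin_induction with
    | mem x hx => exact h₁ x hx
    | algebraMap r =>
      simp [Bialgebra.comul_algebraMap, Algebra.TensorProduct.algebraMap_apply]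
    | add x y _ _ hx hy => simp only [map_add, hx, hy]
    | mul x y _ _ hx hy =>
      have key (u w : A ⊗[k] A) : LinearMap.mul' k A
          (((MulOpposite.opLinearEquiv k).symm.toLinearMap ∘ₗ S.toLinearMap).rTensor A u) =
          algebraMap k A (counit x) → LinearMap.mul' k A
          (((MulOpposite.opLinearEquiv k).symm.toLinearMap ∘ₗ S.toLinearMap).rTensor A (u * w)) =
          algebraMap k A (counit x) * LinearMap.mul' k A
          (((MulOpposite.opLinearEquiv k).symm.toLinearMap ∘ₗ S.toLinearMap).rTensor A w) := by
        intro hu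
        induction w with
        | zero => simp
        | add w₁ w₂ h₁ h₂ => simp only [mul_add, map_add, h₁, h₂]
        | tmul a b =>
          have : LinearMap.mul' k A (((MulOpposite.opLinearEquiv k).symm.toLinearMap ∘ₗ
              S.toLinearMap).rTensor A (u * a ⊗ₜ b)) = (S a).unop * LinearMap.mul' k A
              (((MulOpposite.opLinearEquiv k).symm.toLinearMap ∘ₗ S.toLinearMap).rTensor A u) * b
              := by
            clear hu
            induction u with
            | zero => simp
            | add w₁ w₂ h₁ h₂ => simp only [mul_add, add_mul, map_add, h₁, h₂]
            | tmul c d => simp [mul_assoc]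
          rw [this, hu, ← Algebra.commutes]
          simp [mul_assoc]
      rw [Bialgebra.comul_mul, key _ _ hx, hy, Bialgebra.counit_mul, map_mul]
  mul_antipode_lTensor_comul := by
    ext x
    have hx : x ∈ Algebra.adjoin k s := hs ▸ Algebra.mem_top
    change LinearMap.mul' k A (_root_.LinearMap.lTensor A _ (comul (R := k) x)) =
      algebraMap k A (counit x)
    induction hx using Algebra.adjoin_induction with
    | mem x hx => exact h₂ x hx
    | algebraMap r =>
      simp [Bialgebra.comul_algebraMap, Algebra.TensorProduct.algebraMap_apply]
    | add x y _ _ hx hy => simp only [map_add, hx, hy]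
    | mul x y _ _ hx hy =>
      have key (u w : A ⊗[k] A) : LinearMap.mul' k A
          (((MulOpposite.opLinearEquiv k).symm.toLinearMap ∘ₗ S.toLinearMap).lTensor A w) =
          algebraMap k A (counit y) → LinearMap.mul' k A
          (((MulOpposite.opLinearEquiv k).symm.toLinearMap ∘ₗ S.toLinearMap).lTensor A (u * w)) =
          LinearMap.mul' k A (((MulOpposite.opLinearEquiv k).symm.toLinearMap ∘ₗ
            S.toLinearMap).lTensor A u) * algebraMap k A (counit y) := by
        intro hu
        induction u with
        | zero => simp
        | add w₁ w₂ h₁ h₂ => simp only [add_mul, map_add, h₁, h₂]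
        | tmul a b =>
          have : LinearMap.mul' k A (((MulOpposite.opLinearEquiv k).symm.toLinearMap ∘ₗ
              S.toLinearMap).lTensor A (a ⊗ₜ b * w)) = a * LinearMap.mul' k A
              (((MulOpposite.opLinearEquiv k).symm.toLinearMap ∘ₗ S.toLinearMap).lTensor A w) *
              (S b).unop := by
            clear hu
            induction w with
            | zero => simp
            | add w₁ w₂ h₁ h₂ => simp only [mul_add, add_mul, map_add, h₁, h₂]
            | tmul c d => simp [mul_assoc]
          rw [this, hu, mul_assoc, Algebra.commutes]
          simp [mul_assoc]
      rw [Bialgebra.comul_mul, key _ _ hy, hx, Bialgebra.counit_mul, map_mul]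

end antipode

namespace QAlg

open Coalgebra

variable (v t : kˣ) (n : ℕ)

instance : Bialgebra k (QAlg v t n) :=
  Bialgebra.ofAlgHom (lift _ (sat_of v t).comul) (lift _ (sat_counit v t))
    (by
      apply hom_ext
      intro x
      cases x <;> simp [comulGen, TensorProduct.add_tmul, TensorProduct.tmul_add, add_assoc,
        Algebra.TensorProduct.one_def])
    (by
      apply hom_ext
      intro x
      cases x <;> simp [comulGen, counitGen])
    (by
      apply hom_ext
      intro x
      cases x <;> simp [comulGen, counitGen])

variable {n}

lemma comul_of (x : Gen n) : comul (R := k) (of v t x) = comulGen (of v t) x :=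
  lift_of _ _ x

lemma counit_of (x : Gen n) : counit (R := k) (of v t x) = counitGen k x :=
  lift_of _ _ x

variable (n)

instance : HopfAlgebra k (QAlg v t n) :=
  hopfOfAnti (lift _ (sat_of v t).anti) _ adjoin_of
    (by
      rintro _ ⟨x, rfl⟩
      rw [comul_of, counit_of]
      have h := sat_of v t (n := n)
      cases x <;> simp [comulGen, counitGen, antipodeGen, h.K_Kinv, h.Kinv_K, h.K'_Kinv',
        h.Kinv'_K', mul_assoc])
    (by
      rintro _ ⟨x, rfl⟩
      rw [comul_of, counit_of]
      have h := sat_of v t (n := n)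
      have h1 (i : Fin (n - 1)) (z : QAlg v t n) : of v t (.K i) * (of v t (.Kinv i) * z) = z := by
        rw [← mul_assoc, h.K_Kinv, one_mul]
      cases x <;> simp [comulGen, counitGen, antipodeGen, h.K_Kinv, h.Kinv_K, h.K'_Kinv',
        h.Kinv'_K', h1])

variable {n}

lemma antipode_of (x : Gen n) :
    HopfAlgebra.antipode k (of v t x) = (antipodeGen (of v t) x).unop :=
  congrArg MulOpposite.unop (lift_of _ _ x)

end QAlg

end TwoParam

namespace TwoParam

variable {k : Type*} [Field k]

section sub

open Coalgebra

variable {A : Type*} [Ring A] [HopfAlgebra k A]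

/-- A subalgebra of a Hopf algebra is a Hopf subalgebra if `Δ(B) ⊆ B ⊗ B` and `S(B) ⊆ B`. -/
class IsHopfSub (B : Subalgebra k A) : Prop where
  comul_mem : ∀ b ∈ B, comul (R := k) b ∈ (Algebra.TensorProduct.map B.val B.val).range
  antipode_mem : ∀ b ∈ B, HopfAlgebra.antipode k b ∈ B

namespace IsHopfSub

variable (B : Subalgebra k A)

lemma map_val_injective : Function.Injective (Algebra.TensorProduct.map B.val B.val) :=
  TensorProduct.map_injective_of_flat_flat B.val.toLinearMap B.val.toLinearMap
    Subtype.val_injective Subtype.val_injective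

lemma map_val_val_injective : Function.Injective
    (Algebra.TensorProduct.map B.val (Algebra.TensorProduct.map B.val B.val)) :=
  TensorProduct.map_injective_of_flat_flat B.val.toLinearMap
    (Algebra.TensorProduct.map B.val B.val).toLinearMap
    Subtype.val_injective (map_val_injective B)

/-- The comultiplication of a Hopf subalgebra, the restriction of that of the Hopf algebra. -/
def comulHom [IsHopfSub B] : B →ₐ[k] B ⊗[k] B :=
  (AlgEquiv.ofInjective _ (map_val_injective B)).symm.toAlgHom.comp
    (((Bialgebra.comulAlgHom k A).comp B.val).codRestrict _ fun b => comul_mem b.1 b.2)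

lemma map_comulHom [IsHopfSub B] (b : B) :
    Algebra.TensorProduct.map B.val B.val (comulHom B b) = comul (R := k) (b : A) := by
  exact congrArg Subtype.val (AlgEquiv.apply_symm_apply
    (AlgEquiv.ofInjective _ (map_val_injective B))
    ((((Bialgebra.comulAlgHom k A).comp B.val).codRestrict _ fun b => comul_mem b.1 b.2) b))

instance [IsHopfSub B] : Bialgebra k B :=
  Bialgebra.ofAlgHom (comulHom B) ((Bialgebra.counitAlgHom k A).comp B.val)
    (by
      ext b
      apply map_val_val_injective B
      have h1 (u : B ⊗[k] B) : Algebra.TensorProduct.map B.val (Algebra.TensorProduct.map B.val B.val)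
          (Algebra.TensorProduct.assoc k k k B B B (Algebra.TensorProduct.map (comulHom B) (.id k B) u))
          = TensorProduct.assoc k A A A ((comul (R := k)).rTensor A
            (Algebra.TensorProduct.map B.val B.val u)) := by
        induction u with
        | zero => simp
        | add x y hx hy => simp only [map_add, hx, hy]
        | tmul x y =>
          simp only [Algebra.TensorProduct.map_tmul, AlgHom.coe_id, id_eq,
            _root_.LinearMap.rTensor_tmul]
          rw [Subalgebra.coe_val, ← map_comulHom]
          generalize comulHom B x = w
          induction w with
          | zero => simp
          | add x y hx hy => simp only [map_add, TensorProduct.add_tmul, hx, hy]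
          | tmul x y => simp
      have h2 (u : B ⊗[k] B) : Algebra.TensorProduct.map B.val (Algebra.TensorProduct.map B.val B.val)
          (Algebra.TensorProduct.map (.id k B) (comulHom B) u)
          = (comul (R := k)).lTensor A (Algebra.TensorProduct.map B.val B.val u) := by
        induction u with
        | zero => simp
        | add x y hx hy => simp only [map_add, hx, hy]
        | tmul x y => simp [map_comulHom]
      refine (h1 _).trans (Eq.trans ?_ (h2 _).symm)
      erw [map_comulHom]
      exact coassoc_apply _)
    (by
      ext b
      have h1 (u : B ⊗[k] B) : (B.val.toLinearMap.lTensor k)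
          (Algebra.TensorProduct.map ((Bialgebra.counitAlgHom k A).comp B.val) (.id k B) u) =
          (counit (R := k)).rTensor A (Algebra.TensorProduct.map B.val B.val u) := by
        induction u with
        | zero => simp
        | add x y hx hy => simp only [map_add, hx, hy]
        | tmul x y => simp
      apply (Module.Flat.lTensor_preserves_injective_linearMap (M := k) B.val.toLinearMap
        Subtype.val_injective)
      refine (h1 _).trans ?_
      erw [map_comulHom]
      exact rTensor_counit_comul _)
    (by
      ext b
      have h1 (u : B ⊗[k] B) : (B.val.toLinearMap.rTensor k)
          (Algebra.TensorProduct.map (.id k B) ((Bialgebra.counitAlgHom k A).comp B.val) u) =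
          (counit (R := k)).lTensor A (Algebra.TensorProduct.map B.val B.val u) := by
        induction u with
        | zero => simp
        | add x y hx hy => simp only [map_add, hx, hy]
        | tmul x y => simp
      apply (Module.Flat.rTensor_preserves_injective_linearMap (M := k) B.val.toLinearMap
        Subtype.val_injective)
      refine (h1 _).trans ?_
      erw [map_comulHom]
      exact lTensor_counit_comul _)

lemma map_comul [IsHopfSub B] (b : B) :
    Algebra.TensorProduct.map B.val B.val (comul (R := k) b) = comul (R := k) (b : A) :=
  map_comulHom B b

lemma counit_coe [IsHopfSub B] (b : B) : counit (R := k) b = counit (R := k) (b : A) := rfl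

instance [IsHopfSub B] : HopfAlgebra k B where
  antipode := ((HopfAlgebra.antipode k).comp B.val.toLinearMap).codRestrict
    (Subalgebra.toSubmodule B) fun b => antipode_mem b.1 b.2
  mul_antipode_rTensor_comul := by
    ext b
    have h1 (u : B ⊗[k] B) : ((LinearMap.mul' k B ((((HopfAlgebra.antipode k).comp
        B.val.toLinearMap).codRestrict (Subalgebra.toSubmodule B)
          fun b => antipode_mem b.1 b.2).rTensor B u) : B) : A) =
        LinearMap.mul' k A ((HopfAlgebra.antipode k).rTensor A
          (Algebra.TensorProduct.map B.val B.val u)) := by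
      induction u with
      | zero => simp
      | add x y hx hy => simp only [map_add, Subalgebra.coe_add, hx, hy]
      | tmul x y => rfl
    refine (h1 _).trans ?_
    rw [map_comul, HopfAlgebra.mul_antipode_rTensor_comul_apply]
    rfl
  mul_antipode_lTensor_comul := by
    ext b
    have h1 (u : B ⊗[k] B) : ((LinearMap.mul' k B ((((HopfAlgebra.antipode k).comp
        B.val.toLinearMap).codRestrict (Subalgebra.toSubmodule B)
          fun b => antipode_mem b.1 b.2).lTensor B u) : B) : A) =
        LinearMap.mul' k A ((HopfAlgebra.antipode k).lTensor A
          (Algebra.TensorProduct.map B.val B.val u)) := by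
      induction u with
      | zero => simp
      | add x y hx hy => simp only [map_add, Subalgebra.coe_add, hx, hy]
      | tmul x y => rfl
    refine (h1 _).trans ?_
    rw [map_comul, HopfAlgebra.mul_antipode_lTensor_comul_apply]
    rfl

lemma of_adjoin (s : Set A)
    (h₁ : ∀ x ∈ s, comul (R := k) x ∈ (Algebra.TensorProduct.map (Algebra.adjoin k s).val
      (Algebra.adjoin k s).val).range)
    (h₂ : ∀ x ∈ s, HopfAlgebra.antipode k x ∈ Algebra.adjoin k s) :
    IsHopfSub (Algebra.adjoin k s) where
  comul_mem b hb := by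
    induction hb using Algebra.adjoin_induction with
    | mem x hx => exact h₁ x hx
    | algebraMap r =>
      rw [Bialgebra.comul_algebraMap]
      exact Subalgebra.algebraMap_mem _ _
    | add x y _ _ hx hy => rw [map_add]; exact add_mem hx hy
    | mul x y _ _ hx hy => rw [Bialgebra.comul_mul]; exact mul_mem hx hy
  antipode_mem b hb := by
    induction hb using Algebra.adjoin_induction with
    | mem x hx => exact h₂ x hx
    | algebraMap r =>
      rw [Algebra.algebraMap_eq_smul_one, map_smul, HopfAlgebra.antipode_one]
      exact Subalgebra.smul_mem _ (one_mem _) _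
    | add x y _ _ hx hy => rw [map_add]; exact add_mem hx hy
    | mul x y _ _ hx hy => rw [HopfAlgebra.antipode_mul_antidistrib]; exact mul_mem hy hx

lemma tmul_mem_range {B : Subalgebra k A} {x y : A} (hx : x ∈ B) (hy : y ∈ B) :
    x ⊗ₜ[k] y ∈ (Algebra.TensorProduct.map B.val B.val).range :=
  ⟨⟨x, hx⟩ ⊗ₜ ⟨y, hy⟩, rfl⟩

end IsHopfSub

end sub

namespace QAlg

variable (v t : kˣ) (n : ℕ)

/-- The generators `E_i`, `K_i^{±1}`. -/
inductive PosGen : QAlg v t n → Prop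
  | E (i : Fin (n - 1)) : PosGen (E v t i)
  | K (i : Fin (n - 1)) : PosGen (K v t i)
  | Kinv (i : Fin (n - 1)) : PosGen (Kinv v t i)

/-- The generators `F_i`, `K_i'^{±1}`. -/
inductive NegGen : QAlg v t n → Prop
  | F (i : Fin (n - 1)) : NegGen (F v t i)
  | K' (i : Fin (n - 1)) : NegGen (K' v t i)
  | Kinv' (i : Fin (n - 1)) : NegGen (Kinv' v t i)

/-- The subalgebra generated by `E_i`, `K_i^{±1}`. -/
def BPos : Subalgebra k (QAlg v t n) := Algebra.adjoin k {x | PosGen v t n x}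

/-- The subalgebra generated by `F_i`, `K_i'^{±1}`. -/
def BNeg : Subalgebra k (QAlg v t n) := Algebra.adjoin k {x | NegGen v t n x}

variable {n}

lemma E_mem (i : Fin (n - 1)) : E v t i ∈ BPos v t n := Algebra.subset_adjoin (.E i)
lemma K_mem (i : Fin (n - 1)) : K v t i ∈ BPos v t n := Algebra.subset_adjoin (.K i)
lemma Kinv_mem (i : Fin (n - 1)) : Kinv v t i ∈ BPos v t n := Algebra.subset_adjoin (.Kinv i)
lemma F_mem (i : Fin (n - 1)) : F v t i ∈ BNeg v t n := Algebra.subset_adjoin (.F i)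
lemma K'_mem (i : Fin (n - 1)) : K' v t i ∈ BNeg v t n := Algebra.subset_adjoin (.K' i)
lemma Kinv'_mem (i : Fin (n - 1)) : Kinv' v t i ∈ BNeg v t n := Algebra.subset_adjoin (.Kinv' i)

variable (n)

instance : IsHopfSub (BPos v t n) := by
  refine IsHopfSub.of_adjoin _ ?_ ?_
  · rintro _ (i | i | i)
    · rw [E, comul_of]
      exact add_mem (IsHopfSub.tmul_mem_range (E_mem v t i) (one_mem _))
        (IsHopfSub.tmul_mem_range (K_mem v t i) (E_mem v t i))
    · rw [K, comul_of]
      exact IsHopfSub.tmul_mem_range (K_mem v t i) (K_mem v t i)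
    · rw [Kinv, comul_of]
      exact IsHopfSub.tmul_mem_range (Kinv_mem v t i) (Kinv_mem v t i)
  · rintro _ (i | i | i)
    · rw [E, antipode_of]
      exact neg_mem (mul_mem (Kinv_mem v t i) (E_mem v t i))
    · rw [K, antipode_of]
      exact Kinv_mem v t i
    · rw [Kinv, antipode_of]
      exact K_mem v t i

instance : IsHopfSub (BNeg v t n) := by
  refine IsHopfSub.of_adjoin _ ?_ ?_
  · rintro _ (i | i | i)
    · rw [F, comul_of]
      exact add_mem (IsHopfSub.tmul_mem_range (one_mem _) (F_mem v t i))
        (IsHopfSub.tmul_mem_range (F_mem v t i) (K'_mem v t i))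
    · rw [K', comul_of]
      exact IsHopfSub.tmul_mem_range (K'_mem v t i) (K'_mem v t i)
    · rw [Kinv', comul_of]
      exact IsHopfSub.tmul_mem_range (Kinv'_mem v t i) (Kinv'_mem v t i)
  · rintro _ (i | i | i)
    · rw [F, antipode_of]
      exact neg_mem (mul_mem (F_mem v t i) (Kinv'_mem v t i))
    · rw [K', antipode_of]
      exact Kinv'_mem v t i
    · rw [Kinv', antipode_of]
      exact K'_mem v t i

end QAlg

end TwoParam

namespace TwoParam

open Coalgebra TensorProduct

section conv

variable {k C : Type*} [CommRing k] [AddCommGroup C] [Module k C] [Coalgebra k C]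

/-- `c ↦ Q(c₍₁₎) c₍₂₎`. -/
def convL (Q : C →ₗ[k] k) : C →ₗ[k] C :=
  (TensorProduct.lid k C).toLinearMap ∘ₗ Q.rTensor C ∘ₗ comul

/-- `c ↦ c₍₁₎ P(c₍₂₎)`. -/
def convR (P : C →ₗ[k] k) : C →ₗ[k] C :=
  (TensorProduct.rid k C).toLinearMap ∘ₗ P.lTensor C ∘ₗ comul

lemma convL_apply (Q : C →ₗ[k] k) (c : C) :
    convL Q c = TensorProduct.lid k C (Q.rTensor C (comul c)) := rfl

lemma convR_apply (Q : C →ₗ[k] k) (c : C) :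
    convR Q c = TensorProduct.rid k C (Q.lTensor C (comul c)) := rfl

lemma comul_convR (P : C →ₗ[k] k) (c : C) :
    comul (R := k) (convR P c) = (convR P).lTensor C (comul c) := by
  have h1 (u : C ⊗[k] C) : comul (R := k) (TensorProduct.rid k C (P.lTensor C u)) =
      ((TensorProduct.rid k C).toLinearMap ∘ₗ P.lTensor C).lTensor C
        (TensorProduct.assoc k C C C ((comul (R := k)).rTensor C u)) := by
    induction u with
    | zero => simp
    | add x y hx hy => simp only [map_add, hx, hy]
    | tmul x y =>
      simp only [LinearMap.lTensor_tmul, LinearMap.rTensor_tmul, TensorProduct.rid_tmul, map_smul]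
      generalize comul (R := k) x = w
      induction w with
      | zero => simp
      | add x y hx hy => simp only [map_add, smul_add, TensorProduct.add_tmul, hx, hy]
      | tmul x y => simp
  rw [convR_apply, h1, coassoc_apply, ← LinearMap.lTensor_comp_apply]
  rfl

lemma comul_convL (Q : C →ₗ[k] k) (c : C) :
    comul (R := k) (convL Q c) = (convL Q).rTensor C (comul c) := by
  have h1 (u : C ⊗[k] C) : comul (R := k) (TensorProduct.lid k C (Q.rTensor C u)) =
      ((TensorProduct.lid k C).toLinearMap ∘ₗ Q.rTensor C).rTensor C
        ((TensorProduct.assoc k C C C).symm ((comul (R := k)).lTensor C u)) := by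
    induction u with
    | zero => simp
    | add x y hx hy => simp only [map_add, hx, hy]
    | tmul x y =>
      simp only [LinearMap.lTensor_tmul, LinearMap.rTensor_tmul, TensorProduct.lid_tmul, map_smul]
      generalize comul (R := k) y = w
      induction w with
      | zero => simp
      | add x y hx hy => simp only [map_add, smul_add, TensorProduct.tmul_add, hx, hy]
      | tmul x y => simp [TensorProduct.smul_tmul']
  rw [convL_apply, h1, coassoc_symm_apply, ← LinearMap.rTensor_comp_apply]
  rfl

lemma rTensor_convR (P : C →ₗ[k] k) (c : C) :
    (convR P).rTensor C (comul (R := k) c) = (convL P).lTensor C (comul c) := by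
  have h1 (u : C ⊗[k] C) : (convR P).rTensor C u =
      ((TensorProduct.lid k C).toLinearMap ∘ₗ P.rTensor C).lTensor C
        (TensorProduct.assoc k C C C ((comul (R := k)).rTensor C u)) := by
    induction u with
    | zero => simp
    | add x y hx hy => simp only [map_add, hx, hy]
    | tmul x y =>
      simp only [LinearMap.rTensor_tmul, convR_apply]
      generalize comul (R := k) x = w
      induction w with
      | zero => simp
      | add x y hx hy => simp only [map_add, TensorProduct.add_tmul, hx, hy]
      | tmul x y => simp [TensorProduct.smul_tmul]
  rw [h1, coassoc_apply, ← LinearMap.lTensor_comp_apply]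
  rfl

lemma counit_convR (P : C →ₗ[k] k) (c : C) : counit (R := k) (convR P c) = P c := by
  have h1 (u : C ⊗[k] C) : counit (R := k) (TensorProduct.rid k C (P.lTensor C u)) =
      P (TensorProduct.lid k C ((counit (R := k)).rTensor C u)) := by
    induction u with
    | zero => simp
    | add x y hx hy => simp only [map_add, hx, hy]
    | tmul x y => simp [mul_comm]
  rw [convR_apply, h1, rTensor_counit_comul]
  simp

lemma counit_convL (P : C →ₗ[k] k) (c : C) : counit (R := k) (convL P c) = P c := by
  have h1 (u : C ⊗[k] C) : counit (R := k) (TensorProduct.lid k C (P.rTensor C u)) =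
      P (TensorProduct.rid k C ((counit (R := k)).lTensor C u)) := by
    induction u with
    | zero => simp
    | add x y hx hy => simp only [map_add, hx, hy]
    | tmul x y => simp [mul_comm]
  rw [convL_apply, h1, lTensor_counit_comul]
  simp

lemma convL_counit (c : C) : convL (counit (R := k)) c = c := by
  rw [convL_apply, rTensor_counit_comul]; simp

/-- `P ∘ convL Q` is the convolution product of `Q` and `P`. -/
lemma convL_convL (P Q : C →ₗ[k] k) (h : P ∘ₗ convL Q = counit) (c : C) :
    convL P (convL Q c) = c := by
  rw [convL_apply, comul_convL, ← LinearMap.rTensor_comp_apply, h, rTensor_counit_comul]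
  simp

lemma convL_comm_convR (P Q : C →ₗ[k] k) (c : C) : convL Q (convR P c) = convR P (convL Q c) := by
  have h1 (u : C ⊗[k] C) : TensorProduct.lid k C (Q.rTensor C ((convR P).lTensor C u)) =
      convR P (TensorProduct.lid k C (Q.rTensor C u)) := by
    induction u with
    | zero => simp
    | add x y hx hy => simp only [map_add, hx, hy]
    | tmul x y => simp
  rw [convL_apply, comul_convR, h1, convL_apply]

lemma apply_convR (P Q : C →ₗ[k] k) (c : C) : Q (convR P c) = P (convL Q c) := by
  rw [convL_apply, convR_apply]
  generalize comul (R := k) c = u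
  induction u with
  | zero => simp
  | add x y hx hy => simp only [map_add, hx, hy]
  | tmul x y => simp [mul_comm]

lemma comul_convL_convR (P Q : C →ₗ[k] k) (h : Q ∘ₗ convL P = counit) (c : C) :
    comul (R := k) (convL Q (convR P c)) =
      TensorProduct.map (convL Q ∘ₗ convR P) (convL Q ∘ₗ convR P) (comul c) := by
  have h1 : (convL Q ∘ₗ convR P) ∘ₗ convL P = convR P := by
    ext x
    simp only [LinearMap.comp_apply]
    rw [← convL_comm_convR P P, convL_convL Q P h]
  have h2 (u : C ⊗[k] C) : TensorProduct.map (convL Q ∘ₗ convR P) (convL Q ∘ₗ convR P) u =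
      TensorProduct.map (convL Q) (convL Q ∘ₗ convR P) ((convR P).rTensor C u) := by
    rw [← LinearMap.comp_apply, LinearMap.rTensor, ← TensorProduct.map_comp, LinearMap.comp_id]
  have h3 (u : C ⊗[k] C) : TensorProduct.map (convL Q) (convL Q ∘ₗ convR P)
      ((convL P).lTensor C u) = TensorProduct.map (convL Q) (convR P) u := by
    rw [← LinearMap.comp_apply, LinearMap.lTensor, ← TensorProduct.map_comp, h1, LinearMap.comp_id]
  rw [h2, rTensor_convR, h3, comul_convL, comul_convR, ← LinearMap.comp_apply, LinearMap.rTensor,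
    LinearMap.lTensor, ← TensorProduct.map_comp, LinearMap.comp_id, LinearMap.id_comp]

lemma counit_convL_convR (P Q : C →ₗ[k] k) (h : P ∘ₗ convL Q = counit) (c : C) :
    counit (R := k) (convL Q (convR P c)) = counit c := by
  rw [counit_convL, apply_convR, ← h]
  rfl

end conv

section coop

/-- The co-opposite of a coalgebra (bialgebra): the same underlying module (algebra) and counit,
with comultiplication `Δ^op`. -/
def Coop (L : Type*) : Type _ := L

variable {k L : Type*} [CommRing k] [Ring L] [Bialgebra k L]

namespace Coop

instance : Ring (Coop L) := inferInstanceAs (Ring L)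
instance : Algebra k (Coop L) := inferInstanceAs (Algebra k L)

variable (k) in
/-- The identity map from `L` to its co-opposite, an isomorphism of algebras. -/
def of : L ≃ₐ[k] Coop L := AlgEquiv.refl

/-- The co-opposite coalgebra structure. -/
abbrev coalg (k L : Type*) [CommRing k] [Ring L] [Bialgebra k L] : Coalgebra k L where
  comul := (TensorProduct.comm k L L).toLinearMap ∘ₗ comul
  counit := counit
  coassoc := by
    ext x
    have h1 (u : L ⊗[k] L) : TensorProduct.assoc k L L L
        (((TensorProduct.comm k L L).toLinearMap ∘ₗ comul (R := k)).rTensor L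
          (TensorProduct.comm k L L u)) =
        (TensorProduct.assoc k L L L) (TensorProduct.comm k L (L ⊗[k] L)
          ((TensorProduct.comm k L L).toLinearMap.lTensor L
            ((comul (R := k)).lTensor L u))) := by
      induction u with
      | zero => simp
      | add x y hx hy => simp only [map_add, hx, hy]
      | tmul x y => simp
    have h2 (u : L ⊗[k] L) :
        ((TensorProduct.comm k L L).toLinearMap ∘ₗ comul (R := k)).lTensor L
          (TensorProduct.comm k L L u) =
        TensorProduct.comm k (L ⊗[k] L) L
          ((TensorProduct.comm k L L).toLinearMap.rTensor L ((comul (R := k)).rTensor L u)) := by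
      induction u with
      | zero => simp
      | add x y hx hy => simp only [map_add, hx, hy]
      | tmul x y => simp
    have h3 (w : (L ⊗[k] L) ⊗[k] L) : (TensorProduct.assoc k L L L)
        (TensorProduct.comm k L (L ⊗[k] L) ((TensorProduct.comm k L L).toLinearMap.lTensor L
          (TensorProduct.assoc k L L L w))) =
        TensorProduct.comm k (L ⊗[k] L) L ((TensorProduct.comm k L L).toLinearMap.rTensor L w) := by
      induction w with
      | zero => simp
      | add x y hx hy => simp only [map_add, hx, hy]
      | tmul x y =>
        induction x with
        | zero => simp
        | add x y hx hy => simp only [map_add, TensorProduct.add_tmul, hx, hy]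
        | tmul x z => simp
    refine (h1 _).trans (Eq.trans ?_ (h2 _).symm)
    rw [← h3, coassoc_apply]
  rTensor_counit_comp_comul := by
    ext x
    have h1 (u : L ⊗[k] L) : (counit (R := k)).rTensor L (TensorProduct.comm k L L u) =
        TensorProduct.comm k L k ((counit (R := k)).lTensor L u) := by
      induction u with
      | zero => simp
      | add x y hx hy => simp only [map_add, hx, hy]
      | tmul x y => simp
    refine (h1 _).trans ?_
    rw [lTensor_counit_comul]
    rfl
  lTensor_counit_comp_comul := by
    ext x
    have h1 (u : L ⊗[k] L) : (counit (R := k)).lTensor L (TensorProduct.comm k L L u) =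
        TensorProduct.comm k k L ((counit (R := k)).rTensor L u) := by
      induction u with
      | zero => simp
      | add x y hx hy => simp only [map_add, hx, hy]
      | tmul x y => simp
    refine (h1 _).trans ?_
    rw [rTensor_counit_comul]
    rfl

instance : Coalgebra k (Coop L) := coalg k L

instance : Bialgebra k (Coop L) :=
  Bialgebra.mk' k (Coop L)
    (Bialgebra.counit_one (R := k) (A := L))
    (fun {a b} => Bialgebra.counit_mul (R := k) (A := L) a b)
    ((congrArg (Algebra.TensorProduct.comm k L L) (Bialgebra.comul_one (R := k) (A := L))).trans
      (map_one _))
    (fun {a b} => (congrArg (Algebra.TensorProduct.comm k L L)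
      (Bialgebra.comul_mul (R := k) (A := L) a b)).trans (map_mul _ _ _))

lemma comul_of (x : L) : comul (R := k) (of k x) =
    TensorProduct.map (of k).toLinearMap (of k).toLinearMap
      (TensorProduct.comm k L L (comul x)) := by
  change TensorProduct.comm k L L (comul x) = TensorProduct.map LinearMap.id LinearMap.id _
  rw [TensorProduct.map_id]
  rfl

lemma counit_of (x : L) : counit (R := k) (of k x) = counit (R := k) x := rfl

end Coop

end coop

/-- A Hopf pairing `H' × H → k`:
`(1, h) = ε(h)`, `(h', 1) = ε(h')`, `(h', x y) = (Δ(h'), x ⊗ y)`,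
`(x' y', h) = (x' ⊗ y', Δ(h))`. -/
@[ext]
structure HopfPairing (k H' H : Type*) [CommRing k] [Ring H'] [Bialgebra k H']
    [Ring H] [Bialgebra k H] where
  /-- the bilinear form -/
  form : H' →ₗ[k] H →ₗ[k] k
  one_left (h : H) : form 1 h = counit (R := k) h
  one_right (h' : H') : form h' 1 = counit (R := k) h'
  mul_right (h' : H') (x y : H) : form h' (x * y) =
    LinearMap.mul' k k (TensorProduct.map (form.flip x) (form.flip y) (comul h'))
  mul_left (x' y' : H') (h : H) : form (x' * y') h =
    LinearMap.mul' k k (TensorProduct.map (form x') (form y') (comul h))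

end TwoParam

namespace TwoParam

open Coalgebra TensorProduct

namespace Dbl

variable {k H L : Type*} [CommRing k] [Ring H] [HopfAlgebra k H] [Ring L] [HopfAlgebra k L]

/-- A bilinear form on `L × H` which is a Hopf pairing between the co-opposite of `L` and `H`. -/
structure IsSkew (P : L →ₗ[k] H →ₗ[k] k) : Prop where
  one_left (h : H) : P 1 h = counit (R := k) h
  one_right (f : L) : P f 1 = counit (R := k) f
  mul_right (f : L) (x y : H) : P f (x * y) = LinearMap.mul' k k
    (TensorProduct.map (P.flip x) (P.flip y) (TensorProduct.comm k L L (comul f)))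
  mul_left (f g : L) (h : H) : P (f * g) h =
    LinearMap.mul' k k (TensorProduct.map (P f) (P g) (comul h))

variable (P : L →ₗ[k] H →ₗ[k] k)

/-- The functional `f ⊗ a ↦ (f, a)`. -/
def pair : L ⊗[k] H →ₗ[k] k := TensorProduct.lift P

/-- The functional `f ⊗ a ↦ (S(f), a)`. -/
def pairS : L ⊗[k] H →ₗ[k] k := TensorProduct.lift (P ∘ₗ HopfAlgebra.antipode k)

/-- The map `f ⊗ a ↦ ∑ (S(f₍₁₎), a₍₁₎) (f₍₃₎, a₍₃₎) f₍₂₎ ⊗ a₍₂₎`. -/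
def ex : L ⊗[k] H →ₗ[k] L ⊗[k] H := convL (pairS P) ∘ₗ convR (pair P)

/-- `f ↦ (a ↦ ∑ a₍₁₎ (f, a₍₂₎))`. -/
def rr : L →ₗ[k] H →ₗ[k] H where
  toFun f := convR (P f)
  map_add' f g := by
    ext a
    simp only [convR_apply, map_add, LinearMap.lTensor_add, LinearMap.add_apply]
  map_smul' c f := by
    ext a
    simp only [convR_apply, map_smul, LinearMap.lTensor_smul, LinearMap.smul_apply, RingHom.id_apply]

/-- `f ↦ (a ↦ ∑ (f, a₍₁₎) a₍₂₎)`. -/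
def ll : L →ₗ[k] H →ₗ[k] H where
  toFun f := convL (P f)
  map_add' f g := by
    ext a
    simp only [convL_apply, map_add, LinearMap.rTensor_add, LinearMap.add_apply]
  map_smul' c f := by
    ext a
    simp only [convL_apply, map_smul, LinearMap.rTensor_smul, LinearMap.smul_apply, RingHom.id_apply]

lemma rr_apply (f : L) (a : H) : rr P f a = convR (P f) a := rfl
lemma ll_apply (f : L) (a : H) : ll P f a = convL (P f) a := rfl

lemma convR_tmul (f : L) (a : H) {ι : Type*} (F : Repr k f ι) :
    convR (pair P) (f ⊗ₜ[k] a) = ∑ i ∈ F.index, F.left i ⊗ₜ[k] rr P (F.right i) a := by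
  simp only [convR_apply, rr_apply, TensorProduct.comul_tmul, ← F.eq]
  generalize comul (R := k) a = w
  induction w with
  | zero => simp
  | add x y hx hy => simp only [map_add, TensorProduct.tmul_add, hx, hy, Finset.sum_add_distrib]
  | tmul x y => simp [TensorProduct.sum_tmul, pair]

lemma convL_tmul (f : L) (a : H) {ι : Type*} (F : Repr k f ι) :
    convL (pair P) (f ⊗ₜ[k] a) = ∑ i ∈ F.index, F.right i ⊗ₜ[k] ll P (F.left i) a := by
  simp only [convL_apply, ll_apply, TensorProduct.comul_tmul, ← F.eq]
  generalize comul (R := k) a = w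
  induction w with
  | zero => simp
  | add x y hx hy => simp only [map_add, TensorProduct.tmul_add, hx, hy, Finset.sum_add_distrib]
  | tmul x y => simp [TensorProduct.sum_tmul, pair]

variable {P}

lemma rr_one (hP : IsSkew P) (a : H) : rr P 1 a = a := by
  have : P 1 = counit := LinearMap.ext hP.one_left
  rw [rr_apply, convR_apply, this, lTensor_counit_comul]
  simp

lemma ll_one (hP : IsSkew P) (a : H) : ll P 1 a = a := by
  have : P 1 = counit := LinearMap.ext hP.one_left
  rw [ll_apply, convL_apply, this, rTensor_counit_comul]
  simp

lemma rr_map_one (hP : IsSkew P) (f : L) : rr P f 1 = counit (R := k) f • 1 := by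
  rw [rr_apply, convR_apply, Bialgebra.comul_one]
  simp [Algebra.TensorProduct.one_def, hP.one_right]

lemma ll_map_one (hP : IsSkew P) (f : L) : ll P f 1 = counit (R := k) f • 1 := by
  rw [ll_apply, convL_apply, Bialgebra.comul_one]
  simp [Algebra.TensorProduct.one_def, hP.one_right]

lemma rr_mul (hP : IsSkew P) (f g : L) (a : H) : rr P (f * g) a = rr P f (rr P g a) := by
  have h1 : P f ∘ₗ convR (P g) = P (f * g) := by
    ext a
    rw [hP.mul_left, LinearMap.comp_apply, convR_apply]
    generalize comul (R := k) a = u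
    induction u with
    | zero => simp
    | add x y hx hy => simp only [map_add, hx, hy]
    | tmul x y => simp [mul_comm]
  simp only [rr_apply]
  rw [convR_apply (P f), comul_convR, ← LinearMap.lTensor_comp_apply, h1, convR_apply]

lemma ll_mul (hP : IsSkew P) (f g : L) (a : H) : ll P (f * g) a = ll P g (ll P f a) := by
  have h1 : P g ∘ₗ convL (P f) = P (f * g) := by
    ext a
    rw [hP.mul_left, LinearMap.comp_apply, convL_apply]
    generalize comul (R := k) a = u
    induction u with
    | zero => simp
    | add x y hx hy => simp only [map_add, hx, hy]
    | tmul x y => simp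
  simp only [ll_apply]
  rw [convL_apply (P g), comul_convL, ← LinearMap.rTensor_comp_apply, h1, convL_apply]

lemma P_mul (hP : IsSkew P) (f : L) (a b : H) {ι : Type*} (F : Repr k f ι) :
    P f (a * b) = ∑ i ∈ F.index, P (F.right i) a * P (F.left i) b := by
  rw [hP.mul_right, ← F.eq]
  simp

lemma rr_map_mul (hP : IsSkew P) (f : L) (a b : H) {ι : Type*} (F : Repr k f ι) :
    rr P f (a * b) = ∑ i ∈ F.index, rr P (F.right i) a * rr P (F.left i) b := by
  simp only [rr_apply, convR_apply, Bialgebra.comul_mul]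
  generalize comul (R := k) a = u
  generalize comul (R := k) b = w
  induction u with
  | zero => simp
  | add x y hx hy => simp only [map_add, add_mul, hx, hy, Finset.sum_add_distrib]
  | tmul x y =>
    induction w with
    | zero => simp
    | add x y hx hy => simp only [map_add, mul_add, hx, hy, Finset.sum_add_distrib]
    | tmul z w => simp [P_mul hP _ _ _ F, Finset.sum_smul, smul_smul, mul_comm]

lemma ll_map_mul (hP : IsSkew P) (f : L) (a b : H) {ι : Type*} (F : Repr k f ι) :
    ll P f (a * b) = ∑ i ∈ F.index, ll P (F.right i) a * ll P (F.left i) b := by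
  simp only [ll_apply, convL_apply, Bialgebra.comul_mul]
  generalize comul (R := k) a = u
  generalize comul (R := k) b = w
  induction u with
  | zero => simp
  | add x y hx hy => simp only [map_add, add_mul, hx, hy, Finset.sum_add_distrib]
  | tmul x y =>
    induction w with
    | zero => simp
    | add x y hx hy => simp only [map_add, mul_add, hx, hy, Finset.sum_add_distrib]
    | tmul z w => simp [P_mul hP _ _ _ F, Finset.sum_smul, smul_smul, mul_comm]

lemma ll_rr (f g : L) (a : H) : ll P f (rr P g a) = rr P g (ll P f a) := convL_comm_convR _ _ _

lemma pair_convL_pairS (hP : IsSkew P) : pair P ∘ₗ convL (pairS P) = counit := by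
  ext f a
  have h : (pair P (convL (pairS P) (f ⊗ₜ[k] a))) =
      P (LinearMap.mul' k L ((HopfAlgebra.antipode k).rTensor L (comul (R := k) f))) a := by
    rw [convL_apply, TensorProduct.comul_tmul]
    generalize comul (R := k) f = u
    induction u with
    | zero => simp
    | add x y hx hy =>
      simp only [map_add, TensorProduct.add_tmul, LinearMap.add_apply, hx, hy]
    | tmul x y =>
      simp only [LinearMap.rTensor_tmul, LinearMap.mul'_apply, hP.mul_left]
      generalize comul (R := k) a = w
      induction w with
      | zero => simp
      | add x y hx hy => simp only [map_add, TensorProduct.tmul_add, hx, hy]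
      | tmul z w => simp [pair, pairS]
  simp [h, Algebra.algebraMap_eq_smul_one, hP.one_left, mul_comm]

lemma pairS_convL_pair (hP : IsSkew P) : pairS P ∘ₗ convL (pair P) = counit := by
  ext f a
  have h : (pairS P (convL (pair P) (f ⊗ₜ[k] a))) =
      P (LinearMap.mul' k L ((HopfAlgebra.antipode k).lTensor L (comul (R := k) f))) a := by
    rw [convL_apply, TensorProduct.comul_tmul]
    generalize comul (R := k) f = u
    induction u with
    | zero => simp
    | add x y hx hy =>
      simp only [map_add, TensorProduct.add_tmul, LinearMap.add_apply, hx, hy]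
    | tmul x y =>
      simp only [LinearMap.lTensor_tmul, LinearMap.mul'_apply, hP.mul_left]
      generalize comul (R := k) a = w
      induction w with
      | zero => simp
      | add x y hx hy => simp only [map_add, TensorProduct.tmul_add, hx, hy]
      | tmul z w => simp [pair, pairS]
  simp [h, Algebra.algebraMap_eq_smul_one, hP.one_left, mul_comm]

section hex

/-- `φ` acting on the first and third factor of `L ⊗ L ⊗ H`. -/
def op13 (φ : Module.End k (L ⊗[k] H)) : Module.End k (L ⊗[k] (L ⊗[k] H)) :=
  (TensorProduct.leftComm k L L H).toLinearMap ∘ₗ φ.lTensor L ∘ₗ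
    (TensorProduct.leftComm k L L H).toLinearMap

/-- `φ` acting on the second and third factor of `L ⊗ L ⊗ H`. -/
def op23 (φ : Module.End k (L ⊗[k] H)) : Module.End k (L ⊗[k] (L ⊗[k] H)) := φ.lTensor L

/-- `φ` acting on the first and second factor of `L ⊗ H ⊗ H`. -/
def op12 (φ : Module.End k (L ⊗[k] H)) : Module.End k (L ⊗[k] (H ⊗[k] H)) :=
  (TensorProduct.assoc k L H H).toLinearMap ∘ₗ φ.rTensor H ∘ₗ
    (TensorProduct.assoc k L H H).symm.toLinearMap

/-- `φ` acting on the first and third factor of `L ⊗ H ⊗ H`. -/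
def op13' (φ : Module.End k (L ⊗[k] H)) : Module.End k (L ⊗[k] (H ⊗[k] H)) :=
  (TensorProduct.comm k H H).toLinearMap.lTensor L ∘ₗ op12 φ ∘ₗ
    (TensorProduct.comm k H H).toLinearMap.lTensor L

lemma op13_comp (φ ψ : Module.End k (L ⊗[k] H)) : op13 (φ ∘ₗ ψ) = op13 φ ∘ₗ op13 ψ := by
  have h : (TensorProduct.leftComm k L L H).toLinearMap ∘ₗ
      (TensorProduct.leftComm k L L H).toLinearMap = LinearMap.id := by ext; simp
  have h' (w) : TensorProduct.leftComm k L L H (TensorProduct.leftComm k L L H w) = w :=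
    LinearMap.congr_fun h w
  ext f g a
  simp [op13, h']

lemma op23_comp (φ ψ : Module.End k (L ⊗[k] H)) : op23 (φ ∘ₗ ψ) = op23 φ ∘ₗ op23 ψ := by
  ext f g a
  simp [op23]

lemma op12_comp (φ ψ : Module.End k (L ⊗[k] H)) : op12 (φ ∘ₗ ψ) = op12 φ ∘ₗ op12 ψ := by
  ext f g a
  simp [op12]

lemma op13'_comp (φ ψ : Module.End k (L ⊗[k] H)) : op13' (φ ∘ₗ ψ) = op13' φ ∘ₗ op13' ψ := by
  ext f g a
  simp [op13', op12_comp, ← LinearMap.lTensor_comp_apply]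

lemma op13_id : op13 (LinearMap.id : L ⊗[k] H →ₗ[k] L ⊗[k] H) = LinearMap.id := by
  ext f g a
  simp [op13]

lemma op23_id : op23 (LinearMap.id : L ⊗[k] H →ₗ[k] L ⊗[k] H) = LinearMap.id := by
  ext f g a
  simp [op23]

lemma op12_id : op12 (LinearMap.id : L ⊗[k] H →ₗ[k] L ⊗[k] H) = LinearMap.id := by
  ext f g a
  simp [op12]

lemma op13'_id : op13' (LinearMap.id : L ⊗[k] H →ₗ[k] L ⊗[k] H) = LinearMap.id := by
  ext f g a
  simp [op13', op12_id]

/-- Multiplication of the first two factors of `L ⊗ L ⊗ H`. -/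
def mulL : L ⊗[k] (L ⊗[k] H) →ₗ[k] L ⊗[k] H :=
  (LinearMap.mul' k L).rTensor H ∘ₗ (TensorProduct.assoc k L L H).symm.toLinearMap

/-- Multiplication of the last two factors of `L ⊗ H ⊗ H`. -/
def mulH : L ⊗[k] (H ⊗[k] H) →ₗ[k] L ⊗[k] H := (LinearMap.mul' k H).lTensor L

lemma op13_R (f g : L) (a : H) {ι : Type*} (F : Repr k f ι) :
    op13 (convR (pair P)) (f ⊗ₜ[k] (g ⊗ₜ[k] a)) =
      ∑ i ∈ F.index, F.left i ⊗ₜ[k] (g ⊗ₜ[k] rr P (F.right i) a) := by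
  simp [op13, convR_tmul _ _ _ F, TensorProduct.tmul_sum]

lemma op13_L (f g : L) (a : H) {ι : Type*} (F : Repr k f ι) :
    op13 (convL (pair P)) (f ⊗ₜ[k] (g ⊗ₜ[k] a)) =
      ∑ i ∈ F.index, F.right i ⊗ₜ[k] (g ⊗ₜ[k] ll P (F.left i) a) := by
  simp [op13, convL_tmul _ _ _ F, TensorProduct.tmul_sum]

lemma op23_R (f g : L) (a : H) {ι : Type*} (G : Repr k g ι) :
    op23 (convR (pair P)) (f ⊗ₜ[k] (g ⊗ₜ[k] a)) =
      ∑ i ∈ G.index, f ⊗ₜ[k] (G.left i ⊗ₜ[k] rr P (G.right i) a) := by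
  simp [op23, convR_tmul _ _ _ G, TensorProduct.tmul_sum]

lemma op23_L (f g : L) (a : H) {ι : Type*} (G : Repr k g ι) :
    op23 (convL (pair P)) (f ⊗ₜ[k] (g ⊗ₜ[k] a)) =
      ∑ i ∈ G.index, f ⊗ₜ[k] (G.right i ⊗ₜ[k] ll P (G.left i) a) := by
  simp [op23, convL_tmul _ _ _ G, TensorProduct.tmul_sum]

lemma op12_R (f : L) (a b : H) {ι : Type*} (F : Repr k f ι) :
    op12 (convR (pair P)) (f ⊗ₜ[k] (a ⊗ₜ[k] b)) =
      ∑ i ∈ F.index, F.left i ⊗ₜ[k] (rr P (F.right i) a ⊗ₜ[k] b) := by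
  simp [op12, convR_tmul _ _ _ F, TensorProduct.sum_tmul]

lemma op12_L (f : L) (a b : H) {ι : Type*} (F : Repr k f ι) :
    op12 (convL (pair P)) (f ⊗ₜ[k] (a ⊗ₜ[k] b)) =
      ∑ i ∈ F.index, F.right i ⊗ₜ[k] (ll P (F.left i) a ⊗ₜ[k] b) := by
  simp [op12, convL_tmul _ _ _ F, TensorProduct.sum_tmul]

lemma op13'_R (f : L) (a b : H) {ι : Type*} (F : Repr k f ι) :
    op13' (convR (pair P)) (f ⊗ₜ[k] (a ⊗ₜ[k] b)) =
      ∑ i ∈ F.index, F.left i ⊗ₜ[k] (a ⊗ₜ[k] rr P (F.right i) b) := by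
  simp [op13', op12_R _ _ _ F]

lemma op13'_L (f : L) (a b : H) {ι : Type*} (F : Repr k f ι) :
    op13' (convL (pair P)) (f ⊗ₜ[k] (a ⊗ₜ[k] b)) =
      ∑ i ∈ F.index, F.right i ⊗ₜ[k] (a ⊗ₜ[k] ll P (F.left i) b) := by
  simp [op13', op12_L _ _ _ F]

lemma R_mulL (hP : IsSkew P) : convR (pair P) ∘ₗ mulL =
    mulL ∘ₗ op13 (convR (pair P)) ∘ₗ op23 (convR (pair P)) := by
  ext f g a
  have h := convR_tmul P (f * g) a ((ℛ k f).mul (ℛ k g))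
  simp only [TensorProduct.AlgebraTensorModule.curry_apply, TensorProduct.curry_apply,
    LinearMap.coe_restrictScalars, LinearMap.comp_apply, op23_R _ _ _ (ℛ k g), map_sum,
    op13_R _ _ _ (ℛ k f)]
  simp only [mulL, LinearMap.comp_apply, LinearEquiv.coe_coe, TensorProduct.assoc_symm_tmul,
    LinearMap.rTensor_tmul, LinearMap.mul'_apply, h, ← rr_mul hP]
  rw [Finset.sum_comm]
  exact Finset.sum_product _ _ _

lemma L_mulL (hP : IsSkew P) : convL (pair P) ∘ₗ mulL =
    mulL ∘ₗ op23 (convL (pair P)) ∘ₗ op13 (convL (pair P)) := by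
  ext f g a
  have h := convL_tmul P (f * g) a ((ℛ k f).mul (ℛ k g))
  simp only [TensorProduct.AlgebraTensorModule.curry_apply, TensorProduct.curry_apply,
    LinearMap.coe_restrictScalars, LinearMap.comp_apply, op23_L _ _ _ (ℛ k g), map_sum,
    op13_L _ _ _ (ℛ k f)]
  simp only [mulL, LinearMap.comp_apply, LinearEquiv.coe_coe, TensorProduct.assoc_symm_tmul,
    LinearMap.rTensor_tmul, LinearMap.mul'_apply, h, ← ll_mul hP]
  exact Finset.sum_product _ _ _

lemma R_mulH (hP : IsSkew P) : convR (pair P) ∘ₗ mulH =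
    mulH ∘ₗ op13' (convR (pair P)) ∘ₗ op12 (convR (pair P)) := by
  ext f a b
  have hc := congrArg ((LinearMap.mul' k H ∘ₗ TensorProduct.map ((rr P).flip a) ((rr P).flip b) ∘ₗ
    (TensorProduct.comm k L L).toLinearMap).lTensor L)
    (sum_tmul_tmul_eq (ℛ k f) (fun i => ℛ k _) (fun i => ℛ k _))
  simp only [map_sum, LinearMap.lTensor_tmul, LinearMap.comp_apply, LinearEquiv.coe_coe,
    TensorProduct.comm_tmul, TensorProduct.map_tmul, LinearMap.flip_apply,
    LinearMap.mul'_apply] at hc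
  simp only [TensorProduct.AlgebraTensorModule.curry_apply, TensorProduct.curry_apply,
    LinearMap.coe_restrictScalars, LinearMap.comp_apply, op12_R _ _ _ (ℛ k f), map_sum,
    op13'_R _ _ _ (ℛ k _)]
  simp only [mulH, LinearMap.lTensor_tmul, LinearMap.mul'_apply, convR_tmul _ _ _ (ℛ k f),
    rr_map_mul hP _ _ _ (ℛ k _), TensorProduct.tmul_sum, hc]

lemma L_mulH (hP : IsSkew P) : convL (pair P) ∘ₗ mulH =
    mulH ∘ₗ op12 (convL (pair P)) ∘ₗ op13' (convL (pair P)) := by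
  ext f a b
  have hc := congrArg ((LinearMap.mul' k H ∘ₗ TensorProduct.map ((ll P).flip a) ((ll P).flip b) ∘ₗ
    (TensorProduct.comm k L L).toLinearMap).lTensor L ∘ₗ (TensorProduct.comm k _ _).toLinearMap ∘ₗ
      (TensorProduct.assoc k L L L).symm.toLinearMap)
    (sum_tmul_tmul_eq (ℛ k f) (fun i => ℛ k _) (fun i => ℛ k _))
  simp only [map_sum, LinearMap.lTensor_tmul, LinearMap.comp_apply, LinearEquiv.coe_coe,
    TensorProduct.comm_tmul, TensorProduct.map_tmul, LinearMap.flip_apply,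
    TensorProduct.assoc_symm_tmul, LinearMap.mul'_apply] at hc
  simp only [TensorProduct.AlgebraTensorModule.curry_apply, TensorProduct.curry_apply,
    LinearMap.coe_restrictScalars, LinearMap.comp_apply, op13'_L _ _ _ (ℛ k f), map_sum,
    op12_L _ _ _ (ℛ k _)]
  simp only [mulH, LinearMap.lTensor_tmul, LinearMap.mul'_apply, convL_tmul _ _ _ (ℛ k f),
    ll_map_mul hP _ _ _ (ℛ k _), TensorProduct.tmul_sum, hc]

lemma op23_L_op13_R : op23 (convL (pair P)) ∘ₗ op13 (convR (pair P)) =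
    op13 (convR (pair P)) ∘ₗ op23 (convL (pair P)) := by
  ext f g a
  simp only [TensorProduct.AlgebraTensorModule.curry_apply, TensorProduct.curry_apply,
    LinearMap.coe_restrictScalars, LinearMap.comp_apply, op23_L _ _ _ (ℛ k g), map_sum,
    op13_R _ _ _ (ℛ k f), ll_rr]
  rw [Finset.sum_comm]

lemma op12_L_op13'_R : op12 (convL (pair P)) ∘ₗ op13' (convR (pair P)) =
    op13' (convR (pair P)) ∘ₗ op12 (convL (pair P)) := by
  ext f a b
  have hc := congrArg ((TensorProduct.map ((ll P).flip a) ((rr P).flip b)).lTensor L ∘ₗ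
      (TensorProduct.leftComm k L L L).toLinearMap)
    (sum_tmul_tmul_eq (ℛ k f) (fun i => ℛ k _) (fun i => ℛ k _))
  simp only [map_sum, LinearMap.lTensor_tmul, LinearMap.comp_apply, LinearEquiv.coe_coe,
    TensorProduct.leftComm_tmul, TensorProduct.map_tmul, LinearMap.flip_apply] at hc
  simp only [TensorProduct.AlgebraTensorModule.curry_apply, TensorProduct.curry_apply,
    LinearMap.coe_restrictScalars, LinearMap.comp_apply, op12_L _ _ _ (ℛ k _), map_sum,
    op13'_R _ _ _ (ℛ k _), hc]

end hex

end Dbl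

end TwoParam

namespace TwoParam

open Coalgebra TensorProduct

namespace Dbl

variable {k H L : Type*} [CommRing k] [Ring H] [HopfAlgebra k H] [Ring L] [HopfAlgebra k L]
variable {P : L →ₗ[k] H →ₗ[k] k}

lemma LLS (hP : IsSkew P) : convL (pair P) ∘ₗ convL (pairS P) = LinearMap.id :=
  LinearMap.ext fun c => convL_convL (pair P) (pairS P) (pair_convL_pairS hP) c

lemma LSL (hP : IsSkew P) : convL (pairS P) ∘ₗ convL (pair P) = LinearMap.id :=
  LinearMap.ext fun c => convL_convL (pairS P) (pair P) (pairS_convL_pair hP) c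

section opers

variable {M N : Type*} [AddCommGroup M] [Module k M] [AddCommGroup N] [Module k N]

lemma hex_inv {m : N →ₗ[k] M} {l l' : M →ₗ[k] M} {a b a' b' : N →ₗ[k] N}
    (h : l ∘ₗ m = m ∘ₗ b ∘ₗ a) (hl : l' ∘ₗ l = LinearMap.id) (ha : a ∘ₗ a' = LinearMap.id)
    (hb : b ∘ₗ b' = LinearMap.id) : l' ∘ₗ m = m ∘ₗ a' ∘ₗ b' := by
  ext x
  have h1 := LinearMap.congr_fun h (a' (b' x))
  have h2 := LinearMap.congr_fun ha (b' x)
  have h3 := LinearMap.congr_fun hb x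
  have h4 := LinearMap.congr_fun hl (m (a' (b' x)))
  simp only [LinearMap.comp_apply, LinearMap.id_apply] at h1 h2 h3 h4 ⊢
  rw [h2, h3] at h1
  rw [← h1, h4]

lemma comm_of_inv {a a' b : M →ₗ[k] M}
    (h : a ∘ₗ b = b ∘ₗ a) (h1 : a ∘ₗ a' = LinearMap.id) (h2 : a' ∘ₗ a = LinearMap.id) :
    a' ∘ₗ b = b ∘ₗ a' := by
  ext x
  have g := LinearMap.congr_fun h (a' x)
  have g1 := LinearMap.congr_fun h1 x
  have g2 := LinearMap.congr_fun h2 (b (a' x))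
  simp only [LinearMap.comp_apply, LinearMap.id_apply] at g g1 g2 ⊢
  rw [g1] at g
  rw [← g, g2]

lemma hex_comb {m : N →ₗ[k] M} {l r : M →ₗ[k] M} {l₁ l₂ r₁ r₂ : N →ₗ[k] N}
    (hr : r ∘ₗ m = m ∘ₗ r₁ ∘ₗ r₂) (hl : l ∘ₗ m = m ∘ₗ l₁ ∘ₗ l₂)
    (hc : l₂ ∘ₗ r₁ = r₁ ∘ₗ l₂) : (l ∘ₗ r) ∘ₗ m = m ∘ₗ (l₁ ∘ₗ r₁) ∘ₗ (l₂ ∘ₗ r₂) := by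
  ext x
  have h1 := LinearMap.congr_fun hr x
  have h2 := LinearMap.congr_fun hl (r₁ (r₂ x))
  have h3 := LinearMap.congr_fun hc (r₂ x)
  simp only [LinearMap.comp_apply] at h1 h2 h3 ⊢
  rw [h1, h2, h3]

end opers

lemma LS_mulL (hP : IsSkew P) : convL (pairS P) ∘ₗ mulL =
    mulL ∘ₗ op13 (convL (pairS P)) ∘ₗ op23 (convL (pairS P)) :=
  hex_inv (L_mulL hP) (LSL hP) (by rw [← op13_comp, LLS hP, op13_id])
    (by rw [← op23_comp, LLS hP, op23_id])

lemma LS_mulH (hP : IsSkew P) : convL (pairS P) ∘ₗ mulH =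
    mulH ∘ₗ op13' (convL (pairS P)) ∘ₗ op12 (convL (pairS P)) :=
  hex_inv (L_mulH hP) (LSL hP) (by rw [← op13'_comp, LLS hP, op13'_id])
    (by rw [← op12_comp, LLS hP, op12_id])

lemma ex_mulL (hP : IsSkew P) : ex P ∘ₗ mulL = mulL ∘ₗ op13 (ex P) ∘ₗ op23 (ex P) := by
  have hc := comm_of_inv (op23_L_op13_R (P := P))
    (by rw [← op23_comp, LLS hP, op23_id]) (by rw [← op23_comp, LSL hP, op23_id])
  have h := hex_comb (R_mulL hP) (LS_mulL hP) hc
  rwa [← op13_comp, ← op23_comp] at h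

lemma ex_mulH (hP : IsSkew P) : ex P ∘ₗ mulH = mulH ∘ₗ op13' (ex P) ∘ₗ op12 (ex P) := by
  have hc := comm_of_inv (op12_L_op13'_R (P := P))
    (by rw [← op12_comp, LLS hP, op12_id]) (by rw [← op12_comp, LSL hP, op12_id])
  have h := hex_comb (R_mulH hP) (LS_mulH hP) hc
  rwa [← op13'_comp, ← op12_comp] at h

lemma ex_one_left (hP : IsSkew P) (a : H) : ex P (1 ⊗ₜ[k] a) = 1 ⊗ₜ[k] a := by
  let F : Repr k (1 : L) Unit := ⟨{()}, fun _ => 1, fun _ => 1, by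
    simp [Algebra.TensorProduct.one_def]⟩
  have h1 : convR (pair P) (1 ⊗ₜ[k] a) = 1 ⊗ₜ[k] a := by
    rw [convR_tmul P 1 a F]; simp [F, rr_one hP]
  have h2 : convL (pair P) (1 ⊗ₜ[k] a) = 1 ⊗ₜ[k] a := by
    rw [convL_tmul P 1 a F]; simp [F, ll_one hP]
  have h3 := LinearMap.congr_fun (LSL hP) (1 ⊗ₜ[k] a)
  rw [LinearMap.comp_apply, h2] at h3
  rw [ex, LinearMap.comp_apply, h1, h3]
  rfl

lemma ex_one_right (hP : IsSkew P) (f : L) : ex P (f ⊗ₜ[k] 1) = f ⊗ₜ[k] 1 := by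
  have h1 : convR (pair P) (f ⊗ₜ[k] (1 : H)) = f ⊗ₜ[k] 1 := by
    rw [convR_tmul P f 1 (ℛ k f)]
    simp only [rr_map_one hP, ← TensorProduct.smul_tmul, ← TensorProduct.sum_tmul]
    congr 1
    have h := congrArg (TensorProduct.rid k L) (sum_tmul_counit_eq (ℛ k f))
    simp only [map_sum, TensorProduct.rid_tmul, one_smul] at h
    exact h
  have h2 : convL (pair P) (f ⊗ₜ[k] (1 : H)) = f ⊗ₜ[k] 1 := by
    rw [convL_tmul P f 1 (ℛ k f)]
    simp only [ll_map_one hP, ← TensorProduct.smul_tmul, ← TensorProduct.sum_tmul]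
    rw [sum_counit_smul]
  have h3 := LinearMap.congr_fun (LSL hP) (f ⊗ₜ[k] 1)
  rw [LinearMap.comp_apply, h2] at h3
  rw [ex, LinearMap.comp_apply, h1, h3]
  rfl

lemma comul_ex (hP : IsSkew P) (c : L ⊗[k] H) :
    comul (R := k) (ex P c) = TensorProduct.map (ex P) (ex P) (comul c) :=
  comul_convL_convR (pair P) (pairS P) (pairS_convL_pair hP) c

lemma counit_ex (hP : IsSkew P) (c : L ⊗[k] H) : counit (R := k) (ex P c) = counit c :=
  counit_convL_convR (pair P) (pairS P) (pair_convL_pairS hP) c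

variable (P)

/-- The exchange map `f ⊗ a ↦ ∑ (S(f₍₁₎), a₍₁₎) (f₍₃₎, a₍₃₎) a₍₂₎ ⊗ f₍₂₎`. -/
def exch : L ⊗[k] H →ₗ[k] H ⊗[k] L := (TensorProduct.comm k L H).toLinearMap ∘ₗ ex P

/-- The multiplication of the double,
`(a ⊗ f)(a' ⊗ f') = ∑ (S(f₍₁₎), a'₍₁₎) (f₍₃₎, a'₍₃₎) a a'₍₂₎ ⊗ f₍₂₎ f'`. -/
def dmul : (H ⊗[k] L) ⊗[k] (H ⊗[k] L) →ₗ[k] H ⊗[k] L :=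
  TensorProduct.map (LinearMap.mul' k H) (LinearMap.mul' k L) ∘ₗ
  (TensorProduct.assoc k H H (L ⊗[k] L)).symm.toLinearMap ∘ₗ
  ((TensorProduct.assoc k H L L).toLinearMap ∘ₗ (exch P).rTensor L ∘ₗ
    (TensorProduct.assoc k L H L).symm.toLinearMap).lTensor H ∘ₗ
  (TensorProduct.assoc k H L (H ⊗[k] L)).toLinearMap

/-- `z ↦ a z g`. -/
def bim (a : H) (g : L) : H ⊗[k] L →ₗ[k] H ⊗[k] L :=
  TensorProduct.map (LinearMap.mulLeft k a) (LinearMap.mulRight k g)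

lemma dmul_tmul (a b : H) (f g : L) :
    dmul P ((a ⊗ₜ[k] f) ⊗ₜ[k] (b ⊗ₜ[k] g)) = bim a g (exch P (f ⊗ₜ[k] b)) := by
  simp only [dmul, LinearMap.comp_apply, LinearEquiv.coe_coe, TensorProduct.assoc_tmul,
    LinearMap.lTensor_tmul, TensorProduct.assoc_symm_tmul, LinearMap.rTensor_tmul]
  generalize exch P (f ⊗ₜ[k] b) = w
  induction w with
  | zero => simp
  | add x y hx hy => simp only [map_add, TensorProduct.add_tmul, TensorProduct.tmul_add, hx, hy]
  | tmul x y => simp [bim]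

variable {P}

lemma exch_mul_left (hP : IsSkew P) (f g : L) (a : H) (w : H ⊗[k] L) (hw : exch P (g ⊗ₜ[k] a) = w) :
    exch P ((f * g) ⊗ₜ[k] a) = dmul P (((1 : H) ⊗ₜ[k] f) ⊗ₜ[k] w) := by
  have h := LinearMap.congr_fun (ex_mulL hP) (f ⊗ₜ[k] (g ⊗ₜ[k] a))
  have h1 : ex P (g ⊗ₜ[k] a) = TensorProduct.comm k H L w := by
    rw [← hw]; simp [exch]
  simp only [LinearMap.comp_apply, op23, LinearMap.lTensor_tmul, h1] at h
  simp only [mulL, LinearMap.comp_apply, LinearEquiv.coe_coe, TensorProduct.assoc_symm_tmul,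
    LinearMap.rTensor_tmul, LinearMap.mul'_apply] at h
  rw [exch, LinearMap.comp_apply, h]
  clear h h1 hw
  induction w with
  | zero => simp
  | add x y hx hy => simp only [map_add, TensorProduct.tmul_add, hx, hy]
  | tmul x y =>
    rw [dmul_tmul]
    simp only [op13, exch, LinearMap.comp_apply, LinearEquiv.coe_coe, TensorProduct.comm_tmul,
      TensorProduct.leftComm_tmul, LinearMap.lTensor_tmul]
    generalize ex P (f ⊗ₜ[k] x) = u
    induction u with
    | zero => simp
    | add x y hx hy => simp only [map_add, TensorProduct.tmul_add, hx, hy]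
    | tmul x y => simp [bim]

lemma exch_mul_right (hP : IsSkew P) (f : L) (a b : H) (w : H ⊗[k] L)
    (hw : exch P (f ⊗ₜ[k] a) = w) :
    exch P (f ⊗ₜ[k] (a * b)) = dmul P (w ⊗ₜ[k] (b ⊗ₜ[k] (1 : L))) := by
  have h := LinearMap.congr_fun (ex_mulH hP) (f ⊗ₜ[k] (a ⊗ₜ[k] b))
  have h1 : ex P (f ⊗ₜ[k] a) = TensorProduct.comm k H L w := by
    rw [← hw]; simp [exch]
  simp only [LinearMap.comp_apply, op12, LinearEquiv.coe_coe, TensorProduct.assoc_symm_tmul,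
    LinearMap.rTensor_tmul, h1] at h
  simp only [mulH, LinearMap.lTensor_tmul, LinearMap.mul'_apply] at h
  rw [exch, LinearMap.comp_apply, h]
  clear h h1 hw
  induction w with
  | zero => simp
  | add x y hx hy => simp only [map_add, TensorProduct.add_tmul, hx, hy]
  | tmul x y =>
    rw [dmul_tmul]
    simp only [op13', op12, exch, LinearMap.comp_apply, LinearEquiv.coe_coe,
      TensorProduct.comm_tmul, TensorProduct.assoc_tmul, LinearMap.lTensor_tmul,
      TensorProduct.assoc_symm_tmul, LinearMap.rTensor_tmul]
    generalize ex P (y ⊗ₜ[k] b) = u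
    induction u with
    | zero => simp
    | add x y hx hy => simp only [map_add, TensorProduct.add_tmul, hx, hy]
    | tmul x y => simp [bim]

lemma bim_bim (a b : H) (f g : L) (z : H ⊗[k] L) : bim a g (bim b f z) = bim (a * b) (f * g) z := by
  induction z with
  | zero => simp
  | add x y hx hy => simp only [map_add, hx, hy]
  | tmul x y => simp [bim, mul_assoc]

lemma bim_one_one (z : H ⊗[k] L) : bim (k := k) 1 1 z = z := by
  induction z with
  | zero => simp
  | add x y hx hy => simp only [map_add, hx, hy]
  | tmul x y => simp [bim]

lemma dmul_bim_left (a : H) (x y : H ⊗[k] L) :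
    dmul P (bim a 1 x ⊗ₜ[k] y) = bim a 1 (dmul P (x ⊗ₜ[k] y)) := by
  induction x with
  | zero => simp
  | add x y hx hy => simp only [map_add, TensorProduct.add_tmul, hx, hy]
  | tmul b f =>
    induction y with
    | zero => simp
    | add x y hx hy => simp only [map_add, TensorProduct.tmul_add, hx, hy]
    | tmul c g =>
      have h : bim (k := k) a 1 (b ⊗ₜ[k] f) = (a * b) ⊗ₜ[k] f := by simp [bim]
      rw [h, dmul_tmul, dmul_tmul, bim_bim, mul_one]

lemma dmul_bim_right (g : L) (x y : H ⊗[k] L) :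
    dmul P (x ⊗ₜ[k] bim 1 g y) = bim 1 g (dmul P (x ⊗ₜ[k] y)) := by
  induction x with
  | zero => simp
  | add x y hx hy => simp only [map_add, TensorProduct.add_tmul, hx, hy]
  | tmul b f =>
    induction y with
    | zero => simp
    | add x y hx hy => simp only [map_add, TensorProduct.tmul_add, hx, hy]
    | tmul c h => rw [dmul_tmul, bim_bim]; simp [bim, dmul_tmul]

lemma dmul_left (hP : IsSkew P) (a c : H) (g h : L) (w : H ⊗[k] L) :
    dmul P (bim a g w ⊗ₜ[k] (c ⊗ₜ[k] h)) = bim a h (dmul P (w ⊗ₜ[k] exch P (g ⊗ₜ[k] c))) := by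
  induction w with
  | zero => simp
  | add x y hx hy => simp only [map_add, TensorProduct.add_tmul, hx, hy]
  | tmul x y =>
    have h1 : bim (k := k) a g (x ⊗ₜ[k] y) = (a * x) ⊗ₜ[k] (y * g) := by simp [bim]
    have h2 : x ⊗ₜ[k] y = bim (k := k) x 1 (1 ⊗ₜ[k] y) := by simp [bim]
    rw [h1, h2, dmul_bim_left, bim_bim, one_mul, dmul_tmul, exch_mul_left hP _ _ _ _ rfl]

lemma dmul_right (hP : IsSkew P) (a b : H) (f h : L) (w : H ⊗[k] L) :
    dmul P ((a ⊗ₜ[k] f) ⊗ₜ[k] bim b h w) = bim a h (dmul P (exch P (f ⊗ₜ[k] b) ⊗ₜ[k] w)) := by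
  induction w with
  | zero => simp
  | add x y hx hy => simp only [map_add, TensorProduct.tmul_add, hx, hy]
  | tmul x y =>
    have h1 : bim (k := k) b h (x ⊗ₜ[k] y) = (b * x) ⊗ₜ[k] (y * h) := by simp [bim]
    have h2 : x ⊗ₜ[k] y = bim (k := k) 1 y (x ⊗ₜ[k] 1) := by simp [bim]
    rw [h1, h2, dmul_bim_right, bim_bim, mul_one, dmul_tmul, exch_mul_right hP _ _ _ _ rfl]

lemma dmul_assoc (hP : IsSkew P) (x y z : H ⊗[k] L) :
    dmul P (dmul P (x ⊗ₜ[k] y) ⊗ₜ[k] z) = dmul P (x ⊗ₜ[k] dmul P (y ⊗ₜ[k] z)) := by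
  induction x with
  | zero => simp
  | add x y hx hy => simp only [map_add, TensorProduct.add_tmul, hx, hy]
  | tmul a f =>
    induction y with
    | zero => simp
    | add x y hx hy => simp only [map_add, TensorProduct.add_tmul, TensorProduct.tmul_add, hx, hy]
    | tmul b g =>
      induction z with
      | zero => simp
      | add x y hx hy => simp only [map_add, TensorProduct.tmul_add, hx, hy]
      | tmul c h => rw [dmul_tmul, dmul_left hP, dmul_tmul, dmul_right hP]

lemma exch_one_left (hP : IsSkew P) (a : H) : exch P (1 ⊗ₜ[k] a) = a ⊗ₜ[k] 1 := by
  simp [exch, ex_one_left hP]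

lemma exch_one_right (hP : IsSkew P) (f : L) : exch P (f ⊗ₜ[k] 1) = 1 ⊗ₜ[k] f := by
  simp [exch, ex_one_right hP]

lemma dmul_one_left (hP : IsSkew P) (x : H ⊗[k] L) : dmul P ((1 ⊗ₜ[k] 1) ⊗ₜ[k] x) = x := by
  induction x with
  | zero => simp
  | add x y hx hy => simp only [map_add, TensorProduct.tmul_add, hx, hy]
  | tmul a f => simp [dmul_tmul, exch_one_left hP, bim]

lemma dmul_one_right (hP : IsSkew P) (x : H ⊗[k] L) : dmul P (x ⊗ₜ[k] (1 ⊗ₜ[k] 1)) = x := by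
  induction x with
  | zero => simp
  | add x y hx hy => simp only [map_add, TensorProduct.add_tmul, hx, hy]
  | tmul a f => simp [dmul_tmul, exch_one_right hP, bim]

lemma comul_comm (c : L ⊗[k] H) : comul (R := k) (TensorProduct.comm k L H c) =
    TensorProduct.map (TensorProduct.comm k L H).toLinearMap
      (TensorProduct.comm k L H).toLinearMap (comul c) := by
  induction c with
  | zero => simp
  | add x y hx hy => simp only [map_add, hx, hy]
  | tmul f a =>
    rw [TensorProduct.comm_tmul, TensorProduct.comul_tmul, TensorProduct.comul_tmul]
    generalize comul (R := k) f = u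
    generalize comul (R := k) a = w
    induction u with
    | zero => simp
    | add x y hx hy => simp only [map_add, TensorProduct.add_tmul, TensorProduct.tmul_add, hx, hy]
    | tmul x y =>
      induction w with
      | zero => simp
      | add x y hx hy =>
        simp only [map_add, TensorProduct.add_tmul, TensorProduct.tmul_add, hx, hy]
      | tmul z w => simp

lemma comul_exch (hP : IsSkew P) (c : L ⊗[k] H) : comul (R := k) (exch P c) =
    TensorProduct.map (exch P) (exch P) (comul c) := by
  rw [exch, LinearMap.comp_apply, LinearEquiv.coe_coe, comul_comm, comul_ex hP,
    TensorProduct.map_comp, LinearMap.comp_apply]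

lemma counit_exch (hP : IsSkew P) (c : L ⊗[k] H) : counit (R := k) (exch P c) = counit c := by
  rw [← counit_ex hP c, exch, LinearMap.comp_apply]
  generalize ex P c = w
  induction w with
  | zero => simp
  | add x y hx hy => simp only [map_add, hx, hy]
  | tmul x y => simp [mul_comm]

end Dbl

end TwoParam

namespace TwoParam

open Coalgebra TensorProduct

namespace Dbl

variable {k H L : Type*} [CommRing k] [Ring H] [HopfAlgebra k H] [Ring L] [HopfAlgebra k L]

lemma comul_repr (a : H) (f : L) {ι κ : Type*} (A : Repr k a ι) (F : Repr k f κ) :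
    comul (R := k) (a ⊗ₜ[k] f) = ∑ i ∈ A.index, ∑ j ∈ F.index,
      (A.left i ⊗ₜ[k] F.left j) ⊗ₜ[k] (A.right i ⊗ₜ[k] F.right j) := by
  rw [TensorProduct.comul_tmul, ← A.eq, ← F.eq, TensorProduct.sum_tmul, map_sum]
  refine Finset.sum_congr rfl fun i _ => ?_
  rw [TensorProduct.tmul_sum, map_sum]
  rfl

lemma comul_bim (a : H) (g : L) (z : H ⊗[k] L) {ι κ : Type*} (A : Repr k a ι) (G : Repr k g κ) :
    comul (R := k) (bim a g z) = ∑ i ∈ A.index, ∑ j ∈ G.index,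
      TensorProduct.map (bim (A.left i) (G.left j)) (bim (A.right i) (G.right j)) (comul z) := by
  induction z with
  | zero => simp
  | add x y hx hy => simp only [map_add, hx, hy, Finset.sum_add_distrib]
  | tmul x y =>
    have h1 : bim (k := k) a g (x ⊗ₜ[k] y) = (a * x) ⊗ₜ[k] (y * g) := by simp [bim]
    rw [h1, TensorProduct.comul_tmul, TensorProduct.comul_tmul, Bialgebra.comul_mul,
      Bialgebra.comul_mul, ← A.eq, ← G.eq]
    generalize comul (R := k) x = u
    generalize comul (R := k) y = w
    induction u with
    | zero => simp
    | add x y hx hy =>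
      simp only [map_add, TensorProduct.add_tmul, mul_add, hx, hy, Finset.sum_add_distrib]
    | tmul x y =>
      induction w with
      | zero => simp
      | add x y hx hy =>
        simp only [map_add, TensorProduct.tmul_add, add_mul, hx, hy, Finset.sum_add_distrib]
      | tmul z w =>
        simp only [Finset.sum_mul, Finset.mul_sum, Algebra.TensorProduct.tmul_mul_tmul,
          TensorProduct.sum_tmul, TensorProduct.tmul_sum, map_sum,
          TensorProduct.AlgebraTensorModule.tensorTensorTensorComm_tmul, TensorProduct.map_tmul]
        rw [Finset.sum_comm]
        simp [bim]

end Dbl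

section double

variable {k H L : Type*} [CommRing k] [Ring H] [HopfAlgebra k H] [Ring L] [HopfAlgebra k L]

/-- The bilinear form of a Hopf pairing between the co-opposite of `L` and `H`, as a form on
`L × H`. -/
def HopfPairing.onL (p : HopfPairing k (Coop L) H) : L →ₗ[k] H →ₗ[k] k :=
  p.form ∘ₗ (Coop.of k).toLinearMap

lemma HopfPairing.isSkew (p : HopfPairing k (Coop L) H) : Dbl.IsSkew p.onL where
  one_left h := p.one_left h
  one_right f := p.one_right (Coop.of k f)
  mul_right f x y := by
    refine (p.mul_right (Coop.of k f) x y).trans ?_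
    rw [Coop.comul_of]
    generalize TensorProduct.comm k L L (comul f) = u
    induction u with
    | zero => simp
    | add x y hx hy => simp only [map_add, hx, hy]
    | tmul x y => rfl
  mul_left f g h := p.mul_left (Coop.of k f) (Coop.of k g) h

/-- The Drinfeld double of `H` and `L = (H')^coop`, where `H' = L^coop`, with respect to a Hopf
pairing `H' × H → k`. The underlying coalgebra is `H ⊗ L`; the multiplication is
`(a ⊗ f)(a' ⊗ f') = ∑ (S_L(f₍₁₎), a'₍₁₎) (f₍₃₎, a'₍₃₎) a a'₍₂₎ ⊗ f₍₂₎ f'`,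
the iterated coproduct of `f` being taken in `L`; the unit is `1 ⊗ 1`; the antipode is
`S(a ⊗ f) = (1 ⊗ S_L(f)) (S_H(a) ⊗ 1)`. -/
def DrinfeldDouble (_p : HopfPairing k (Coop L) H) : Type _ := H ⊗[k] L

namespace DrinfeldDouble

variable (p : HopfPairing k (Coop L) H)

instance : AddCommGroup (DrinfeldDouble p) := inferInstanceAs (AddCommGroup (H ⊗[k] L))
instance : Module k (DrinfeldDouble p) := inferInstanceAs (Module k (H ⊗[k] L))
instance : Coalgebra k (DrinfeldDouble p) := inferInstanceAs (Coalgebra k (H ⊗[k] L))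

/-- The element `a ⊗ f` of the double. -/
def tm (a : H) (f : L) : DrinfeldDouble p := a ⊗ₜ[k] f

instance : Mul (DrinfeldDouble p) := ⟨fun x y => Dbl.dmul p.onL (x ⊗ₜ[k] y)⟩
instance : One (DrinfeldDouble p) := ⟨tm p 1 1⟩

variable {p}

lemma mul_def (x y : DrinfeldDouble p) : x * y = Dbl.dmul p.onL (x ⊗ₜ[k] y) := rfl

instance : Ring (DrinfeldDouble p) :=
  { (inferInstance : AddCommGroup (DrinfeldDouble p)),
    (inferInstance : Mul (DrinfeldDouble p)),
    (inferInstance : One (DrinfeldDouble p)) with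
    left_distrib := fun x y z => by
      simp only [mul_def]
      exact (congrArg _ (TensorProduct.tmul_add (R := k) (M := H ⊗[k] L) (N := H ⊗[k] L)
        x y z)).trans (map_add _ _ _)
    right_distrib := fun x y z => by
      simp only [mul_def]
      exact (congrArg _ (TensorProduct.add_tmul (R := k) (M := H ⊗[k] L) (N := H ⊗[k] L)
        x y z)).trans (map_add _ _ _)
    zero_mul := fun x =>
      (congrArg _ (TensorProduct.zero_tmul (R := k) (H ⊗[k] L) (N := H ⊗[k] L) x)).trans
        (map_zero (Dbl.dmul p.onL))
    mul_zero := fun x =>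
      (congrArg _ (TensorProduct.tmul_zero (R := k) (H ⊗[k] L) (M := H ⊗[k] L) x)).trans
        (map_zero (Dbl.dmul p.onL))
    mul_assoc := Dbl.dmul_assoc p.isSkew
    one_mul := Dbl.dmul_one_left p.isSkew
    mul_one := Dbl.dmul_one_right p.isSkew }

instance : Algebra k (DrinfeldDouble p) :=
  Algebra.ofModule
    (fun r x y => (congrArg _ (TensorProduct.smul_tmul' (R := k) (M := H ⊗[k] L) (N := H ⊗[k] L)
      r x y).symm).trans (map_smul (Dbl.dmul p.onL) r (x ⊗ₜ[k] y)))
    (fun r x y => (congrArg _ (TensorProduct.tmul_smul (R := k) (M := H ⊗[k] L) (N := H ⊗[k] L)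
      r x y)).trans (map_smul (Dbl.dmul p.onL) r (x ⊗ₜ[k] y)))

@[elab_as_elim]
lemma induction {motive : DrinfeldDouble p → Prop} (x : DrinfeldDouble p) (h0 : motive 0)
    (h : ∀ a f, motive (tm p a f)) (hadd : ∀ x y, motive x → motive y → motive (x + y)) :
    motive x := TensorProduct.induction_on x h0 h hadd

lemma tm_mul_tm (a b : H) (f g : L) :
    tm p a f * tm p b g = Dbl.bim a g (Dbl.exch p.onL (f ⊗ₜ[k] b)) := Dbl.dmul_tmul _ _ _ _ _

lemma comul_tm (a : H) (f : L) {ι κ : Type*} (A : Repr k a ι) (F : Repr k f κ) :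
    comul (R := k) (tm p a f) = ∑ i ∈ A.index, ∑ j ∈ F.index,
      (tm p (A.left i) (F.left j)) ⊗ₜ[k] (tm p (A.right i) (F.right j)) :=
  Dbl.comul_repr a f A F

lemma counit_tm (a : H) (f : L) :
    counit (R := k) (tm p a f) = counit (R := k) a * counit (R := k) f :=
  (TensorProduct.counit_tmul (R := k) (S := k) a f).trans (mul_comm _ _)

lemma counit_mul' (x y : DrinfeldDouble p) :
    counit (R := k) (x * y) = counit (R := k) x * counit (R := k) y := by
  induction x using induction with
  | h0 => simp
  | hadd x y hx hy => simp only [add_mul, map_add, hx, hy]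
  | h a f =>
    induction y using induction with
    | h0 => simp
    | hadd x y hx hy => simp only [mul_add, map_add, hx, hy]
    | h b g =>
      have h1 (z : H ⊗[k] L) : counit (R := k) (Dbl.bim a g z) =
          counit (R := k) a * counit (R := k) z * counit (R := k) g := by
        induction z with
        | zero => simp
        | add x y hx hy => simp only [map_add, hx, hy, mul_add, add_mul]
        | tmul x y => simp [Dbl.bim]; ring
      rw [tm_mul_tm, counit_tm, counit_tm]
      refine (h1 _).trans ?_
      rw [Dbl.counit_exch p.isSkew]
      simp
      ring

lemma comul_mul' (x y : DrinfeldDouble p) :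
    comul (R := k) (x * y) = comul (R := k) x * comul (R := k) y := by
  induction x using induction with
  | h0 => simp
  | hadd x y hx hy => simp only [add_mul, map_add, hx, hy]
  | h a f =>
    induction y using induction with
    | h0 => simp
    | hadd x y hx hy => simp only [mul_add, map_add, hx, hy]
    | h b g =>
      rw [comul_tm a f (ℛ k a) (ℛ k f), comul_tm b g (ℛ k b) (ℛ k g), tm_mul_tm]
      refine (Dbl.comul_bim a g _ (ℛ k a) (ℛ k g)).trans ?_
      rw [Dbl.comul_exch p.isSkew, Dbl.comul_repr f b (ℛ k f) (ℛ k b)]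
      simp only [Finset.sum_mul]
      simp only [Finset.mul_sum]
      simp only [map_sum, TensorProduct.map_tmul,
        Algebra.TensorProduct.tmul_mul_tmul, tm_mul_tm]
      refine Finset.sum_congr rfl fun i _ => ?_
      rw [Finset.sum_comm]
      refine Finset.sum_congr rfl fun j _ => ?_
      rw [Finset.sum_comm]
      rfl

instance : Bialgebra k (DrinfeldDouble p) :=
  Bialgebra.mk' k (DrinfeldDouble p)
    (by
      refine (counit_tm (p := p) 1 1).trans ?_
      simp)
    (fun {a b} => counit_mul' a b)
    (by
      change comul (R := k) ((1 : H) ⊗ₜ[k] (1 : L)) = _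
      rw [TensorProduct.comul_tmul, Bialgebra.comul_one, Bialgebra.comul_one]
      rfl)
    (fun {a b} => comul_mul' a b)

variable (p)

/-- The antipode `S(a ⊗ f) = (1 ⊗ S_L(f)) (S_H(a) ⊗ 1)`. -/
def anti : DrinfeldDouble p →ₗ[k] DrinfeldDouble p :=
  TensorProduct.lift (LinearMap.mk₂ k
    (fun (a : H) (f : L) => tm p 1 (HopfAlgebra.antipode k f) * tm p (HopfAlgebra.antipode k a) 1)
    (fun a b f => by
      rw [map_add, ← mul_add]
      exact congrArg _ (TensorProduct.add_tmul _ _ _))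
    (fun c a f => by
      rw [map_smul, ← mul_smul_comm]
      exact congrArg _ (TensorProduct.smul_tmul' _ _ _).symm)
    (fun a f g => by
      rw [map_add, ← add_mul]
      exact congrArg (· * _) (TensorProduct.tmul_add _ _ _))
    (fun c a f => by
      rw [map_smul, ← smul_mul_assoc]
      exact congrArg (· * _) (TensorProduct.tmul_smul _ _ _)))

variable {p}

lemma anti_tm (a : H) (f : L) : anti p (tm p a f) =
    tm p 1 (HopfAlgebra.antipode k f) * tm p (HopfAlgebra.antipode k a) 1 :=
  TensorProduct.lift.tmul _ _

lemma tm_eq (a : H) (f : L) : tm p a f = tm p a 1 * tm p 1 f := by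
  rw [tm_mul_tm, Dbl.exch_one_left p.isSkew]
  simp [Dbl.bim, tm]
  rfl

lemma tmH_mul (a b : H) : tm p a 1 * tm p b 1 = tm p (a * b) 1 := by
  rw [tm_mul_tm, Dbl.exch_one_left p.isSkew]
  simp [Dbl.bim, tm]
  rfl

lemma tmL_mul (f g : L) : tm p 1 f * tm p 1 g = tm p 1 (f * g) := by
  rw [tm_mul_tm, Dbl.exch_one_right p.isSkew]
  simp [Dbl.bim, tm]
  rfl

variable (p) in
/-- The embedding `a ↦ a ⊗ 1` of algebras. -/
def inH : H →ₗ[k] DrinfeldDouble p := (TensorProduct.mk k H L).flip 1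

variable (p) in
/-- The embedding `f ↦ 1 ⊗ f` of algebras. -/
def inL : L →ₗ[k] DrinfeldDouble p := TensorProduct.mk k H L 1

lemma inH_apply (a : H) : inH p a = tm p a 1 := rfl
lemma inL_apply (f : L) : inL p f = tm p 1 f := rfl
lemma inH_one : inH p 1 = 1 := rfl
lemma inL_one : inL p 1 = 1 := rfl

instance : HopfAlgebra k (DrinfeldDouble p) where
  antipode := anti p
  mul_antipode_rTensor_comul := by
    ext x
    simp only [LinearMap.comp_apply]
    induction x using induction with
    | h0 => simp
    | hadd x y hx hy => simp only [map_add, hx, hy]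
    | h a f =>
      rw [comul_tm a f (ℛ k a) (ℛ k f), counit_tm]
      simp only [map_sum, LinearMap.rTensor_tmul, LinearMap.mul'_apply, anti_tm]
      have h (i j) : tm p 1 (HopfAlgebra.antipode k ((ℛ k f).left j)) *
          tm p (HopfAlgebra.antipode k ((ℛ k a).left i)) 1 *
            tm p ((ℛ k a).right i) ((ℛ k f).right j) =
          inL p (HopfAlgebra.antipode k ((ℛ k f).left j)) *
          inH p (HopfAlgebra.antipode k ((ℛ k a).left i) * (ℛ k a).right i) *
          inL p ((ℛ k f).right j) := by
        rw [tm_eq ((ℛ k a).right i), inH_apply, ← tmH_mul, inL_apply, inL_apply]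
        simp only [mul_assoc]
      simp only [h]
      rw [Finset.sum_comm]
      simp only [← Finset.sum_mul, ← Finset.mul_sum, ← map_sum,
        HopfAlgebra.sum_antipode_mul_eq_smul, map_smul, inH_one, mul_smul_comm, smul_mul_assoc,
        mul_one, inL_apply, tmL_mul]
      simp only [← inL_apply, ← Finset.smul_sum, ← map_sum, HopfAlgebra.sum_antipode_mul_eq_smul]
      simp [inL_one, Algebra.algebraMap_eq_smul_one, smul_smul]
  mul_antipode_lTensor_comul := by
    ext x
    simp only [LinearMap.comp_apply]
    induction x using induction with
    | h0 => simp
    | hadd x y hx hy => simp only [map_add, hx, hy]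
    | h a f =>
      rw [comul_tm a f (ℛ k a) (ℛ k f), counit_tm]
      simp only [map_sum, LinearMap.lTensor_tmul, LinearMap.mul'_apply, anti_tm]
      have h (i j) : tm p ((ℛ k a).left i) ((ℛ k f).left j) *
          (tm p 1 (HopfAlgebra.antipode k ((ℛ k f).right j)) *
          tm p (HopfAlgebra.antipode k ((ℛ k a).right i)) 1) =
          inH p ((ℛ k a).left i) *
          inL p ((ℛ k f).left j * HopfAlgebra.antipode k ((ℛ k f).right j)) *
          inH p (HopfAlgebra.antipode k ((ℛ k a).right i)) := by
        rw [tm_eq ((ℛ k a).left i), inL_apply, ← tmL_mul, inH_apply, inH_apply]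
        simp only [mul_assoc]
      simp only [h]
      simp only [← Finset.sum_mul, ← Finset.mul_sum, ← map_sum,
        HopfAlgebra.sum_mul_antipode_eq_smul, map_smul, inL_one, mul_smul_comm, smul_mul_assoc,
        mul_one, inH_apply, tmH_mul]
      simp only [← inH_apply, ← Finset.smul_sum, ← map_sum, HopfAlgebra.sum_mul_antipode_eq_smul]
      simp [inH_one, Algebra.algebraMap_eq_smul_one, smul_smul, mul_comm]

end DrinfeldDouble

end double

end TwoParam

namespace TwoParam

/-- The field `ℚ(v, t)` of rational functions in two variables. -/
abbrev Qvt : Type := FractionRing (MvPolynomial (Fin 2) ℚ)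

lemma algebraMap_X_ne_zero (i : Fin 2) :
    algebraMap (MvPolynomial (Fin 2) ℚ) Qvt (MvPolynomial.X i) ≠ 0 := by
  rw [Ne, IsFractionRing.to_map_eq_zero_iff]
  exact MvPolynomial.X_ne_zero i

/-- The indeterminate `v`. -/
def vQ : Qvtˣ := Units.mk0 _ (algebraMap_X_ne_zero 0)

/-- The indeterminate `t`. -/
def tQ : Qvtˣ := Units.mk0 _ (algebraMap_X_ne_zero 1)

/-- The two-parameter quantum algebra `U_{v,t}(sl_n)` over `ℚ(v, t)`. -/
abbrev Uvt (n : ℕ) : Type := QAlg vQ tQ n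

/-- The Hopf subalgebra `B` of `U_{v,t}(sl_n)` generated by `E_i`, `K_i^{±1}`. -/
abbrev BU (n : ℕ) : Subalgebra Qvt (Uvt n) := QAlg.BPos vQ tQ n

/-- The Hopf subalgebra `B'` of `U_{v,t}(sl_n)` generated by `F_i`, `K_i'^{±1}`. -/
abbrev BU' (n : ℕ) : Subalgebra Qvt (Uvt n) := QAlg.BNeg vQ tQ n

/-- The values on generators which single out the Hopf pairing `B'^coop × B → ℚ(v, t)`:
`(F_i, E_j) = δ_{ij} / (v⁻¹ - v)`, `(K_i', K_j) = v^{j·i} t^{⟨j,i⟩ - ⟨i,j⟩}`,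
`(F_i, K_j) = 0`, `(K_i', E_j) = 0`. -/
structure IsBorelPairing {n : ℕ} (p : HopfPairing Qvt (Coop (BU' n)) (BU n)) : Prop where
  F_E (i j : Fin (n - 1)) :
    p.form (Coop.of Qvt ⟨QAlg.F vQ tQ i, QAlg.F_mem vQ tQ i⟩)
      ⟨QAlg.E vQ tQ j, QAlg.E_mem vQ tQ j⟩ =
        if i = j then ((vQ : Qvt)⁻¹ - (vQ : Qvt))⁻¹ else 0
  K'_K (i j : Fin (n - 1)) :
    p.form (Coop.of Qvt ⟨QAlg.K' vQ tQ i, QAlg.K'_mem vQ tQ i⟩)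
      ⟨QAlg.K vQ tQ j, QAlg.K_mem vQ tQ j⟩ =
        (vQ : Qvt) ^ dot j i * (tQ : Qvt) ^ (Om j i - Om i j)
  F_K (i j : Fin (n - 1)) :
    p.form (Coop.of Qvt ⟨QAlg.F vQ tQ i, QAlg.F_mem vQ tQ i⟩)
      ⟨QAlg.K vQ tQ j, QAlg.K_mem vQ tQ j⟩ = 0
  K'_E (i j : Fin (n - 1)) :
    p.form (Coop.of Qvt ⟨QAlg.K' vQ tQ i, QAlg.K'_mem vQ tQ i⟩)
      ⟨QAlg.E vQ tQ j, QAlg.E_mem vQ tQ j⟩ = 0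

end TwoParam

end

/-! Write B and B' for the subalgebras generated by the E_i, K_i^{±1} and by the F_i, K_i'^{±1}, and
D for the double. The isomorphism is the inverse of the evident map U → D, E_i, K_i ↦ a ⊗ 1 and F_i,
K_i' ↦ 1 ⊗ f. Two things carry it. First, the map exists: convolution with the pairing is
invertible, so the product (1 ⊗ f)(a ⊗ 1) in D is characterised by an equation free of antipodes
(`inL_mul_inH`), which on generators turns into the mixed relations of U (`cross_E_E`, `cross_K_E`,
`cross_E_K`). Second, it is bijective: the relations of U move every F_i and K_i' to the right of
every E_j and K_j, so multiplication B ⊗ B' → U is onto (`mulMap_surjective`); and since a ⊗ f = (a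
⊗ 1)(1 ⊗ f) in D, the composite B ⊗ B' → U → D is the identity of the underlying space
(`hom_mulMap`). An identity that factors through a surjection makes both factors bijective, so
neither a PBW basis nor nondegeneracy of the pairing is needed, and no condition on v or t.

The pairing still has to be constructed, and for that one must know all relations among the
generators of B and of B'. Let Bor(v, t) be the algebra presented by the evident relations among the
E_i, K_i^{±1}; the F_i, K_i'^{±1} satisfy the relations of Bor(v, t⁻¹). A Hopf pairing of Bor(v,
t⁻¹) with Bor(v, t) is an algebra map into the convolution algebra of functionals on Bor(v, t),
compatible with the transpose of multiplication. The images of the K_i are characters, those of the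
E_i are corner entries of triangular 2 × 2 representations (`tri`). Their relations hold because
each relator is a skew derivation, which vanishes as soon as it vanishes on generators
(`eq_zero_of_skew`).

The first half of the argument, applied to these presented algebras, gives a map from U to their
double. Restricted along Bor(v, t) → B → U it is the embedding of a tensor factor, so Bor(v, t) → B
is injective, hence an isomorphism (`posHom_injective`), and likewise for B'. The pairing is
transported along these isomorphisms, and the same map U → D is then used for B and B' themselves;
this is why `BorelGens` is stated for arbitrary Hopf algebras containing elements that look like
Borel generators.

Uniqueness of the pairing is the usual propagation from generators (`ext_of_gens`, `ext_of_E_K`),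
and a bialgebra map between Hopf algebras automatically respects antipodes (`map_antipode`). -/

noncomputable section

/-! ### The Borel algebra by generators and relations -/

namespace TwoParam

/-- The generating symbols `E_i`, `K_i^{±1}` of a Borel algebra. -/
inductive BorGen (n : ℕ) : Type
  | E (i : Fin (n - 1))
  | K (i : Fin (n - 1))
  | Kinv (i : Fin (n - 1))

/-- The symbols `K_i^{±1}`. -/
def BorGen.IsTorus {n : ℕ} : BorGen n → Prop
  | .E _ => False
  | _ => True

variable {k : Type*} [Field k]

/-- The defining relations among the `E_i`, `K_i^{±1}`. -/
inductive BorRel (v t : kˣ) (n : ℕ) :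
    FreeAlgebra k (BorGen n) → FreeAlgebra k (BorGen n) → Prop
  | comm (x y : BorGen n) (hx : x.IsTorus) (hy : y.IsTorus) :
      BorRel v t n (FreeAlgebra.ι k x * FreeAlgebra.ι k y) (FreeAlgebra.ι k y * FreeAlgebra.ι k x)
  | K_Kinv (i : Fin (n - 1)) :
      BorRel v t n (FreeAlgebra.ι k (.K i) * FreeAlgebra.ι k (.Kinv i)) 1
  | Kinv_K (i : Fin (n - 1)) :
      BorRel v t n (FreeAlgebra.ι k (.Kinv i) * FreeAlgebra.ι k (.K i)) 1
  | KE (i j : Fin (n - 1)) : BorRel v t n (FreeAlgebra.ι k (.K i) * FreeAlgebra.ι k (.E j))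
      (((v ^ dot i j * t ^ (Om i j - Om j i) : kˣ) : k) •
        (FreeAlgebra.ι k (.E j) * FreeAlgebra.ι k (.K i)))
  | E_E (i j : Fin (n - 1)) (h : 1 < |(i : ℤ) - (j : ℤ)|) :
      BorRel v t n (FreeAlgebra.ι k (.E i) * FreeAlgebra.ι k (.E j))
        (FreeAlgebra.ι k (.E j) * FreeAlgebra.ι k (.E i))
  | serre₁ (i j : Fin (n - 1)) (h : (j : ℕ) = (i : ℕ) + 1) :
      BorRel v t n (srr (v : k) t (FreeAlgebra.ι k (.E i)) (FreeAlgebra.ι k (.E j))) 0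
  | serre₂ (i j : Fin (n - 1)) (h : (j : ℕ) = (i : ℕ) + 1) :
      BorRel v t n (srr (v : k) (t : k)⁻¹ (FreeAlgebra.ι k (.E j)) (FreeAlgebra.ι k (.E i))) 0

/-- The Borel algebra, presented by generators and relations. -/
def Bor (v t : kˣ) (n : ℕ) : Type _ := RingQuot (BorRel v t n)

lemma map_srr {A B : Type*} [Ring A] [Algebra k A] [Ring B] [Algebra k B] (f : A →ₐ[k] B)
    (v s : k) (a b : A) : f (srr v s a b) = srr v s (f a) (f b) := by
  simp only [srr, map_add, map_sub, map_smul, map_mul, map_pow]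

namespace Bor

/-- Elements `e x` of an algebra satisfy the defining relations of the Borel algebra. -/
structure Sat (v t : kˣ) {n : ℕ} {A : Type*} [Ring A] [Algebra k A] (e : BorGen n → A) :
    Prop where
  comm (x y : BorGen n) (hx : x.IsTorus) (hy : y.IsTorus) : e x * e y = e y * e x
  K_Kinv (i : Fin (n - 1)) : e (.K i) * e (.Kinv i) = 1
  Kinv_K (i : Fin (n - 1)) : e (.Kinv i) * e (.K i) = 1
  KE (i j : Fin (n - 1)) : e (.K i) * e (.E j) =
      ((v ^ dot i j * t ^ (Om i j - Om j i) : kˣ) : k) • (e (.E j) * e (.K i))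
  E_E (i j : Fin (n - 1)) (h : 1 < |(i : ℤ) - (j : ℤ)|) : e (.E i) * e (.E j) = e (.E j) * e (.E i)
  serre₁ (i j : Fin (n - 1)) (h : (j : ℕ) = (i : ℕ) + 1) :
      srr (v : k) t (e (.E i)) (e (.E j)) = 0
  serre₂ (i j : Fin (n - 1)) (h : (j : ℕ) = (i : ℕ) + 1) :
      srr (v : k) (t : k)⁻¹ (e (.E j)) (e (.E i)) = 0

section presentation

variable (v t : kˣ) (n : ℕ)

instance : Ring (Bor v t n) := inferInstanceAs (Ring (RingQuot (BorRel v t n)))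
instance : Algebra k (Bor v t n) := inferInstanceAs (Algebra k (RingQuot (BorRel v t n)))

/-- The quotient map from the free algebra. -/
def mk : FreeAlgebra k (BorGen n) →ₐ[k] Bor v t n := RingQuot.mkAlgHom k (BorRel v t n)

variable {n}

/-- The image of a generating symbol. -/
def of (x : BorGen n) : Bor v t n := mk v t n (FreeAlgebra.ι k x)

variable {v t}

lemma mk_eq {a b : FreeAlgebra k (BorGen n)} (h : BorRel v t n a b) : mk v t n a = mk v t n b :=
  RingQuot.mkAlgHom_rel k h

lemma sat_of (v t : kˣ) {n : ℕ} : Sat v t (of v t (n := n)) where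
  comm x y hx hy := by
    simpa only [map_mul, of] using mk_eq (BorRel.comm (v := v) (t := t) x y hx hy)
  K_Kinv i := by
    simpa only [map_mul, map_one, of] using mk_eq (BorRel.K_Kinv (v := v) (t := t) i)
  Kinv_K i := by
    simpa only [map_mul, map_one, of] using mk_eq (BorRel.Kinv_K (v := v) (t := t) i)
  KE i j := by
    simpa only [map_mul, map_smul, of] using mk_eq (BorRel.KE (v := v) (t := t) i j)
  E_E i j h := by
    simpa only [map_mul, of] using mk_eq (BorRel.E_E (v := v) (t := t) i j h)
  serre₁ i j h := by
    simpa only [map_srr, map_zero, of] using mk_eq (BorRel.serre₁ (v := v) (t := t) i j h)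
  serre₂ i j h := by
    simpa only [map_srr, map_zero, of] using mk_eq (BorRel.serre₂ (v := v) (t := t) i j h)

variable {A : Type*} [Ring A] [Algebra k A]

/-- The universal property of the Borel algebra. -/
def lift (e : BorGen n → A) (he : Sat v t e) : Bor v t n →ₐ[k] A :=
  RingQuot.liftAlgHom k ⟨FreeAlgebra.lift k e, by
    intro x y h
    induction h with
    | comm x y hx hy => simpa only [map_mul, FreeAlgebra.lift_ι_apply] using he.comm x y hx hy
    | K_Kinv i => simpa only [map_mul, map_one, FreeAlgebra.lift_ι_apply] using he.K_Kinv i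
    | Kinv_K i => simpa only [map_mul, map_one, FreeAlgebra.lift_ι_apply] using he.Kinv_K i
    | KE i j => simpa only [map_mul, map_smul, FreeAlgebra.lift_ι_apply] using he.KE i j
    | E_E i j h => simpa only [map_mul, FreeAlgebra.lift_ι_apply] using he.E_E i j h
    | serre₁ i j h =>
      simpa only [map_srr, map_zero, FreeAlgebra.lift_ι_apply] using he.serre₁ i j h
    | serre₂ i j h =>
      simpa only [map_srr, map_zero, FreeAlgebra.lift_ι_apply] using he.serre₂ i j h⟩

@[simp] lemma lift_of (e : BorGen n → A) (he : Sat v t e) (x : BorGen n) :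
    lift e he (of v t x) = e x := by
  unfold lift of mk
  exact (RingQuot.liftAlgHom_mkAlgHom_apply _ _ _ _).trans (FreeAlgebra.lift_ι_apply _ _)

lemma hom_ext {f g : Bor v t n →ₐ[k] A} (h : ∀ x, f (of v t x) = g (of v t x)) : f = g :=
  RingQuot.ringQuot_ext' k f g (FreeAlgebra.hom_ext (funext h))

lemma adjoin_of : Algebra.adjoin k (Set.range (of v t (n := n))) = ⊤ := by
  have h : (mk v t n).range = ⊤ :=
    (AlgHom.range_eq_top _).2 (RingQuot.mkAlgHom_surjective k (BorRel v t n))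
  rw [← h, ← Algebra.map_top, ← FreeAlgebra.adjoin_range_ι, AlgHom.map_adjoin, ← Set.range_comp]
  rfl

lemma mem_adjoin_of (x : Bor v t n) : x ∈ Algebra.adjoin k (Set.range (of v t (n := n))) :=
  adjoin_of (v := v) (t := t) (n := n) ▸ Algebra.mem_top

end presentation

/-! ### Comultiplication, counit, antipode and inverse antipode on Borel generators -/

section structure_maps

variable {v t : kˣ} {n : ℕ} {A : Type*} [Ring A] [Algebra k A] {e : BorGen n → A}

namespace Sat

lemma map {B : Type*} [Ring B] [Algebra k B] (he : Sat v t e) (f : A →ₐ[k] B) :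
    Sat v t (fun x => f (e x)) where
  comm x y hx hy := by simp only [← map_mul, he.comm x y hx hy]
  K_Kinv i := by rw [← map_mul, he.K_Kinv, map_one]
  Kinv_K i := by rw [← map_mul, he.Kinv_K, map_one]
  KE i j := by rw [← map_mul, he.KE, map_smul, map_mul]
  E_E i j h := by simp only [← map_mul, he.E_E i j h]
  serre₁ i j h := by rw [← map_srr, he.serre₁ i j h, map_zero]
  serre₂ i j h := by rw [← map_srr, he.serre₂ i j h, map_zero]

/-- Lets the subalgebras `BPos` and `BNeg` inherit relations that are checked in the whole quantum
algebra. -/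
lemma of_injective {B : Type*} [Ring B] [Algebra k B] (f : A →ₐ[k] B)
    (hf : Function.Injective f) (he : Sat v t (fun x => f (e x))) : Sat v t e where
  comm x y hx hy := hf (by simpa only [map_mul] using he.comm x y hx hy)
  K_Kinv i := hf (by simpa only [map_mul, map_one] using he.K_Kinv i)
  Kinv_K i := hf (by simpa only [map_mul, map_one] using he.Kinv_K i)
  KE i j := hf (by simpa only [map_mul, map_smul] using he.KE i j)
  E_E i j h := hf (by simpa only [map_mul] using he.E_E i j h)
  serre₁ i j h := hf (by simpa only [map_srr, map_zero] using he.serre₁ i j h)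
  serre₂ i j h := hf (by simpa only [map_srr, map_zero] using he.serre₂ i j h)

lemma KE_self (he : Sat v t e) (i : Fin (n - 1)) :
    e (.K i) * e (.E i) = (v : k) ^ 2 • (e (.E i) * e (.K i)) := by
  simpa [dot, Om_self, zpow_two, pow_two] using he.KE i i

lemma KE_up (he : Sat v t e) {i j : Fin (n - 1)} (h : (j : ℕ) = (i : ℕ) + 1) :
    e (.K i) * e (.E j) = ((v : k)⁻¹ * t) • (e (.E j) * e (.K i)) := by
  simpa [dot, (Om_succ h).1, (Om_succ h).2] using he.KE i j

lemma KE_down (he : Sat v t e) {i j : Fin (n - 1)} (h : (j : ℕ) = (i : ℕ) + 1) :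
    e (.K j) * e (.E i) = ((v : k)⁻¹ * (t : k)⁻¹) • (e (.E i) * e (.K j)) := by
  simpa [dot, (Om_succ h).1, (Om_succ h).2] using he.KE j i

lemma KE_far (he : Sat v t e) {i j : Fin (n - 1)} (h : 1 < |(i : ℤ) - (j : ℤ)|) :
    e (.K i) * e (.E j) = e (.E j) * e (.K i) := by
  simpa [dot, (Om_far h).1, (Om_far h).2] using he.KE i j

lemma EKinv (he : Sat v t e) {i j : Fin (n - 1)} {c : k}
    (h : e (.K i) * e (.E j) = c • (e (.E j) * e (.K i))) :
    e (.E j) * e (.Kinv i) = c • (e (.Kinv i) * e (.E j)) :=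
  QAlg.inv_comm_of (he.K_Kinv i) (he.Kinv_K i) h

end Sat

/-- The comultiplication on generators: `K ↦ K ⊗ K`, `E ↦ E ⊗ 1 + K ⊗ E`. -/
def comulGen (e : BorGen n → A) : BorGen n → A ⊗[k] A
  | .E i => e (.E i) ⊗ₜ 1 + e (.K i) ⊗ₜ e (.E i)
  | .K i => e (.K i) ⊗ₜ e (.K i)
  | .Kinv i => e (.Kinv i) ⊗ₜ e (.Kinv i)

lemma comulGen_torus (e : BorGen n → A) {x : BorGen n} (hx : x.IsTorus) :
    comulGen (k := k) e x = e x ⊗ₜ e x := by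
  cases x <;> first | rfl | exact hx.elim

/-- The Serre element is skew-primitive. This is proved from the torus relations alone, without
assuming that the element vanishes, because it serves twice: to check the comultiplication, where
the element is zero, and in the dual, where skew-primitivity is what forces it to be zero. -/
lemma srr_comulGen {s : k} (hs : s ≠ 0) {i j : Fin (n - 1)}
    (hK : e (.K i) * e (.K j) = e (.K j) * e (.K i))
    (h₁₁ : e (.K i) * e (.E i) = (v : k) ^ 2 • (e (.E i) * e (.K i)))
    (h₁₂ : e (.K i) * e (.E j) = ((v : k)⁻¹ * s) • (e (.E j) * e (.K i)))
    (h₂₁ : e (.K j) * e (.E i) = ((v : k)⁻¹ * s⁻¹) • (e (.E i) * e (.K j))) :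
    srr (v : k) s (comulGen (k := k) e (.E i)) (comulGen (k := k) e (.E j)) =
      srr (v : k) s (e (.E i)) (e (.E j)) ⊗ₜ 1 +
        (e (.K i) * e (.K i) * e (.K j)) ⊗ₜ srr (v : k) s (e (.E i)) (e (.E j)) := by
  unfold comulGen
  rw [srr_add v.ne_zero hs, QAlg.srr_tmul_left, QAlg.srr_tmul_right' _ _ _ _ hK]
  · simp [h₁₁, TensorProduct.smul_tmul']
  · simp [h₁₂, TensorProduct.smul_tmul']
  · simp [h₂₁, TensorProduct.smul_tmul']

/-- The same for the commutator of two distant E's, again without assuming that it vanishes. -/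
lemma comm_comulGen {i j : Fin (n - 1)} (hK : e (.K i) * e (.K j) = e (.K j) * e (.K i))
    (h₁₂ : e (.K i) * e (.E j) = e (.E j) * e (.K i))
    (h₂₁ : e (.K j) * e (.E i) = e (.E i) * e (.K j)) :
    comulGen (k := k) e (.E i) * comulGen e (.E j) -
        comulGen (k := k) e (.E j) * comulGen e (.E i) =
      (e (.E i) * e (.E j) - e (.E j) * e (.E i)) ⊗ₜ 1 +
        (e (.K i) * e (.K j)) ⊗ₜ (e (.E i) * e (.E j) - e (.E j) * e (.E i)) := by
  simp only [comulGen, mul_add, add_mul, Algebra.TensorProduct.tmul_mul_tmul, mul_one, one_mul,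
    h₁₂, h₂₁, TensorProduct.sub_tmul, TensorProduct.tmul_sub, hK]
  abel

/-- The same for the relator between K_i and E_j. The scalar c is free, so that the formula also
applies in the dual, where t is replaced by t⁻¹. -/
lemma skew_comulGen (c : k) {i j : Fin (n - 1)}
    (hK : e (.K i) * e (.K j) = e (.K j) * e (.K i)) :
    comulGen (k := k) e (.K i) * comulGen e (.E j) -
        c • (comulGen (k := k) e (.E j) * comulGen e (.K i)) =
      (e (.K i) * e (.E j) - c • (e (.E j) * e (.K i))) ⊗ₜ e (.K i) +
        (e (.K i) * e (.K j)) ⊗ₜ (e (.K i) * e (.E j) - c • (e (.E j) * e (.K i))) := by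
  simp only [comulGen, mul_add, add_mul, Algebra.TensorProduct.tmul_mul_tmul, mul_one, one_mul,
    TensorProduct.sub_tmul, TensorProduct.tmul_sub, TensorProduct.tmul_smul,
    ← TensorProduct.smul_tmul', smul_add, hK]
  abel

lemma Sat.comul (he : Sat v t e) : Sat v t (comulGen (k := k) e) where
  comm x y hx hy := by
    simp [comulGen_torus e hx, comulGen_torus e hy, he.comm x y hx hy]
  K_Kinv i := by simp [comulGen, he.K_Kinv, Algebra.TensorProduct.one_def]
  Kinv_K i := by simp [comulGen, he.Kinv_K, Algebra.TensorProduct.one_def]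
  KE i j := by
    rw [← sub_eq_zero, skew_comulGen _ (he.comm _ _ trivial trivial), he.KE]
    simp
  E_E i j h := by
    have h' : 1 < |(j : ℤ) - (i : ℤ)| := by rwa [abs_sub_comm]
    rw [← sub_eq_zero, comm_comulGen (he.comm _ _ trivial trivial) (he.KE_far h) (he.KE_far h'),
      he.E_E i j h]
    simp
  serre₁ i j h := by
    rw [srr_comulGen t.ne_zero (he.comm _ _ trivial trivial) (he.KE_self i) (he.KE_up h)
      (he.KE_down h), he.serre₁ i j h]
    simp
  serre₂ i j h := by
    rw [srr_comulGen (inv_ne_zero t.ne_zero) (he.comm _ _ trivial trivial) (he.KE_self j)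
      (he.KE_down h) (by simpa using he.KE_up h), he.serre₂ i j h]
    simp

/-- The counit on generators. -/
def counitGen (k : Type*) [Field k] {n : ℕ} : BorGen n → k
  | .E _ => 0
  | _ => 1

lemma sat_counit (v t : kˣ) : Sat v t (counitGen k (n := n)) where
  comm x y hx hy := mul_comm _ _
  K_Kinv i := by simp [counitGen]
  Kinv_K i := by simp [counitGen]
  KE i j := by simp [counitGen]
  E_E i j h := by simp [counitGen]
  serre₁ i j h := by simp [counitGen, srr]
  serre₂ i j h := by simp [counitGen, srr]

/-- The antipode on generators, with values in the opposite algebra. -/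
def antipodeGen (e : BorGen n → A) : BorGen n → Aᵐᵒᵖ
  | .E i => .op (-(e (.Kinv i) * e (.E i)))
  | .K i => .op (e (.Kinv i))
  | .Kinv i => .op (e (.K i))

/-- The inverse of the antipode on generators, with values in the opposite algebra. -/
def antipodeInvGen (e : BorGen n → A) : BorGen n → Aᵐᵒᵖ
  | .E i => .op (-(e (.E i) * e (.Kinv i)))
  | .K i => .op (e (.Kinv i))
  | .Kinv i => .op (e (.K i))

/-- Pulling the factors K⁻¹ to one side of a monomial produces powers of v and t that match the
reversed order of the opposite algebra, so a relator goes to a torus element times itself; for the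
Serre relations this is `srr_anti`. -/
lemma Sat.anti (he : Sat v t e) : Sat v t (antipodeGen e) where
  comm x y hx hy := by
    apply MulOpposite.unop_injective
    cases x <;> cases y <;> first | exact hx.elim | exact hy.elim |
      exact he.comm _ _ trivial trivial
  K_Kinv i := congrArg MulOpposite.op (he.K_Kinv i)
  Kinv_K i := congrArg MulOpposite.op (he.Kinv_K i)
  KE i j := by
    apply MulOpposite.unop_injective
    simp only [antipodeGen, MulOpposite.unop_mul, MulOpposite.unop_op, MulOpposite.unop_smul,
      neg_mul, mul_neg, smul_neg, neg_inj]
    rw [mul_assoc, he.EKinv (he.KE i j), mul_smul_comm, ← mul_assoc, ← mul_assoc,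
      he.comm (.Kinv i) (.Kinv j) trivial trivial]
  E_E i j h := by
    have h' : 1 < |(j : ℤ) - (i : ℤ)| := by rwa [abs_sub_comm]
    have h2 := he.EKinv (c := 1) (by simpa using he.KE_far h)
    have h3 := he.EKinv (c := 1) (by simpa using he.KE_far h')
    rw [one_smul] at h2 h3
    have c1 : Commute (e (.Kinv i) * e (.E i)) (e (.Kinv j) * e (.E j)) := by
      apply Commute.mul_left <;> apply Commute.mul_right
      · exact he.comm _ _ trivial trivial
      · exact h2.symm
      · exact h3
      · exact he.E_E i j h
    apply MulOpposite.unop_injective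
    simp [antipodeGen, c1.eq]
  serre₁ i j h := srr_anti v.ne_zero t.ne_zero (he.comm _ _ trivial trivial)
    (he.EKinv (he.KE_self i)) (he.EKinv (he.KE_up h)) (he.EKinv (he.KE_down h)) (he.serre₁ i j h)
  serre₂ i j h := srr_anti v.ne_zero (inv_ne_zero t.ne_zero) (he.comm _ _ trivial trivial)
    (he.EKinv (he.KE_self j)) (he.EKinv (he.KE_down h))
    (he.EKinv (by simpa using he.KE_up h)) (he.serre₂ i j h)

/-- The scalar v² is the same for all i, so relations homogeneous in the E's pass from the antipode
to its inverse at no cost. -/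
lemma antipodeInvGen_E (he : Sat v t e) (i : Fin (n - 1)) :
    antipodeInvGen e (.E i) = (v : k) ^ 2 • antipodeGen e (.E i) := by
  simp only [antipodeInvGen, antipodeGen, he.EKinv (he.KE_self i), ← smul_neg,
    MulOpposite.op_smul]

lemma Sat.antiInv (he : Sat v t e) : Sat v t (antipodeInvGen e) where
  comm x y hx hy := by
    have := he.anti.comm x y hx hy
    cases x <;> cases y <;> first | exact hx.elim | exact hy.elim | exact this
  K_Kinv i := he.anti.K_Kinv i
  Kinv_K i := he.anti.Kinv_K i
  KE i j := by
    rw [antipodeInvGen_E he, mul_smul_comm, smul_mul_assoc, smul_comm]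
    exact congrArg _ (he.anti.KE i j)
  E_E i j h := by
    simp only [antipodeInvGen_E he, mul_smul_comm, smul_mul_assoc, he.anti.E_E i j h]
  serre₁ i j h := by
    rw [antipodeInvGen_E he, antipodeInvGen_E he, srr_smul, he.anti.serre₁ i j h, smul_zero]
  serre₂ i j h := by
    rw [antipodeInvGen_E he, antipodeInvGen_E he, srr_smul, he.anti.serre₂ i j h, smul_zero]

end structure_maps

/-! ### Hopf algebra structures on the Borel algebra and on its co-opposite -/

section hopf

open Coalgebra

variable (v t : kˣ) (n : ℕ)

instance : Bialgebra k (Bor v t n) :=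
  Bialgebra.ofAlgHom (lift _ (sat_of v t).comul) (lift _ (sat_counit v t))
    (by
      apply hom_ext
      intro x
      cases x <;> simp [comulGen, TensorProduct.add_tmul, TensorProduct.tmul_add, add_assoc,
        Algebra.TensorProduct.one_def])
    (by
      apply hom_ext
      intro x
      cases x <;> simp [comulGen, counitGen])
    (by
      apply hom_ext
      intro x
      cases x <;> simp [comulGen, counitGen])

variable {n}

lemma comul_of (x : BorGen n) : comul (R := k) (of v t x) = comulGen (of v t) x :=
  lift_of _ _ x

lemma counit_of (x : BorGen n) : counit (R := k) (of v t x) = counitGen k x :=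
  lift_of _ _ x

variable (n)

instance : HopfAlgebra k (Bor v t n) :=
  hopfOfAnti (lift _ (sat_of v t).anti) _ adjoin_of
    (by
      rintro _ ⟨x, rfl⟩
      rw [comul_of, counit_of]
      have h := sat_of v t (n := n)
      cases x <;> simp [comulGen, counitGen, antipodeGen, h.K_Kinv, h.Kinv_K])
    (by
      rintro _ ⟨x, rfl⟩
      rw [comul_of, counit_of]
      have h := sat_of v t (n := n)
      have h1 (i : Fin (n - 1)) (z : Bor v t n) : of v t (.K i) * (of v t (.Kinv i) * z) = z := by
        rw [← mul_assoc, h.K_Kinv, one_mul]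
      cases x <;> simp [comulGen, counitGen, antipodeGen, h.K_Kinv, h.Kinv_K, h1])

/-- The inverse of the antipode, as a map to the opposite of the co-opposite Hopf algebra. -/
def antipodeInv : Coop (Bor v t n) →ₐ[k] (Coop (Bor v t n))ᵐᵒᵖ :=
  (lift _ ((sat_of v t).map (Coop.of k : Bor v t n ≃ₐ[k] _).toAlgHom).antiInv).comp
    (Coop.of k : Bor v t n ≃ₐ[k] _).symm.toAlgHom

variable {n} in
lemma antipodeInv_of (x : BorGen n) : antipodeInv v t n (Coop.of k (of v t x)) =
    antipodeInvGen (fun x => Coop.of k (of v t x)) x :=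
  lift_of _ ((sat_of v t).map (Coop.of k : Bor v t n ≃ₐ[k] _).toAlgHom).antiInv x

lemma adjoin_coop :
    Algebra.adjoin k (Set.range fun x => Coop.of k (of v t (n := n) x)) = ⊤ := adjoin_of

variable {n} in
lemma comul_coop_of (x : BorGen n) : comul (R := k) (Coop.of k (of v t x)) =
    TensorProduct.comm k _ _ (comulGen (fun x => Coop.of k (of v t x)) x) := by
  rw [Coop.comul_of, comul_of]
  cases x <;> simp [comulGen]

/-- The factor L of the double must be a Hopf algebra whose coproduct is that of the F's, which is
the flip of the Borel coproduct. The antipode of a co-opposite is the inverse of the original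
antipode, hence `antipodeInv`. -/
instance : HopfAlgebra k (Coop (Bor v t n)) :=
  hopfOfAnti (antipodeInv v t n) _ (adjoin_coop v t n)
    (by
      rintro _ ⟨x, rfl⟩
      rw [comul_coop_of, Coop.counit_of, counit_of]
      have h := (sat_of v t (n := n)).map (Coop.of k : Bor v t n ≃ₐ[k] _).toAlgHom
      have h1 (i : Fin (n - 1)) :
          Coop.of k (of v t (.K i)) * Coop.of k (of v t (.Kinv i)) = 1 := h.K_Kinv i
      have h2 (i : Fin (n - 1)) :
          Coop.of k (of v t (.Kinv i)) * Coop.of k (of v t (.K i)) = 1 := h.Kinv_K i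
      cases x <;> simp [comulGen, counitGen, antipodeInv_of, antipodeInvGen, h1, h2, mul_assoc])
    (by
      rintro _ ⟨x, rfl⟩
      rw [comul_coop_of, Coop.counit_of, counit_of]
      have h := (sat_of v t (n := n)).map (Coop.of k : Bor v t n ≃ₐ[k] _).toAlgHom
      have h1 (i : Fin (n - 1)) :
          Coop.of k (of v t (.K i)) * Coop.of k (of v t (.Kinv i)) = 1 := h.K_Kinv i
      have h2 (i : Fin (n - 1)) :
          Coop.of k (of v t (.Kinv i)) * Coop.of k (of v t (.K i)) = 1 := h.Kinv_K i
      cases x <;> simp [comulGen, counitGen, antipodeInv_of, antipodeInvGen, h1, h2])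

end hopf

end Bor

end TwoParam

/-! ### The convolution algebra of functionals on a bialgebra -/

namespace TwoParam

open Coalgebra WithConv

section dual

variable {k H : Type*} [Field k] [Ring H] [Bialgebra k H]

lemma conv_mul_apply_groupLike (f g : WithConv (H →ₗ[k] k)) {x : H}
    (hx : comul (R := k) x = x ⊗ₜ x) : (f * g) x = f x * g x := by
  rw [LinearMap.convMul_apply, hx]
  rfl

/-- With the group-like case above, this evaluates convolution products on generators, which is all
that `eq_zero_of_skew` asks for. -/
lemma conv_mul_apply_skew (f g : WithConv (H →ₗ[k] k)) {x y : H}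
    (hx : comul (R := k) x = x ⊗ₜ 1 + y ⊗ₜ x) : (f * g) x = f x * g 1 + f y * g x := by
  rw [LinearMap.convMul_apply, hx]
  simp

lemma conv_mul_apply_one (f g : WithConv (H →ₗ[k] k)) : (f * g) 1 = f 1 * g 1 :=
  conv_mul_apply_groupLike f g Bialgebra.comul_one

variable (k H) in
/-- Evaluation at `1`, an algebra homomorphism on the dual of a bialgebra. -/
def dualEvalOne : WithConv (H →ₗ[k] k) →ₐ[k] k :=
  AlgHom.ofLinearMap (LinearMap.applyₗ (1 : H) ∘ₗ (WithConv.linearEquiv k (H →ₗ[k] k)).toLinearMap)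
    (by simp)
    (fun f g => conv_mul_apply_one f g)

variable (k H) in
/-- The transpose `f ↦ (x ⊗ y ↦ f (x y))` of the multiplication. -/
def dualComul : WithConv (H →ₗ[k] k) →ₐ[k] WithConv (H ⊗[k] H →ₗ[k] k) :=
  AlgHom.ofLinearMap ((WithConv.linearEquiv k _).symm.toLinearMap ∘ₗ
      LinearMap.lcomp k k (LinearMap.mul' k H) ∘ₗ (WithConv.linearEquiv k _).toLinearMap)
    (by
      ext x y
      simp [mul_comm])
    (fun f g => by
      ext x y
      simp only [LinearMap.comp_apply, LinearEquiv.coe_coe, linearEquiv_apply,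
        symm_linearEquiv_apply, TensorProduct.AlgebraTensorModule.curry_apply,
        TensorProduct.curry_apply, LinearMap.coe_restrictScalars, LinearMap.lcomp_apply',
        LinearMap.mul'_apply, LinearMap.convMul_apply, Bialgebra.comul_mul,
        TensorProduct.comul_tmul]
      generalize comul (R := k) x = u
      generalize comul (R := k) y = w
      induction u with
      | zero => simp
      | add x y hx hy => simp only [map_add, add_mul, TensorProduct.add_tmul, hx, hy]
      | tmul a b =>
        induction w with
        | zero => simp
        | add x y hx hy => simp only [map_add, mul_add, TensorProduct.tmul_add, hx, hy]
        | tmul c d => simp)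

variable (k H) in
/-- The map `f ⊗ g ↦ (x ⊗ y ↦ f x * g y)`. -/
def dualTensor : WithConv (H →ₗ[k] k) ⊗[k] WithConv (H →ₗ[k] k) →ₐ[k]
    WithConv (H ⊗[k] H →ₗ[k] k) :=
  Algebra.TensorProduct.algHomOfLinearMapTensorProduct
    (TensorProduct.lift (LinearMap.mk₂ k
      (fun f g => toConv (LinearMap.mul' k k ∘ₗ TensorProduct.map f.ofConv g.ofConv))
      (fun f f' g => by ext; simp [add_mul]) (fun c f g => by ext; simp [mul_assoc])
      (fun f g g' => by ext; simp [mul_add]) (fun c f g => by ext; simp [mul_left_comm])))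
    (fun f f' g g' => by
      ext x y
      simp only [TensorProduct.lift.tmul, LinearMap.mk₂_apply,
        TensorProduct.AlgebraTensorModule.curry_apply,
        TensorProduct.curry_apply, LinearMap.coe_restrictScalars, LinearMap.comp_apply,
        LinearMap.mul'_apply, LinearMap.convMul_apply, TensorProduct.map_tmul,
        TensorProduct.comul_tmul]
      generalize comul (R := k) x = u
      generalize comul (R := k) y = w
      induction u with
      | zero => simp
      | add x y hx hy => simp only [map_add, add_mul, TensorProduct.add_tmul, hx, hy]
      | tmul a b =>
        induction w with
        | zero => simp
        | add x y hx hy => simp only [map_add, mul_add, TensorProduct.tmul_add, hx, hy]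
        | tmul c d => simp; ring)
    (by
      ext x y
      simp [mul_comm])

lemma dualTensor_srr (v s : k) (a b : WithConv (H →ₗ[k] k) ⊗[k] WithConv (H →ₗ[k] k)) :
    srr v s (dualTensor k H a) (dualTensor k H b) = dualTensor k H (srr v s a b) := by
  simp only [srr, pow_two, map_add, map_sub, map_smul, map_mul]

/-- A skew derivation which vanishes at `1` and on generators is zero. -/
lemma eq_zero_of_skew {s a b : WithConv (H →ₗ[k] k)} {S : Set H} (hS : Algebra.adjoin k S = ⊤)
    (h : dualComul k H s = dualTensor k H (s ⊗ₜ a + b ⊗ₜ s)) (h1 : s 1 = 0)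
    (h0 : ∀ x ∈ S, s x = 0) : s = 0 := by
  ext x
  have hx : x ∈ Algebra.adjoin k S := hS ▸ Algebra.mem_top
  -- Evaluated at x ⊗ y, the hypothesis is a twisted Leibniz rule, so s vanishes on products of
  -- elements on which it vanishes.
  have hm (x y : H) : s (x * y) = s x * a y + b x * s y := by
    have := congrArg (fun f : WithConv (H ⊗[k] H →ₗ[k] k) => f (x ⊗ₜ y)) h
    rwa [map_add] at this
  change s x = 0
  induction hx using Algebra.adjoin_induction with
  | mem x hx => exact h0 x hx
  | algebraMap r => rw [Algebra.algebraMap_eq_smul_one, map_smul, h1, smul_zero]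
  | add x y _ _ hx hy => rw [map_add, hx, hy, add_zero]
  | mul x y _ _ hx hy => rw [hm, hx, hy, zero_mul, mul_zero, add_zero]

end dual

/-! ### The functionals dual to the Borel generators, and the pairing they define -/

namespace Bor

variable {k : Type*} [Field k] {n : ℕ} (v t : kˣ)

/-- A character of the torus, extended by zero on the `E_i`, on generators. -/
def chrGen (c : Fin (n - 1) → kˣ) : BorGen n → k
  | .E _ => 0
  | .K i => c i
  | .Kinv i => ((c i)⁻¹ : kˣ)

/-- Once the E's are sent to zero only the torus relations survive, so the values on the K's are
arbitrary units. -/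
lemma sat_chr (c : Fin (n - 1) → kˣ) : Sat v t (chrGen c) where
  comm x y hx hy := mul_comm _ _
  K_Kinv i := by simp [chrGen]
  Kinv_K i := by simp [chrGen]
  KE i j := by simp [chrGen]
  E_E i j h := by simp [chrGen]
  serre₁ i j h := by simp [chrGen, srr]
  serre₂ i j h := by simp [chrGen, srr]

/-- A character of the torus, extended by zero on the `E_i`. -/
def chr (c : Fin (n - 1) → kˣ) : Bor v t n →ₐ[k] k := lift _ (sat_chr v t c)

/-- A character of the Borel algebra as an element of its dual. -/
def dualChr (c : Fin (n - 1) → kˣ) : WithConv (Bor v t n →ₗ[k] k) :=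
  toConv (chr v t c).toLinearMap

lemma dualChr_of (c : Fin (n - 1) → kˣ) (x : BorGen n) :
    dualChr v t c (of v t x) = chrGen c x := lift_of _ _ x

lemma dualChr_one (c : Fin (n - 1) → kˣ) : dualChr v t c 1 = 1 := map_one (chr v t c)

lemma dualComul_dualChr (c : Fin (n - 1) → kˣ) : dualComul k _ (dualChr v t c) =
    dualTensor k _ (dualChr v t c ⊗ₜ dualChr v t c) := by
  ext x y
  exact map_mul (chr v t c) x y

lemma dualChr_mul (c d : Fin (n - 1) → kˣ) :
    dualChr v t c * dualChr v t d = dualChr v t (c * d) := by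
  -- The target k is commutative, so characters are closed under convolution and can be compared on
  -- generators.
  have h : toConv (chr v t c) * toConv (chr v t d) = toConv (chr v t (c * d)) := by
    apply WithConv.ofConv_injective
    apply hom_ext
    intro x
    change (toConv (chr v t c) * toConv (chr v t d)) (of v t x) = chr v t (c * d) (of v t x)
    rw [AlgHom.convMul_apply, comul_of]
    cases x <;> simp [comulGen, chr, chrGen, mul_comm]
  exact congrArg (fun f => toConv (AlgHom.toLinearMap (ofConv f))) h

lemma dualChr_one_eq : dualChr v t (1 : Fin (n - 1) → kˣ) = 1 := by
  have h : chr v t (1 : Fin (n - 1) → kˣ) = Bialgebra.counitAlgHom k (Bor v t n) := by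
    apply hom_ext
    intro x
    change _ = counit (R := k) (of v t x)
    rw [counit_of]
    cases x <;> simp [chr, chrGen, counitGen]
  rw [dualChr, h]
  rfl

/-- The scalar by which `K_i` commutes past `E_j`. -/
def wt (j i : Fin (n - 1)) : kˣ := v ^ dot j i * t ^ (Om j i - Om i j)

/-- The triangular representation on generators, whose upper right corner is the skew derivation
dual to `E_i`. -/
def triGen (a : k) (i : Fin (n - 1)) : BorGen n → Matrix (Fin 2) (Fin 2) k
  | .E j => !![0, if i = j then a else 0; 0, 0]
  | .K j => !![(wt v t j i : k), 0; 0, 1]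
  | .Kinv j => !![((wt v t j i)⁻¹ : kˣ), 0; 0, 1]

lemma upper_mul_upper (x y : k) : !![0, x; 0, 0] * !![0, y; 0, 0] = 0 := by
  ext a b
  fin_cases a <;> fin_cases b <;> simp

/-- Products of two strictly upper triangular matrices vanish, so the Serre and commutation
relations are automatic. The only condition is the one between K_j and E_i, and it dictates that the
diagonal entries of K_j have ratio `wt v t j i`. -/
lemma sat_tri (a : k) (i : Fin (n - 1)) : Sat v t (triGen v t a i) where
  comm x y hx hy := by
    cases x <;> cases y <;> first | exact hx.elim | exact hy.elim | simp [triGen, mul_comm]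
  K_Kinv j := by simp [triGen, Matrix.one_fin_two]
  Kinv_K j := by simp [triGen, Matrix.one_fin_two]
  KE j l := by
    simp only [triGen, wt]
    split_ifs with h
    · subst h; simp
    · simp
  E_E j l h := by
    simp only [triGen, upper_mul_upper]
  serre₁ j l h := by
    simp [triGen, srr, pow_two, upper_mul_upper, -Matrix.cons_mul]
  serre₂ j l h := by
    simp [triGen, srr, pow_two, upper_mul_upper, -Matrix.cons_mul]

/-- The triangular representation whose upper right corner is the skew derivation dual to `E_i`. -/
def tri (a : k) (i : Fin (n - 1)) : Bor v t n →ₐ[k] Matrix (Fin 2) (Fin 2) k :=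
  lift _ (sat_tri v t a i)

lemma tri_one_zero (a : k) (i : Fin (n - 1)) (x : Bor v t n) : tri v t a i x 1 0 = 0 := by
  induction mem_adjoin_of x using Algebra.adjoin_induction with
  | mem x hx => obtain ⟨x, rfl⟩ := hx; cases x <;> simp [tri, triGen]
  | algebraMap r => simp [Matrix.algebraMap_eq_diagonal]
  | add x y _ _ hx hy => simp [hx, hy]
  | mul x y _ _ hx hy => simp [Matrix.mul_apply, hx, hy]

/-- The representation is upper triangular, so its diagonal entries are algebra maps, here the
character K_j ↦ `wt v t j i` and, in the other corner, the counit. -/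
lemma tri_zero_zero (a : k) (i : Fin (n - 1)) (x : Bor v t n) :
    tri v t a i x 0 0 = chr v t (fun j => wt v t j i) x := by
  induction mem_adjoin_of x using Algebra.adjoin_induction with
  | mem x hx => obtain ⟨x, rfl⟩ := hx; cases x <;> simp [tri, triGen, chr, chrGen]
  | algebraMap r => simp [Matrix.algebraMap_eq_diagonal]
  | add x y _ _ hx hy => simp [hx, hy]
  | mul x y _ _ hx hy => simp [Matrix.mul_apply, hx, hy, tri_one_zero]

lemma tri_one_one (a : k) (i : Fin (n - 1)) (x : Bor v t n) :
    tri v t a i x 1 1 = counit (R := k) x := by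
  induction mem_adjoin_of x using Algebra.adjoin_induction with
  | mem x hx =>
    obtain ⟨x, rfl⟩ := hx
    rw [counit_of]
    cases x <;> simp [tri, triGen, counitGen]
  | algebraMap r => simp [Matrix.algebraMap_eq_diagonal]
  | add x y _ _ hx hy => simp [hx, hy]
  | mul x y _ _ hx hy => simp [Matrix.mul_apply, hx, hy, tri_one_zero]

/-- The skew derivation dual to `E_i`, as an element of the dual. -/
def dualDer (a : k) (i : Fin (n - 1)) : WithConv (Bor v t n →ₗ[k] k) :=
  toConv (Matrix.entryLinearMap k k 0 1 ∘ₗ (tri v t a i).toLinearMap)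

lemma dualDer_apply (a : k) (i : Fin (n - 1)) (x : Bor v t n) :
    dualDer v t a i x = tri v t a i x 0 1 := rfl

lemma dualDer_of (a : k) (i : Fin (n - 1)) (x : BorGen n) :
    dualDer v t a i (of v t x) = triGen v t a i x 0 1 := by
  rw [dualDer_apply, tri, lift_of]

lemma dualDer_one (a : k) (i : Fin (n - 1)) : dualDer v t a i 1 = 0 := by
  rw [dualDer_apply, map_one]
  rfl

/-- Reading the upper right entry of a product of triangular matrices gives D(xy) = D(x) ε(y) + χ(x)
D(y). This is the shape E ⊗ 1 + K ⊗ E of the coproduct of E, since ε is the unit of the convolution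
algebra. -/
lemma dualComul_dualDer (a : k) (i : Fin (n - 1)) : dualComul k _ (dualDer v t a i) =
    dualTensor k _ (dualDer v t a i ⊗ₜ 1 + dualChr v t (fun j => wt v t j i) ⊗ₜ dualDer v t a i) := by
  ext x y
  rw [map_add]
  change tri v t a i (x * y) 0 1 = tri v t a i x 0 1 * counit (R := k) y +
    chr v t (fun j => wt v t j i) x * tri v t a i y 0 1
  rw [map_mul, Matrix.mul_apply, Fin.sum_univ_two, tri_zero_zero, tri_one_one]
  ring

/-- The elements of the dual of the Borel algebra which pair with it as the generators of the
opposite Borel algebra. -/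
def dualGen (a : k) : BorGen n → WithConv (Bor v t n →ₗ[k] k)
  | .E i => dualDer v t a i
  | .K i => dualChr v t (fun j => wt v t j i)
  | .Kinv i => dualChr v t (fun j => wt v t j i)⁻¹

/-- The transpose of multiplication acts on the dual generators exactly as the comultiplication acts
on Borel generators; hence the relator formulas `skew_comulGen`, `comm_comulGen` and `srr_comulGen`
apply to them. -/
lemma dualComul_dualGen (a : k) (x : BorGen n) : dualComul k _ (dualGen v t a x) =
    dualTensor k _ (comulGen (dualGen v t a) x) := by
  cases x with
  | E i => exact dualComul_dualDer v t a i
  | K i => exact dualComul_dualChr v t _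
  | Kinv i => exact dualComul_dualChr v t _

lemma dualGen_one (a : k) (x : BorGen n) : dualGen v t a x 1 = counitGen k x := by
  cases x with
  | E i => exact dualDer_one v t a i
  | K i => exact dualChr_one v t _
  | Kinv i => exact dualChr_one v t _

variable {v t} in
lemma conv_mul_apply_torus (f g : WithConv (Bor v t n →ₗ[k] k)) {x : BorGen n} (hx : x.IsTorus) :
    (f * g) (of v t x) = f (of v t x) * g (of v t x) :=
  conv_mul_apply_groupLike f g (by rw [comul_of, comulGen_torus _ hx])

variable {v t} in
lemma conv_mul_apply_E (f g : WithConv (Bor v t n →ₗ[k] k)) (i : Fin (n - 1)) :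
    (f * g) (of v t (.E i)) =
      f (of v t (.E i)) * g 1 + f (of v t (.K i)) * g (of v t (.E i)) :=
  conv_mul_apply_skew f g (comul_of v t _)

lemma dualGen_comm (a : k) (x y : BorGen n) (hx : x.IsTorus) (hy : y.IsTorus) :
    dualGen v t a x * dualGen v t a y = dualGen v t a y * dualGen v t a x := by
  cases x <;> cases y <;> first | exact hx.elim | exact hy.elim |
    simp only [dualGen, dualChr_mul, mul_comm]

/-- The relator is a skew derivation by `skew_comulGen`, so it is enough to evaluate it on
generators; the only nontrivial value is the one at E_j. -/
lemma dualGen_KE (a : k) (i j : Fin (n - 1)) : dualGen v t a (.K i) * dualGen v t a (.E j) =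
    ((v ^ dot i j * t⁻¹ ^ (Om i j - Om j i) : kˣ) : k) •
      (dualGen v t a (.E j) * dualGen v t a (.K i)) := by
  -- The scalar that appears in the dual is the weight of E_j under K_j in Bor(v, t) with the
  -- indices swapped between the K's: χ_i(K_j) = `wt v t j i`. Since the exponent of t is
  -- antisymmetric in i and j, this is the Borel scalar with t⁻¹ in place of t.
  have hc : v ^ dot i j * t⁻¹ ^ (Om i j - Om j i) = wt v t j i := by
    rw [wt, dot, dot, add_comm, inv_zpow', neg_sub]
  rw [hc, ← sub_eq_zero]
  refine eq_zero_of_skew (a := dualGen v t a (.K i))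
    (b := dualGen v t a (.K i) * dualGen v t a (.K j)) adjoin_of ?_ ?_ ?_
  · rw [map_sub, map_smul, map_mul, map_mul, dualComul_dualGen, dualComul_dualGen, ← map_mul,
      ← map_mul, ← map_smul, ← map_sub]
    exact congrArg _ (skew_comulGen _ (dualGen_comm v t a (.K i) (.K j) trivial trivial))
  · simp [-LinearMap.convMul_apply, conv_mul_apply_one, dualGen_one, counitGen]
  · rintro _ ⟨x, rfl⟩
    cases x with
    | E l =>
      -- For j = l both sides equal `wt v t j i` times a; for j ≠ l each product is zero.
      by_cases h : j = l
      · subst h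
        simp [-LinearMap.convMul_apply, conv_mul_apply_E, dualGen, dualChr_of, dualDer_of,
          dualDer_one, dualChr_one, chrGen, triGen, mul_comm]
      · simp [-LinearMap.convMul_apply, conv_mul_apply_E, dualGen, dualDer_of, dualDer_one, triGen,
          h]
    | K l =>
      simp [-LinearMap.convMul_apply, conv_mul_apply_torus (x := .K l) _ _ trivial, dualGen,
        dualDer_of, triGen]
    | Kinv l =>
      simp [-LinearMap.convMul_apply, conv_mul_apply_torus (x := .Kinv l) _ _ trivial, dualGen,
        dualDer_of, triGen]

/-- Each term of Δ(E_l) contains E_l in only one tensor factor, so a product of two functionals D_i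
kills every generator. Skew-primitivity of the commutator then finishes. -/
lemma dualGen_E_E (a : k) {i j : Fin (n - 1)} (h : 1 < |(i : ℤ) - (j : ℤ)|) :
    dualGen v t a (.E i) * dualGen v t a (.E j) = dualGen v t a (.E j) * dualGen v t a (.E i) := by
  have far {i j : Fin (n - 1)} (h : 1 < |(i : ℤ) - (j : ℤ)|) :
      dualGen v t a (.K i) * dualGen v t a (.E j) =
        dualGen v t a (.E j) * dualGen v t a (.K i) := by
    simpa [dot, (Om_far h).1, (Om_far h).2] using dualGen_KE v t a i j
  have h' : 1 < |(j : ℤ) - (i : ℤ)| := by rwa [abs_sub_comm]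
  rw [← sub_eq_zero]
  refine eq_zero_of_skew (a := 1)
    (b := dualGen v t a (.K i) * dualGen v t a (.K j)) adjoin_of ?_ ?_ ?_
  · rw [map_sub, map_mul, map_mul, dualComul_dualGen, dualComul_dualGen, ← map_mul,
      ← map_mul, ← map_sub]
    exact congrArg _ (comm_comulGen (dualGen_comm v t a (.K i) (.K j) trivial trivial) (far h)
      (far h'))
  · simp [-LinearMap.convMul_apply, conv_mul_apply_one, dualGen_one, counitGen]
  · rintro _ ⟨x, rfl⟩
    cases x with
    | E l =>
      simp [-LinearMap.convMul_apply, conv_mul_apply_E, dualGen, dualDer_of, dualDer_one, triGen]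
    | K l =>
      simp [-LinearMap.convMul_apply, conv_mul_apply_torus (x := .K l) _ _ trivial, dualGen,
        dualDer_of, triGen]
    | Kinv l =>
      simp [-LinearMap.convMul_apply, conv_mul_apply_torus (x := .Kinv l) _ _ trivial, dualGen,
        dualDer_of, triGen]

/-- The Serre element is a skew derivation by `srr_comulGen`, and every cubic product of the D's is
zero on generators for the same reason as in the quadratic case. The scalar s covers both Serre
relations, s = t⁻¹ and s = t. -/
lemma srr_dualGen (a : k) {i j : Fin (n - 1)} {s : k} (hs : s ≠ 0)
    (h₁₂ : dualGen v t a (.K i) * dualGen v t a (.E j) =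
      ((v : k)⁻¹ * s) • (dualGen v t a (.E j) * dualGen v t a (.K i)))
    (h₂₁ : dualGen v t a (.K j) * dualGen v t a (.E i) =
      ((v : k)⁻¹ * s⁻¹) • (dualGen v t a (.E i) * dualGen v t a (.K j))) :
    srr (v : k) s (dualGen v t a (.E i)) (dualGen v t a (.E j)) = 0 := by
  have h₁₁ : dualGen v t a (.K i) * dualGen v t a (.E i) =
      (v : k) ^ 2 • (dualGen v t a (.E i) * dualGen v t a (.K i)) := by
    simpa [dot, Om_self, zpow_two, pow_two] using dualGen_KE v t a i i
  refine eq_zero_of_skew (a := 1)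
    (b := dualGen v t a (.K i) * dualGen v t a (.K i) * dualGen v t a (.K j)) adjoin_of ?_ ?_ ?_
  · rw [map_srr, dualComul_dualGen, dualComul_dualGen, dualTensor_srr]
    exact congrArg _ (srr_comulGen hs
      (dualGen_comm v t a (.K i) (.K j) trivial trivial) h₁₁ h₁₂ h₂₁)
  · simp [-LinearMap.convMul_apply, srr, pow_two, conv_mul_apply_one, dualGen_one, counitGen]
  · rintro _ ⟨x, rfl⟩
    cases x with
    | E l =>
      simp [-LinearMap.convMul_apply, srr, pow_two, conv_mul_apply_E, conv_mul_apply_one,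
        conv_mul_apply_torus (x := .K l) _ _ trivial, dualGen, dualDer_of, dualDer_one, triGen]
    | K l =>
      simp [-LinearMap.convMul_apply, srr, pow_two,
        conv_mul_apply_torus (x := .K l) _ _ trivial, dualGen, dualDer_of, triGen]
    | Kinv l =>
      simp [-LinearMap.convMul_apply, srr, pow_two,
        conv_mul_apply_torus (x := .Kinv l) _ _ trivial, dualGen, dualDer_of, triGen]

lemma sat_dualGen (a : k) : Sat v t⁻¹ (dualGen v t a (n := n)) where
  comm := dualGen_comm v t a
  K_Kinv i := by simp only [dualGen, dualChr_mul, mul_inv_cancel, dualChr_one_eq]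
  Kinv_K i := by simp only [dualGen, dualChr_mul, inv_mul_cancel, dualChr_one_eq]
  KE := dualGen_KE v t a
  E_E _ _ h := dualGen_E_E v t a h
  serre₁ i j h := srr_dualGen v t a t⁻¹.ne_zero
    (by simpa [dot, (Om_succ h).1, (Om_succ h).2] using dualGen_KE v t a i j)
    (by simpa [dot, (Om_succ h).1, (Om_succ h).2] using dualGen_KE v t a j i)
  serre₂ i j h := srr_dualGen v t a (inv_ne_zero t⁻¹.ne_zero)
    (by simpa [dot, (Om_succ h).1, (Om_succ h).2] using dualGen_KE v t a j i)
    (by simpa [dot, (Om_succ h).1, (Om_succ h).2] using dualGen_KE v t a i j)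

/-- The algebra homomorphism to the dual which defines the pairing of two Borel algebras. -/
def toDual (a : k) : Bor v t⁻¹ n →ₐ[k] WithConv (Bor v t n →ₗ[k] k) :=
  lift _ (sat_dualGen v t a)

lemma toDual_of (a : k) (x : BorGen n) : toDual v t a (of v t⁻¹ x) = dualGen v t a x :=
  lift_of _ _ x

lemma toDual_apply_one (a : k) (x : Bor v t⁻¹ n) : toDual v t a x 1 = counit (R := k) x := by
  have h : (dualEvalOne k _).comp (toDual v t a) = Bialgebra.counitAlgHom k (Bor v t⁻¹ n) := by
    apply hom_ext
    intro x
    change toDual v t a (of v t⁻¹ x) 1 = counit (R := k) (of v t⁻¹ x)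
    rw [toDual_of, counit_of, dualGen_one]
  exact congrArg (fun f => f x) h

/-- Both sides are algebra maps in x, so agreement on generators suffices. Evaluated on a pure
tensor, this is the axiom (f, xy) = (Δ(f), x ⊗ y) of a Hopf pairing; the other multiplicativity
axiom is the definition of convolution. -/
lemma dualComul_toDual (a : k) (x : Bor v t⁻¹ n) : dualComul k _ (toDual v t a x) =
    dualTensor k _ (TensorProduct.map (toDual v t a).toLinearMap (toDual v t a).toLinearMap
      (comul x)) := by
  have h : (dualComul k (Bor v t n)).comp (toDual v t a) = (dualTensor k (Bor v t n)).comp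
      ((Algebra.TensorProduct.map (toDual v t a (n := n)) (toDual v t a (n := n))).comp
        (Bialgebra.comulAlgHom k (Bor v t⁻¹ n))) := by
    apply hom_ext
    intro x
    simp only [AlgHom.comp_apply, Bialgebra.comulAlgHom_apply, comul_of, toDual_of,
      dualComul_dualGen]
    congr 1
    cases x <;> simp [comulGen, toDual_of]
  exact congrArg (fun f => f x) h

/-- The Hopf pairing of two Borel algebras with `(E_i, E_j) = a δ_{ij}`. -/
def pairing (a : k) : HopfPairing k (Bor v t⁻¹ n) (Bor v t n) where
  form := (WithConv.linearEquiv k _).toLinearMap ∘ₗ (toDual v t a).toLinearMap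
  one_left h := by
    change toDual v t a 1 h = _
    rw [map_one]
    rfl
  one_right := toDual_apply_one v t a
  mul_right f x y := by
    have h := congrArg (fun f : WithConv (Bor v t n ⊗[k] Bor v t n →ₗ[k] k) => f (x ⊗ₜ y))
      (dualComul_toDual v t a f)
    refine h.trans ?_
    generalize comul (R := k) f = u
    induction u with
    | zero => simp
    | add x y hx hy => simp only [map_add, ofConv_add, LinearMap.add_apply, hx, hy]
    | tmul x y => rfl
  mul_left f g x := by
    change toDual v t a (f * g) x = _
    rw [map_mul]
    rfl

lemma pairing_of (a : k) (x : BorGen n) (y : Bor v t n) :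
    (pairing v t a).form (of v t⁻¹ x) y = dualGen v t a x y := by
  rw [← toDual_of]
  rfl

end Bor

end TwoParam

/-! ### The map from the quantum algebra to a double of Borel type -/

namespace TwoParam

open Coalgebra

namespace DrinfeldDouble

section general

variable {k H L : Type*} [CommRing k] [Ring H] [HopfAlgebra k H] [Ring L] [HopfAlgebra k L]
variable (p : HopfPairing k (Coop L) H)

/-- The embedding of `H` into the double, as an algebra homomorphism. -/
def inHAlg : H →ₐ[k] DrinfeldDouble p :=
  AlgHom.ofLinearMap (inH p) inH_one fun a b => (tmH_mul a b).symm

/-- The embedding of `L` into the double, as an algebra homomorphism. -/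
def inLAlg : L →ₐ[k] DrinfeldDouble p :=
  AlgHom.ofLinearMap (inL p) inL_one fun f g => (tmL_mul f g).symm

/-- The map `f ⊗ a ↦ a f` from `L ⊗ H` to the double. -/
def ofLH : L ⊗[k] H →ₗ[k] DrinfeldDouble p := (TensorProduct.comm k L H).toLinearMap

lemma ofLH_tmul (f : L) (a : H) : ofLH p (f ⊗ₜ a) = inHAlg p a * inLAlg p f := tm_eq a f

variable {p}

/-- The cross relations of the double, without antipode. -/
lemma inL_mul_inH {f : L} {a : H} {w : L ⊗[k] H}
    (h : convR (Dbl.pair p.onL) (f ⊗ₜ[k] a) = convL (Dbl.pair p.onL) w) :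
    inLAlg p f * inHAlg p a = ofLH p w := by
  -- The exchange map is convolution with (S(-), -) applied to convolution with the pairing on the
  -- other side. The first is a left inverse of `convL` of the pairing, so applying it to the
  -- hypothesis removes the antipode.
  have h1 : Dbl.ex p.onL (f ⊗ₜ[k] a) = w := by
    rw [Dbl.ex, LinearMap.comp_apply, h]
    exact LinearMap.congr_fun (Dbl.LSL p.isSkew) w
  refine (tm_mul_tm (p := p) 1 a f 1).trans ((Dbl.bim_one_one _).trans ?_)
  rw [Dbl.exch, LinearMap.comp_apply, h1]
  rfl

/-- For group-like f and a, both convolutions multiply f ⊗ a by the same scalar (f, a). -/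
lemma inL_mul_inH_groupLike {f : L} {a : H} (hf : comul (R := k) f = f ⊗ₜ f)
    (ha : comul (R := k) a = a ⊗ₜ a) :
    inLAlg p f * inHAlg p a = inHAlg p a * inLAlg p f := by
  rw [← ofLH_tmul]
  apply inL_mul_inH
  simp [convR_apply, convL_apply, TensorProduct.comul_tmul, hf, ha, Dbl.pair]

lemma comul_inHAlg (a : H) : comul (R := k) (inHAlg p a) =
    TensorProduct.map (inHAlg p).toLinearMap (inHAlg p).toLinearMap (comul a) := by
  change comul (R := k) (a ⊗ₜ[k] (1 : L)) = _
  rw [TensorProduct.comul_tmul, Bialgebra.comul_one]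
  generalize comul (R := k) a = u
  induction u with
  | zero => simp only [map_zero, TensorProduct.zero_tmul]; rfl
  | add x y hx hy => simp only [map_add, TensorProduct.add_tmul, hx, hy]; rfl
  | tmul x y => rfl

lemma comul_inLAlg (f : L) : comul (R := k) (inLAlg p f) =
    TensorProduct.map (inLAlg p).toLinearMap (inLAlg p).toLinearMap (comul f) := by
  change comul (R := k) ((1 : H) ⊗ₜ[k] f) = _
  rw [TensorProduct.comul_tmul, Bialgebra.comul_one]
  generalize comul (R := k) f = u
  induction u with
  | zero => simp only [map_zero, TensorProduct.tmul_zero]; rfl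
  | add x y hx hy => simp only [map_add, TensorProduct.tmul_add, hx, hy]; rfl
  | tmul x y => rfl

lemma counit_inHAlg (a : H) : counit (R := k) (inHAlg p a) = counit (R := k) a := by
  refine (counit_tm (p := p) a 1).trans ?_
  rw [Bialgebra.counit_one, mul_one]

lemma counit_inLAlg (f : L) : counit (R := k) (inLAlg p f) = counit (R := k) f := by
  refine (counit_tm (p := p) 1 f).trans ?_
  rw [Bialgebra.counit_one, one_mul]

/-- The linear map id ⊗ ε on the underlying space is a retraction. This elementary fact is the
source of the injectivity of the presented Borel algebras in the quantum algebra. -/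
lemma inHAlg_injective : Function.Injective (inHAlg p) := by
  let g : DrinfeldDouble p →ₗ[k] H :=
    (TensorProduct.rid k H).toLinearMap ∘ₗ (counit (R := k) (A := L)).lTensor H
  have hg (a : H) : g (inHAlg p a) = a := by
    change TensorProduct.rid k H ((counit (R := k) (A := L)).lTensor H (a ⊗ₜ[k] (1 : L))) = a
    simp
  exact Function.LeftInverse.injective hg

lemma inLAlg_injective : Function.Injective (inLAlg p) := by
  let g : DrinfeldDouble p →ₗ[k] L :=
    (TensorProduct.lid k L).toLinearMap ∘ₗ (counit (R := k) (A := H)).rTensor L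
  have hg (f : L) : g (inLAlg p f) = f := by
    change TensorProduct.lid k L ((counit (R := k) (A := H)).rTensor L ((1 : H) ⊗ₜ[k] f)) = f
    simp
  exact Function.LeftInverse.injective hg

end general

variable {k H L : Type*} [Field k] [Ring H] [HopfAlgebra k H] [Ring L] [HopfAlgebra k L]

/-- Elements of `H` and `L` which behave like the generators of the two Borel algebras, and are
paired like them. -/
structure BorelGens (v t : kˣ) {n : ℕ} (p : HopfPairing k (Coop L) H) (x : BorGen n → H)
    (y : BorGen n → L) : Prop where
  satH : Bor.Sat v t x
  satL : Bor.Sat v t⁻¹ y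
  comulH (g : BorGen n) : comul (R := k) (x g) = Bor.comulGen x g
  comulL (g : BorGen n) : comul (R := k) (y g) = TensorProduct.comm k L L (Bor.comulGen y g)
  counitH (g : BorGen n) : counit (R := k) (x g) = Bor.counitGen k g
  counitL (g : BorGen n) : counit (R := k) (y g) = Bor.counitGen k g
  E_E (i j : Fin (n - 1)) : p.onL (y (.E i)) (x (.E j)) =
    if i = j then ((v : k)⁻¹ - (v : k))⁻¹ else 0
  K_K (i j : Fin (n - 1)) : p.onL (y (.K i)) (x (.K j)) = Bor.wt v t j i
  E_K (i j : Fin (n - 1)) : p.onL (y (.E i)) (x (.K j)) = 0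
  K_E (i j : Fin (n - 1)) : p.onL (y (.K i)) (x (.E j)) = 0

namespace BorelGens

variable {v t : kˣ} {n : ℕ} {p : HopfPairing k (Coop L) H} {x : BorGen n → H} {y : BorGen n → L}

lemma comulH_torus (h : BorelGens v t p x y) {g : BorGen n} (hg : g.IsTorus) :
    comul (R := k) (x g) = x g ⊗ₜ x g := by rw [h.comulH, Bor.comulGen_torus _ hg]

lemma comulL_torus (h : BorelGens v t p x y) {g : BorGen n} (hg : g.IsTorus) :
    comul (R := k) (y g) = y g ⊗ₜ y g := by
  rw [h.comulL, Bor.comulGen_torus _ hg, TensorProduct.comm_tmul]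

lemma cross_comm (h : BorelGens v t p x y) {g g' : BorGen n} (hg : g.IsTorus) (hg' : g'.IsTorus) :
    inLAlg p (y g) * inHAlg p (x g') = inHAlg p (x g') * inLAlg p (y g) :=
  inL_mul_inH_groupLike (h.comulL_torus hg) (h.comulH_torus hg')

/-- The term 1 ⊗ K_i comes from convolution on the right and K_j' ⊗ 1 from convolution on the left,
both with coefficient (F_j, E_i). -/
lemma cross_E_E (h : BorelGens v t p x y) (i j : Fin (n - 1)) :
    inHAlg p (x (.E i)) * inLAlg p (y (.E j)) - inLAlg p (y (.E j)) * inHAlg p (x (.E i)) =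
      if i = j then ((v : k) - (v : k)⁻¹)⁻¹ •
        (inHAlg p (x (.K i)) - inLAlg p (y (.K i))) else 0 := by
  -- With Δ(F) = 1 ⊗ F + F ⊗ K' and Δ(E) = E ⊗ 1 + K ⊗ E, right convolution sends F ⊗ E to F ⊗ E +
  -- (F, E) 1 ⊗ K, and left convolution sends it to F ⊗ E + (F, E) K' ⊗ 1, while fixing 1 ⊗ K and K'
  -- ⊗ 1. This determines the element on the right.
  have hw : inLAlg p (y (.E j)) * inHAlg p (x (.E i)) =
      ofLH p (y (.E j) ⊗ₜ x (.E i) + p.onL (y (.E j)) (x (.E i)) •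
        ((1 : L) ⊗ₜ x (.K i) - y (.K j) ⊗ₜ (1 : H))) := by
    apply inL_mul_inH
    simp [convR_apply, convL_apply, TensorProduct.comul_tmul, h.comulH, h.comulL, Bor.comulGen,
      TensorProduct.tmul_add, TensorProduct.add_tmul, Dbl.pair, p.isSkew.one_left,
      p.isSkew.one_right, h.counitH, h.counitL, Bor.counitGen, h.K_E, h.E_K,
      Algebra.TensorProduct.one_def, smul_sub]
    abel
  rw [hw, h.E_E]
  simp only [map_add, map_smul, map_sub, ofLH_tmul, map_one, one_mul, mul_one]
  by_cases hij : i = j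
  · subst hij
    -- The pairing is normalised by v⁻¹ - v and the relation by v - v⁻¹; the sign is absorbed by
    -- passing from FE - EF to EF - FE.
    rw [if_pos rfl, if_pos rfl, ← neg_sub (v : k), inv_neg, neg_smul]
    abel
  · rw [if_neg hij, if_neg (Ne.symm hij), zero_smul, add_zero, sub_self]

/-- Only the left convolution contributes a scalar, namely (K_i', K_j), through the K_j in the
coproduct of E_j; it moves to the other side as an inverse. -/
lemma cross_K_E (h : BorelGens v t p x y) (i j : Fin (n - 1)) :
    inLAlg p (y (.K i)) * inHAlg p (x (.E j)) =
      ((v ^ (-dot i j) * t ^ (Om i j - Om j i) : kˣ) : k) •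
        (inHAlg p (x (.E j)) * inLAlg p (y (.K i))) := by
  have hc : v ^ (-dot i j) * t ^ (Om i j - Om j i) = (Bor.wt v t j i)⁻¹ := by
    rw [Bor.wt, mul_inv, ← zpow_neg, ← zpow_neg, neg_sub, dot, dot, add_comm]
  rw [hc, ← ofLH_tmul, ← map_smul]
  apply inL_mul_inH
  simp [convR_apply, convL_apply, TensorProduct.comul_tmul, h.comulH, h.comulL, Bor.comulGen,
    TensorProduct.tmul_add, Dbl.pair, p.isSkew.one_right, h.counitL, Bor.counitGen, h.K_E, h.K_K, smul_smul]

/-- Here only the right convolution contributes, namely (K_j', K_i), through the K_j' in the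
coproduct of F_j. -/
lemma cross_E_K (h : BorelGens v t p x y) (i j : Fin (n - 1)) :
    inHAlg p (x (.K i)) * inLAlg p (y (.E j)) =
      ((v ^ (-dot i j) * t ^ (Om j i - Om i j) : kˣ) : k) •
        (inLAlg p (y (.E j)) * inHAlg p (x (.K i))) := by
  have hc : v ^ (-dot i j) * t ^ (Om j i - Om i j) = (Bor.wt v t i j)⁻¹ := by
    rw [Bor.wt, mul_inv, ← zpow_neg, ← zpow_neg, neg_sub]
  have hw : inLAlg p (y (.E j)) * inHAlg p (x (.K i)) =
      ofLH p ((Bor.wt v t i j : k) • (y (.E j) ⊗ₜ x (.K i))) := by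
    apply inL_mul_inH
    simp [convR_apply, convL_apply, TensorProduct.comul_tmul, h.comulH, h.comulL, Bor.comulGen,
      TensorProduct.add_tmul, Dbl.pair, p.isSkew.one_left, h.counitH, Bor.counitGen, h.E_K, h.K_K]
  rw [hc, hw, map_smul, ofLH_tmul, smul_smul, Units.inv_mul, one_smul]

variable (p x y) in
/-- The images of the generators of the two-parameter quantum algebra in the double. -/
def toDouble : Gen n → DrinfeldDouble p
  | .E i => inHAlg p (x (.E i))
  | .F i => inLAlg p (y (.E i))
  | .K i => inHAlg p (x (.K i))
  | .Kinv i => inHAlg p (x (.Kinv i))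
  | .K' i => inLAlg p (y (.K i))
  | .Kinv' i => inLAlg p (y (.Kinv i))

variable (p x y) in
lemma toDouble_torus (g : Gen n) (hg : g.IsTorus) :
    (∃ a : BorGen n, a.IsTorus ∧ toDouble p x y g = inHAlg p (x a)) ∨
      ∃ a : BorGen n, a.IsTorus ∧ toDouble p x y g = inLAlg p (y a) := by
  cases g with
  | E i => exact hg.elim
  | F i => exact hg.elim
  | K i => exact .inl ⟨.K i, trivial, rfl⟩
  | Kinv i => exact .inl ⟨.Kinv i, trivial, rfl⟩
  | K' i => exact .inr ⟨.K i, trivial, rfl⟩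
  | Kinv' i => exact .inr ⟨.Kinv i, trivial, rfl⟩

lemma toDouble_comm (h : BorelGens v t p x y) (g g' : Gen n) (hg : g.IsTorus) (hg' : g'.IsTorus) :
    toDouble p x y g * toDouble p x y g' = toDouble p x y g' * toDouble p x y g := by
  obtain ⟨a, ha, e⟩ | ⟨a, ha, e⟩ := toDouble_torus p x y g hg <;>
    obtain ⟨b, hb, e'⟩ | ⟨b, hb, e'⟩ := toDouble_torus p x y g' hg' <;> rw [e, e']
  · exact (h.satH.map (inHAlg p)).comm a b ha hb
  · exact (h.cross_comm hb ha).symm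
  · exact h.cross_comm ha hb
  · exact (h.satL.map (inLAlg p)).comm a b ha hb

/-- Relations inside one Borel half hold because both halves embed as algebras; the mixed ones are
the cross relations. The F's satisfy Borel relations with t⁻¹, so the powers of t have to be
rewritten for them. -/
lemma sat (h : BorelGens v t p x y) : QAlg.Sat v t (toDouble p x y) := by
  have hH := h.satH.map (inHAlg p)
  have hL := h.satL.map (inLAlg p)
  exact
  { comm := h.toDouble_comm
    K_Kinv := hH.K_Kinv
    Kinv_K := hH.Kinv_K
    K'_Kinv' := hL.K_Kinv
    Kinv'_K' := hL.Kinv_K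
    K_E := fun i j => by
      have := hH.KE i j
      simp only [toDouble] at this ⊢
      rw [this, smul_mul_assoc, mul_assoc, hH.K_Kinv, mul_one]
    K'_E := fun i j => by
      simp only [toDouble]
      rw [h.cross_K_E, smul_mul_assoc, mul_assoc, hL.K_Kinv, mul_one]
    K_F := fun i j => by
      simp only [toDouble]
      rw [h.cross_E_K, smul_mul_assoc, mul_assoc, hH.K_Kinv, mul_one]
    K'_F := fun i j => by
      have := hL.KE i j
      simp only [toDouble] at this ⊢
      rw [this, smul_mul_assoc, mul_assoc, hL.K_Kinv, mul_one, inv_zpow', neg_sub]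
    E_F := h.cross_E_E
    E_E := fun i j hij => sub_eq_zero.2 (hH.E_E i j hij)
    F_F := fun i j hij => sub_eq_zero.2 (hL.E_E i j hij)
    serre_E₁ := hH.serre₁
    serre_E₂ := fun i j hij => by
      rw [srr_flip t.ne_zero]
      exact (congrArg _ (hH.serre₂ i j hij)).trans (smul_zero _)
    serre_F₁ := fun i j hij => by
      simpa only [srr, toDouble, Units.val_inv_eq_inv_val] using hL.serre₁ i j hij
    serre_F₂ := fun i j hij => by
      rw [srr_flip (inv_ne_zero t.ne_zero)]
      have := hL.serre₂ i j hij
      rw [Units.val_inv_eq_inv_val] at this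
      exact (congrArg _ this).trans (smul_zero _) }

/-- The homomorphism of bialgebras from the two-parameter quantum algebra to the double. -/
def hom (h : BorelGens v t p x y) : QAlg v t n →ₐc[k] DrinfeldDouble p :=
  BialgHom.ofAlgHom (QAlg.lift _ h.sat)
    (by
      apply QAlg.hom_ext
      intro g
      change counit (R := k) (QAlg.lift _ h.sat (QAlg.of v t g)) =
        counit (R := k) (QAlg.of v t g)
      rw [QAlg.lift_of, QAlg.counit_of]
      cases g <;>
        simp [toDouble, counit_inHAlg, counit_inLAlg, h.counitH, h.counitL, Bor.counitGen,
          QAlg.counitGen])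
    (by
      apply QAlg.hom_ext
      intro g
      change Algebra.TensorProduct.map _ _ (comul (R := k) (QAlg.of v t g)) =
        comul (R := k) (QAlg.lift _ h.sat (QAlg.of v t g))
      rw [QAlg.lift_of, QAlg.comul_of]
      cases g <;>
        simp [toDouble, comul_inHAlg, comul_inLAlg, h.comulH, h.comulL, Bor.comulGen,
          QAlg.comulGen])

lemma hom_of (h : BorelGens v t p x y) (g : Gen n) :
    h.hom (QAlg.of v t g) = toDouble p x y g := QAlg.lift_of _ h.sat g

end BorelGens

end DrinfeldDouble

end TwoParam

/-! ### Pullback of pairings, and the double of the presented Borel algebras -/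

namespace TwoParam

open Coalgebra

section coop

variable {k : Type*} [CommRing k]

variable (k) in
/-- The identity map from the co-opposite of the co-opposite. -/
def coopCoop (X : Type*) [Ring X] [Bialgebra k X] : Coop (Coop X) →ₐc[k] X :=
  BialgHom.ofAlgHom
    ((Coop.of k : X ≃ₐ[k] _).symm.toAlgHom.comp (Coop.of k : Coop X ≃ₐ[k] _).symm.toAlgHom)
    rfl
    (by
      ext x
      change TensorProduct.map LinearMap.id LinearMap.id
        (TensorProduct.comm k X X (TensorProduct.comm k X X (comul (R := k) (A := X) x))) =
          comul (R := k) (A := X) x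
      simp)

/-- The pullback of a Hopf pairing along homomorphisms of bialgebras. -/
def HopfPairing.comap {X Y H H₀ : Type*} [Ring X] [Bialgebra k X] [Ring Y] [Bialgebra k Y]
    [Ring H] [Bialgebra k H] [Ring H₀] [Bialgebra k H₀] (p : HopfPairing k X H₀)
    (β : Y →ₐc[k] X) (α : H →ₐc[k] H₀) : HopfPairing k Y H where
  form := p.form.compl₁₂ (β : Y →ₗ[k] X) (α : H →ₗ[k] H₀)
  one_left h := by
    change p.form (β 1) (α h) = _
    rw [map_one, p.one_left, CoalgHomClass.counit_comp_apply]
  one_right h := by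
    change p.form (β h) (α 1) = _
    rw [map_one, p.one_right, CoalgHomClass.counit_comp_apply]
  mul_right f x y := by
    change p.form (β f) (α (x * y)) = _
    rw [map_mul, p.mul_right, ← CoalgHomClass.map_comp_comul_apply]
    generalize comul (R := k) f = u
    induction u with
    | zero => simp
    | add x y hx hy => simp only [map_add, hx, hy]
    | tmul x y => rfl
  mul_left f g x := by
    change p.form (β (f * g)) (α x) = _
    rw [map_mul, p.mul_left, ← CoalgHomClass.map_comp_comul_apply]
    generalize comul (R := k) x = u
    induction u with
    | zero => simp
    | add x y hx hy => simp only [map_add, hx, hy]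
    | tmul x y => rfl

end coop

variable {k : Type*} [Field k]

namespace Bor

variable (v t : kˣ) (n : ℕ)

/-- The Hopf pairing of the Borel algebras, in the form required for the double. -/
def coopPairing : HopfPairing k (Coop (Coop (Bor v t⁻¹ n))) (Bor v t n) :=
  (pairing v t ((v : k)⁻¹ - (v : k))⁻¹).comap (coopCoop k _) (BialgHom.id k _)

lemma coopPairing_of (x y : BorGen n) :
    (coopPairing v t n).onL (Coop.of k (of v t⁻¹ x)) (of v t y) =
      dualGen v t ((v : k)⁻¹ - (v : k))⁻¹ x (of v t y) := pairing_of _ _ _ _ _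

/-- First use of `BorelGens`, on the presented algebras, where a pairing is available before
anything is known about `BPos` and `BNeg`. It is the input for their presentations. -/
lemma borelGens : DrinfeldDouble.BorelGens v t (coopPairing v t n) (of v t)
    (fun x => Coop.of k (of v t⁻¹ x)) where
  satH := sat_of v t
  satL := (sat_of v t⁻¹).map (Coop.of k : Bor v t⁻¹ n ≃ₐ[k] _).toAlgHom
  comulH := comul_of v t
  comulL := comul_coop_of v t⁻¹
  counitH := counit_of v t
  counitL := counit_of v t⁻¹
  E_E _ _ := (coopPairing_of v t n _ _).trans (dualDer_of v t _ _ _)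
  K_K _ _ := (coopPairing_of v t n _ _).trans (dualChr_of v t _ _)
  E_K _ _ := (coopPairing_of v t n _ _).trans (dualDer_of v t _ _ _)
  K_E _ _ := (coopPairing_of v t n _ _).trans (dualChr_of v t _ _)

end Bor

/-! ### Presentations of the positive and negative parts, and the pairing between them -/

namespace QAlg

/-- The symbols `E_i`, `K_i^{±1}`. -/
def posGen {n : ℕ} : BorGen n → Gen n
  | .E i => .E i
  | .K i => .K i
  | .Kinv i => .Kinv i

/-- The symbols `F_i`, `K_i'^{±1}`. -/
def negGen {n : ℕ} : BorGen n → Gen n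
  | .E i => .F i
  | .K i => .K' i
  | .Kinv i => .Kinv' i

variable {v t : kˣ} {n : ℕ} {A : Type*} [Ring A] [Algebra k A] {e : Gen n → A}

lemma Sat.pos (he : Sat v t e) : Bor.Sat v t (fun x => e (posGen x)) where
  comm x y hx hy := he.comm _ _ (by cases x <;> trivial) (by cases y <;> trivial)
  K_Kinv := he.K_Kinv
  Kinv_K := he.Kinv_K
  KE := he.KE
  E_E i j h := sub_eq_zero.1 (he.E_E i j h)
  serre₁ _ _ h := he.srrE₁ h
  serre₂ _ _ h := he.srrE₂ h

/-- The F's and K's with primes satisfy the E, K relations with t inverted: in the K'F scalar the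
exponent of t is negated, and the Serre relations of the F's carry t⁻¹. -/
lemma Sat.neg (he : Sat v t e) : Bor.Sat v t⁻¹ (fun x => e (negGen x)) where
  comm x y hx hy := he.comm _ _ (by cases x <;> trivial) (by cases y <;> trivial)
  K_Kinv := he.K'_Kinv'
  Kinv_K := he.Kinv'_K'
  KE i j := by
    rw [inv_zpow', neg_sub]
    exact he.K'F i j
  E_E i j h := sub_eq_zero.1 (he.F_F i j h)
  serre₁ _ _ h := by
    rw [Units.val_inv_eq_inv_val]
    exact he.srrF₁ h
  serre₂ _ _ h := by
    rw [Units.val_inv_eq_inv_val, inv_inv]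
    exact he.srrF₂ h

variable (v t) in
/-- The generators of `BPos`. -/
def pos (x : BorGen n) : BPos v t n :=
  ⟨of v t (posGen x), Algebra.subset_adjoin (by
    cases x with
    | E i => exact .E i
    | K i => exact .K i
    | Kinv i => exact .Kinv i)⟩

variable (v t) in
/-- The generators of `BNeg`. -/
def neg (x : BorGen n) : BNeg v t n :=
  ⟨of v t (negGen x), Algebra.subset_adjoin (by
    cases x with
    | E i => exact .F i
    | K i => exact .K' i
    | Kinv i => exact .Kinv' i)⟩

lemma sat_pos : Bor.Sat v t (pos v t (n := n)) :=
  Bor.Sat.of_injective (BPos v t n).val Subtype.val_injective (sat_of v t).pos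

lemma sat_neg : Bor.Sat v t⁻¹ (neg v t (n := n)) :=
  Bor.Sat.of_injective (BNeg v t n).val Subtype.val_injective (sat_of v t).neg

/-- Coproducts of a Hopf subalgebra are compared in the ambient tensor square, into which its own
tensor square embeds. -/
lemma comul_pos (x : BorGen n) : comul (R := k) (pos v t x) = Bor.comulGen (pos v t) x := by
  apply IsHopfSub.map_val_injective (BPos v t n)
  rw [IsHopfSub.map_comul]
  refine (comul_of v t (posGen x)).trans ?_
  cases x <;> simp [Bor.comulGen, comulGen, pos, posGen]

lemma comul_neg (x : BorGen n) : comul (R := k) (neg v t x) =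
    TensorProduct.comm k _ _ (Bor.comulGen (neg v t) x) := by
  apply IsHopfSub.map_val_injective (BNeg v t n)
  rw [IsHopfSub.map_comul]
  refine (comul_of v t (negGen x)).trans ?_
  cases x <;> simp [Bor.comulGen, comulGen, neg, negGen]

lemma counit_pos (x : BorGen n) : counit (R := k) (pos v t x) = Bor.counitGen k x := by
  refine (counit_of v t (posGen x)).trans ?_
  cases x <;> rfl

lemma counit_neg (x : BorGen n) : counit (R := k) (neg v t x) = Bor.counitGen k x := by
  refine (counit_of v t (negGen x)).trans ?_
  cases x <;> rfl

variable (v t n) in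
/-- The map from the Borel algebra given by generators and relations to `BPos`. -/
def posHom : Bor v t n →ₐ[k] BPos v t n := Bor.lift _ sat_pos

variable (v t n) in
/-- The map from the Borel algebra given by generators and relations to `BNeg`. -/
def negHom : Bor v t⁻¹ n →ₐ[k] BNeg v t n := Bor.lift _ sat_neg

/-- Following the map with U → double of the presented algebras gives the embedding of a tensor
factor, which is injective. So no relations among the E_i, K_i^{±1} hold in U beyond the presented
ones. -/
lemma posHom_injective : Function.Injective (posHom v t n) := by
  have h := Bor.borelGens v t n
  have key : h.hom.toAlgHom.comp ((BPos v t n).val.comp (posHom v t n)) =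
      DrinfeldDouble.inHAlg _ := by
    apply Bor.hom_ext
    intro x
    change h.hom (posHom v t n (Bor.of v t x) : QAlg v t n) = _
    rw [posHom, Bor.lift_of]
    refine (h.hom_of (posGen x)).trans ?_
    cases x <;> rfl
  have hi := DrinfeldDouble.inHAlg_injective (p := Bor.coopPairing v t n)
  rw [← key] at hi
  exact Function.Injective.of_comp (f := fun b : BPos v t n => h.hom (b : QAlg v t n)) hi

lemma negHom_injective : Function.Injective (negHom v t n) := by
  have h := Bor.borelGens v t n
  have key : h.hom.toAlgHom.comp ((BNeg v t n).val.comp (negHom v t n)) =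
      (DrinfeldDouble.inLAlg _).comp (Coop.of k : Bor v t⁻¹ n ≃ₐ[k] _).toAlgHom := by
    apply Bor.hom_ext
    intro x
    change h.hom (negHom v t n (Bor.of v t⁻¹ x) : QAlg v t n) = _
    rw [negHom, Bor.lift_of]
    refine (h.hom_of (negGen x)).trans ?_
    cases x <;> rfl
  have hi : Function.Injective ((DrinfeldDouble.inLAlg (Bor.coopPairing v t n)).comp
      (Coop.of k : Bor v t⁻¹ n ≃ₐ[k] _).toAlgHom) :=
    (DrinfeldDouble.inLAlg_injective (p := Bor.coopPairing v t n)).comp (Coop.of k).injective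
  rw [← key] at hi
  exact Function.Injective.of_comp (f := fun b : BNeg v t n => h.hom (b : QAlg v t n)) hi

lemma posHom_surjective : Function.Surjective (posHom v t n) := by
  have h : BPos v t n ≤ ((BPos v t n).val.comp (posHom v t n)).range := by
    refine Algebra.adjoin_le ?_
    rintro _ (i | i | i)
    · exact ⟨Bor.of v t (.E i), congrArg Subtype.val (Bor.lift_of _ sat_pos _)⟩
    · exact ⟨Bor.of v t (.K i), congrArg Subtype.val (Bor.lift_of _ sat_pos _)⟩
    · exact ⟨Bor.of v t (.Kinv i), congrArg Subtype.val (Bor.lift_of _ sat_pos _)⟩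
  rintro ⟨b, hb⟩
  obtain ⟨x, hx⟩ := h hb
  exact ⟨x, Subtype.ext hx⟩

lemma negHom_surjective : Function.Surjective (negHom v t n) := by
  have h : BNeg v t n ≤ ((BNeg v t n).val.comp (negHom v t n)).range := by
    refine Algebra.adjoin_le ?_
    rintro _ (i | i | i)
    · exact ⟨Bor.of v t⁻¹ (.E i), congrArg Subtype.val (Bor.lift_of _ sat_neg _)⟩
    · exact ⟨Bor.of v t⁻¹ (.K i), congrArg Subtype.val (Bor.lift_of _ sat_neg _)⟩
    · exact ⟨Bor.of v t⁻¹ (.Kinv i), congrArg Subtype.val (Bor.lift_of _ sat_neg _)⟩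
  rintro ⟨b, hb⟩
  obtain ⟨x, hx⟩ := h hb
  exact ⟨x, Subtype.ext hx⟩

lemma adjoin_pos : Algebra.adjoin k (Set.range (pos v t (n := n))) = ⊤ := by
  rw [← (AlgHom.range_eq_top _).2 (posHom_surjective (v := v) (t := t) (n := n)),
    ← Algebra.map_top, ← Bor.adjoin_of, AlgHom.map_adjoin, ← Set.range_comp]
  exact congrArg (fun f => Algebra.adjoin k (Set.range f))
    (funext fun x => (Bor.lift_of _ sat_pos x).symm)

lemma adjoin_neg : Algebra.adjoin k (Set.range (neg v t (n := n))) = ⊤ := by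
  rw [← (AlgHom.range_eq_top _).2 (negHom_surjective (v := v) (t := t) (n := n)),
    ← Algebra.map_top, ← Bor.adjoin_of, AlgHom.map_adjoin, ← Set.range_comp]
  exact congrArg (fun f => Algebra.adjoin k (Set.range f))
    (funext fun x => (Bor.lift_of _ sat_neg x).symm)

/-- Passing to the co-opposite turns 1 ⊗ F + F ⊗ K' into the Borel form F ⊗ 1 + K' ⊗ F; so it is the
co-opposite of `BNeg` that is a Borel algebra as a bialgebra. -/
lemma comul_coop_neg (x : BorGen n) : comul (R := k) (Coop.of k (neg v t x)) =
    Bor.comulGen (fun x => Coop.of k (neg v t x)) x := by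
  rw [Coop.comul_of, comul_neg]
  cases x <;> simp [Bor.comulGen]

variable (v t n) in
/-- The Borel algebra given by generators and relations is `BPos`. -/
def posEquiv : Bor v t n ≃ₐc[k] BPos v t n :=
  BialgEquiv.ofBijective (BialgHom.ofAlgHom (posHom v t n)
    (by
      apply Bor.hom_ext
      intro x
      change counit (R := k) (posHom v t n (Bor.of v t x)) = counit (R := k) (Bor.of v t x)
      rw [posHom, Bor.lift_of, Bor.counit_of, counit_pos])
    (by
      apply Bor.hom_ext
      intro x
      change Algebra.TensorProduct.map _ _ (comul (R := k) (Bor.of v t x)) =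
        comul (R := k) (posHom v t n (Bor.of v t x))
      rw [posHom, Bor.lift_of, Bor.comul_of, comul_pos]
      cases x <;> simp [Bor.comulGen]))
    ⟨posHom_injective, posHom_surjective⟩

variable (v t n) in
/-- The Borel algebra given by generators and relations is the co-opposite of `BNeg`. -/
def negEquiv : Bor v t⁻¹ n ≃ₐc[k] Coop (BNeg v t n) :=
  BialgEquiv.ofBijective (BialgHom.ofAlgHom
      ((Coop.of k : BNeg v t n ≃ₐ[k] _).toAlgHom.comp (negHom v t n))
    (by
      apply Bor.hom_ext
      intro x
      change counit (R := k) (negHom v t n (Bor.of v t⁻¹ x)) = counit (R := k) (Bor.of v t⁻¹ x)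
      rw [negHom, Bor.lift_of, Bor.counit_of, counit_neg])
    (by
      apply Bor.hom_ext
      intro x
      change Algebra.TensorProduct.map _ _ (comul (R := k) (Bor.of v t⁻¹ x)) =
        comul (R := k) (Coop.of k (negHom v t n (Bor.of v t⁻¹ x)))
      rw [negHom, Bor.lift_of, Bor.comul_of, comul_coop_neg]
      cases x <;> simp [Bor.comulGen]))
    ⟨(Coop.of k).injective.comp negHom_injective, (Coop.of k).surjective.comp negHom_surjective⟩

lemma posEquiv_symm_pos (x : BorGen n) : (posEquiv v t n).symm (pos v t x) = Bor.of v t x := by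
  have h : posEquiv v t n (Bor.of v t x) = pos v t x := Bor.lift_of _ sat_pos x
  rw [← h, BialgEquiv.symm_apply_apply]

lemma negEquiv_symm_neg (x : BorGen n) :
    (negEquiv v t n).symm (Coop.of k (neg v t x)) = Bor.of v t⁻¹ x := by
  have h : negEquiv v t n (Bor.of v t⁻¹ x) = Coop.of k (neg v t x) :=
    congrArg (Coop.of k : BNeg v t n ≃ₐ[k] _) (Bor.lift_of _ sat_neg x)
  rw [← h, BialgEquiv.symm_apply_apply]

variable (v t n) in
/-- The Hopf pairing of `BNeg` and `BPos`. -/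
def borelPairing : HopfPairing k (Coop (BNeg v t n)) (BPos v t n) :=
  (Bor.pairing v t ((v : k)⁻¹ - (v : k))⁻¹).comap
    (negEquiv v t n).symm.toBialgHom
    (posEquiv v t n).symm.toBialgHom

lemma borelPairing_gen (x y : BorGen n) :
    (borelPairing v t n).form (Coop.of k (neg v t x)) (pos v t y) =
      Bor.dualGen v t ((v : k)⁻¹ - (v : k))⁻¹ x (Bor.of v t y) := by
  refine Eq.trans ?_ (Bor.pairing_of v t _ x _)
  change (Bor.pairing v t _).form ((negEquiv v t n).symm (Coop.of k (neg v t x)))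
    ((posEquiv v t n).symm (pos v t y)) = _
  rw [posEquiv_symm_pos, negEquiv_symm_neg]

end QAlg

end TwoParam

/-! ### Antipodes under bialgebra maps, and uniqueness of Hopf pairings -/

namespace TwoParam

open Coalgebra WithConv

section general

/-- A homomorphism of bialgebras between Hopf algebras commutes with the antipodes. -/
lemma map_antipode {k A B : Type*} [CommRing k] [Ring A] [HopfAlgebra k A] [Ring B]
    [HopfAlgebra k B] (f : A →ₐc[k] B) (x : A) :
    f (HopfAlgebra.antipode k x) = HopfAlgebra.antipode k (f x) := by
  -- In the convolution algebra of linear maps A → B, f ∘ S is a left inverse of f and S ∘ f is a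
  -- right inverse, so they coincide.
  have h₁ : toConv (f.toLinearMap ∘ₗ HopfAlgebra.antipode k) * toConv f.toLinearMap = 1 := by
    have h := LinearMap.algHom_comp_convMul_distrib f.toAlgHom
      (toConv (HopfAlgebra.antipode k (A := A))) (toConv LinearMap.id)
    rw [LinearMap.antipode_mul_id] at h
    refine Eq.trans (WithConv.ofConv_injective h.symm) ?_
    ext x
    simp
  have h₂ : toConv f.toLinearMap * toConv (HopfAlgebra.antipode k ∘ₗ f.toLinearMap) = 1 := by
    have h := LinearMap.convMul_comp_coalgHom_distrib (toConv LinearMap.id)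
      (toConv (HopfAlgebra.antipode k (A := B))) f.toCoalgHom
    rw [LinearMap.id_mul_antipode] at h
    refine Eq.trans (WithConv.ofConv_injective h.symm) ?_
    ext x
    simp
  have h := left_inv_eq_right_inv h₁ h₂
  exact congrArg (fun g : WithConv (A →ₗ[k] B) => g x) h

namespace HopfPairing

variable {k Y H : Type*} [Field k] [Ring Y] [Bialgebra k Y] [Ring H] [Bialgebra k H]

lemma mul_right_groupLike (p : HopfPairing k Y H) {f : Y} (hf : comul (R := k) f = f ⊗ₜ f)
    (a b : H) : p.form f (a * b) = p.form f a * p.form f b := by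
  rw [p.mul_right, hf]
  rfl

lemma mul_left_groupLike (p : HopfPairing k Y H) {a : H} (ha : comul (R := k) a = a ⊗ₜ a)
    (f g : Y) : p.form (f * g) a = p.form f a * p.form g a := by
  rw [p.mul_left, ha]
  rfl

lemma mul_right_skew (p : HopfPairing k Y H) {f g : Y}
    (hf : comul (R := k) f = f ⊗ₜ 1 + g ⊗ₜ f) (a b : H) :
    p.form f (a * b) = p.form f a * counit (R := k) b + p.form g a * p.form f b := by
  rw [p.mul_right, hf]
  simp [p.one_left]

lemma mul_left_skew (p : HopfPairing k Y H) {a b : H}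
    (ha : comul (R := k) a = a ⊗ₜ 1 + b ⊗ₜ a) (f g : Y) :
    p.form (f * g) a = p.form f a * counit (R := k) g + p.form f b * p.form g a := by
  rw [p.mul_left, ha]
  simp [p.one_right]

variable {v t v' t' : kˣ} {n : ℕ} {x : BorGen n → H} {y : BorGen n → Y}

/-- A Hopf pairing of algebras generated by Borel generators is determined by its values on
generators. -/
lemma ext_of_gens {p q : HopfPairing k Y H}
    (hy : ∀ g, comul (R := k) (y g) = Bor.comulGen y g)
    (ax : Algebra.adjoin k (Set.range x) = ⊤) (ay : Algebra.adjoin k (Set.range y) = ⊤)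
    (h : ∀ g g', p.form (y g) (x g') = q.form (y g) (x g')) : p = q := by
  have h_one (f : Y) (r : k) : p.form f (algebraMap k H r) = q.form f (algebraMap k H r) := by
    simp only [Algebra.algebraMap_eq_smul_one, map_smul, p.one_right, q.one_right]
  -- Group-like elements come first: the multiplication rule for E_i involves the values of K_i on
  -- arbitrary elements.
  have h_torus {g : BorGen n} (hg : g.IsTorus) (a : H) : p.form (y g) a = q.form (y g) a := by
    have hc : comul (R := k) (y g) = y g ⊗ₜ y g := by rw [hy, Bor.comulGen_torus _ hg]
    have ha : a ∈ Algebra.adjoin k (Set.range x) := ax ▸ Algebra.mem_top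
    induction ha using Algebra.adjoin_induction with
    | mem a ha => obtain ⟨g', rfl⟩ := ha; exact h g g'
    | algebraMap r => exact h_one _ r
    | add a b _ _ ha hb => rw [map_add, map_add, ha, hb]
    | mul a b _ _ ha hb => rw [p.mul_right_groupLike hc, q.mul_right_groupLike hc, ha, hb]
  have h_gen (g : BorGen n) (a : H) : p.form (y g) a = q.form (y g) a := by
    cases g with
    | K i => exact h_torus (g := .K i) trivial a
    | Kinv i => exact h_torus (g := .Kinv i) trivial a
    | E i =>
      have hc : comul (R := k) (y (.E i)) = y (.E i) ⊗ₜ 1 + y (.K i) ⊗ₜ y (.E i) := hy _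
      have ha : a ∈ Algebra.adjoin k (Set.range x) := ax ▸ Algebra.mem_top
      induction ha using Algebra.adjoin_induction with
      | mem a ha => obtain ⟨g', rfl⟩ := ha; exact h _ g'
      | algebraMap r => exact h_one _ r
      | add a b _ _ ha hb => rw [map_add, map_add, ha, hb]
      | mul a b _ _ ha hb =>
        rw [p.mul_right_skew hc, q.mul_right_skew hc, ha, hb, h_torus (g := .K i) trivial]
  ext f a
  have hf : f ∈ Algebra.adjoin k (Set.range y) := ay ▸ Algebra.mem_top
  -- The induction on f must carry equality of whole functionals, since the product rule in f
  -- evaluates both factors on the components of Δ(a).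
  suffices p.form f = q.form f by rw [this]
  clear a
  induction hf using Algebra.adjoin_induction with
  | mem f hf => obtain ⟨g, rfl⟩ := hf; exact LinearMap.ext (h_gen g)
  | algebraMap r =>
    ext a
    simp only [Algebra.algebraMap_eq_smul_one, map_smul, LinearMap.smul_apply, p.one_left,
      q.one_left]
  | add f g _ _ hf hg => rw [map_add, map_add, hf, hg]
  | mul f g _ _ hf hg =>
    ext a
    rw [p.mul_left, q.mul_left, hf, hg]

/-- The values of a Hopf pairing of Borel algebras on the generators, including the `K_i⁻¹`, are
determined by those on the `E_i`, `K_i`. -/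
lemma ext_of_E_K {p q : HopfPairing k Y H} (sx : Bor.Sat v t x) (sy : Bor.Sat v' t' y)
    (hx : ∀ g, comul (R := k) (x g) = Bor.comulGen x g)
    (hy : ∀ g, comul (R := k) (y g) = Bor.comulGen y g)
    (cx : ∀ g, counit (R := k) (x g) = Bor.counitGen k g)
    (cy : ∀ g, counit (R := k) (y g) = Bor.counitGen k g)
    (ax : Algebra.adjoin k (Set.range x) = ⊤) (ay : Algebra.adjoin k (Set.range y) = ⊤)
    (h_E_E : ∀ i j, p.form (y (.E i)) (x (.E j)) = q.form (y (.E i)) (x (.E j)))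
    (h_K_K : ∀ i j, p.form (y (.K i)) (x (.K j)) = q.form (y (.K i)) (x (.K j)))
    (h_E_K : ∀ i j, p.form (y (.E i)) (x (.K j)) = 0 ∧ q.form (y (.E i)) (x (.K j)) = 0)
    (h_K_E : ∀ i j, p.form (y (.K i)) (x (.E j)) = 0 ∧ q.form (y (.K i)) (x (.E j)) = 0) :
    p = q := by
  -- Pairing K_j K_j⁻¹ = 1 with a group-like element shows that the values on inverses are inverse
  -- scalars; in particular (K_i', K_j) can be cancelled below.
  have K_Kinv (p : HopfPairing k Y H) (i j : Fin (n - 1)) :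
      p.form (y (.K i)) (x (.K j)) * p.form (y (.K i)) (x (.Kinv j)) = 1 := by
    rw [← p.mul_right_groupLike (hy (.K i)), sx.K_Kinv, p.one_right, cy]
    rfl
  have Kinv_K (p : HopfPairing k Y H) (i j : Fin (n - 1)) :
      p.form (y (.K i)) (x (.K j)) * p.form (y (.Kinv i)) (x (.K j)) = 1 := by
    rw [← p.mul_left_groupLike (hx (.K j)), sy.K_Kinv, p.one_left, cx]
    rfl
  have Kinv_Kinv (p : HopfPairing k Y H) (i j : Fin (n - 1)) :
      p.form (y (.Kinv i)) (x (.K j)) * p.form (y (.Kinv i)) (x (.Kinv j)) = 1 := by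
    rw [← p.mul_right_groupLike (hy (.Kinv i)), sx.K_Kinv, p.one_right, cy]
    rfl
  -- Expanding 0 = (E_i, K_j K_j⁻¹) leaves (K_i, K_j)(E_i, K_j⁻¹) once (E_i, K_j) is known to
  -- vanish. The argument for (K_i⁻¹, E_j) is the mirror image.
  have E_Kinv (p : HopfPairing k Y H) (i j : Fin (n - 1)) (h : p.form (y (.E i)) (x (.K j)) = 0) :
      p.form (y (.E i)) (x (.Kinv j)) = 0 := by
    refine (mul_eq_zero.1 ?_).resolve_left (left_ne_zero_of_mul_eq_one (K_Kinv p i j))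
    have := p.mul_right_skew (hy (.E i)) (x (.K j)) (x (.Kinv j))
    rw [sx.K_Kinv, p.one_right, cy, h, zero_mul, zero_add] at this
    exact this.symm
  have Kinv_E (p : HopfPairing k Y H) (i j : Fin (n - 1)) (h : p.form (y (.K i)) (x (.E j)) = 0) :
      p.form (y (.Kinv i)) (x (.E j)) = 0 := by
    refine (mul_eq_zero.1 ?_).resolve_left (left_ne_zero_of_mul_eq_one (K_Kinv p i j))
    have := p.mul_left_skew (hx (.E j)) (y (.K i)) (y (.Kinv i))
    rw [sy.K_Kinv, p.one_left, cx, h, zero_mul, zero_add] at this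
    exact this.symm
  have e₁ (i j : Fin (n - 1)) :
      p.form (y (.K i)) (x (.Kinv j)) = q.form (y (.K i)) (x (.Kinv j)) := by
    rw [eq_inv_of_mul_eq_one_right (K_Kinv p i j), eq_inv_of_mul_eq_one_right (K_Kinv q i j), h_K_K]
  have e₂ (i j : Fin (n - 1)) :
      p.form (y (.Kinv i)) (x (.K j)) = q.form (y (.Kinv i)) (x (.K j)) := by
    rw [eq_inv_of_mul_eq_one_right (Kinv_K p i j), eq_inv_of_mul_eq_one_right (Kinv_K q i j), h_K_K]
  refine ext_of_gens hy ax ay fun g g' => ?_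
  cases g with
  | E i =>
    cases g' with
    | E j => exact h_E_E i j
    | K j => rw [(h_E_K i j).1, (h_E_K i j).2]
    | Kinv j => rw [E_Kinv p i j (h_E_K i j).1, E_Kinv q i j (h_E_K i j).2]
  | K i =>
    cases g' with
    | E j => rw [(h_K_E i j).1, (h_K_E i j).2]
    | K j => exact h_K_K i j
    | Kinv j => exact e₁ i j
  | Kinv i =>
    cases g' with
    | E j => rw [Kinv_E p i j (h_K_E i j).1, Kinv_E q i j (h_K_E i j).2]
    | K j => exact e₂ i j
    | Kinv j =>
      rw [eq_inv_of_mul_eq_one_right (Kinv_Kinv p i j),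
        eq_inv_of_mul_eq_one_right (Kinv_Kinv q i j), e₂]

end HopfPairing

end general

namespace QAlg

variable {k : Type*} [Field k]

/-! ### Straightening: the positive part times the negative part is everything -/

section triangular

variable (v t : kˣ) (n : ℕ)

/-- The multiplication map from the tensor product of the two Borel algebras. -/
def mulMap : BPos v t n ⊗[k] BNeg v t n →ₗ[k] QAlg v t n :=
  LinearMap.mul' k (QAlg v t n) ∘ₗ
    TensorProduct.map (BPos v t n).val.toLinearMap (BNeg v t n).val.toLinearMap

variable {v t n}

lemma mulMap_tmul (a : BPos v t n) (f : BNeg v t n) :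
    mulMap v t n (a ⊗ₜ f) = (a : QAlg v t n) * f := rfl

lemma mul_mem_range_mulMap (a : BPos v t n) {u : QAlg v t n}
    (hu : u ∈ LinearMap.range (mulMap v t n)) :
    (a : QAlg v t n) * u ∈ LinearMap.range (mulMap v t n) := by
  obtain ⟨w, rfl⟩ := hu
  induction w with
  | zero => simp
  | add x y hx hy => rw [map_add, mul_add]; exact add_mem hx hy
  | tmul b f => exact ⟨(a * b) ⊗ₜ f, by simp only [mulMap_tmul, Subalgebra.coe_mul, mul_assoc]⟩

lemma mem_range_mulMap_mul (f : BNeg v t n) {u : QAlg v t n}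
    (hu : u ∈ LinearMap.range (mulMap v t n)) :
    u * (f : QAlg v t n) ∈ LinearMap.range (mulMap v t n) := by
  obtain ⟨w, rfl⟩ := hu
  induction w with
  | zero => simp
  | add x y hx hy => rw [map_add, add_mul]; exact add_mem hx hy
  | tmul b g => exact ⟨b ⊗ₜ (g * f), by simp only [mulMap_tmul, Subalgebra.coe_mul, mul_assoc]⟩

/-- An element of `BNeg` which can be moved past the generators of `BPos` can be moved past
`BPos`. -/
lemma mul_coe_mem_range_mulMap (z : BNeg v t n)
    (h : ∀ (g : BorGen n) (a : BPos v t n), (z : QAlg v t n) * a ∈ LinearMap.range (mulMap v t n) →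
      (z : QAlg v t n) * (of v t (posGen g) * (a : QAlg v t n)) ∈ LinearMap.range (mulMap v t n))
    (a : BPos v t n) : (z : QAlg v t n) * a ∈ LinearMap.range (mulMap v t n) := by
  -- The claim for b is quantified over all a, so that the case of a product bc can apply the claim
  -- for b to ca.
  have key (b : BPos v t n) : ∀ a : BPos v t n,
      (z : QAlg v t n) * a ∈ LinearMap.range (mulMap v t n) →
      (z : QAlg v t n) * ((b : QAlg v t n) * a) ∈ LinearMap.range (mulMap v t n) := by
    have hb : b ∈ Algebra.adjoin k (Set.range (pos v t (n := n))) :=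
      adjoin_pos (v := v) (t := t) (n := n) ▸ Algebra.mem_top
    induction hb using Algebra.adjoin_induction with
    | mem b hb => obtain ⟨g, rfl⟩ := hb; exact h g
    | algebraMap r =>
      intro a ha
      rw [Subalgebra.coe_algebraMap, ← Algebra.smul_def, mul_smul_comm]
      exact Submodule.smul_mem _ _ ha
    | add b c _ _ hb hc =>
      intro a ha
      rw [Subalgebra.coe_add, add_mul, mul_add]
      exact add_mem (hb a ha) (hc a ha)
    | mul b c _ _ hb hc =>
      intro a ha
      rw [Subalgebra.coe_mul, mul_assoc]
      exact hb (c * a) (hc a ha)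
  have h1 := key a 1 ⟨1 ⊗ₜ z, by simp [mulMap_tmul]⟩
  rwa [OneMemClass.coe_one, mul_one] at h1

lemma skew_mul_mem_range_mulMap {z : QAlg v t n} {g : BorGen n} {c : k}
    (h : z * of v t (posGen g) = c • (of v t (posGen g) * z)) {a : QAlg v t n}
    (ha : z * a ∈ LinearMap.range (mulMap v t n)) :
    z * (of v t (posGen g) * a) ∈ LinearMap.range (mulMap v t n) := by
  rw [← mul_assoc, h, smul_mul_assoc, mul_assoc]
  exact Submodule.smul_mem _ _ (mul_mem_range_mulMap (pos v t g) ha)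

lemma torus_skew {x : Gen n} (hx : x.IsTorus) {g : BorGen n} (hg : g.IsTorus) :
    of v t x * of v t (posGen g) = (1 : k) • (of v t (posGen g) * of v t x) := by
  rw [one_smul]
  exact (sat_of v t).comm _ _ hx (by cases g <;> trivial)

lemma K'_mul_mem (i : Fin (n - 1)) (a : BPos v t n) :
    of v t (.K' i) * (a : QAlg v t n) ∈ LinearMap.range (mulMap v t n) := by
  refine mul_coe_mem_range_mulMap (neg v t (.K i)) (fun g a ha => ?_) a
  cases g with
  | E j => exact skew_mul_mem_range_mulMap (g := .E j) ((sat_of v t).K'E i j) ha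
  | K j => exact skew_mul_mem_range_mulMap (torus_skew (x := .K' i) (g := .K j) trivial trivial) ha
  | Kinv j =>
    exact skew_mul_mem_range_mulMap (torus_skew (x := .K' i) (g := .Kinv j) trivial trivial) ha

lemma Kinv'_mul_mem (i : Fin (n - 1)) (a : BPos v t n) :
    of v t (.Kinv' i) * (a : QAlg v t n) ∈ LinearMap.range (mulMap v t n) := by
  refine mul_coe_mem_range_mulMap (neg v t (.Kinv i)) (fun g a ha => ?_) a
  have h := sat_of v t (n := n)
  cases g with
  | E j =>
    refine skew_mul_mem_range_mulMap (g := .E j)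
      (c := (((v ^ (-dot i j) * t ^ (Om i j - Om j i))⁻¹ : kˣ) : k)) ?_ ha
    have := inv_comm_of (h.K'_Kinv' i) (h.Kinv'_K' i) (h.K'E i j)
    change of v t (.Kinv' i) * of v t (.E j) = _ • (of v t (.E j) * of v t (.Kinv' i))
    rw [this, smul_smul, Units.inv_mul, one_smul]
  | K j =>
    exact skew_mul_mem_range_mulMap (torus_skew (x := .Kinv' i) (g := .K j) trivial trivial) ha
  | Kinv j =>
    exact skew_mul_mem_range_mulMap (torus_skew (x := .Kinv' i) (g := .Kinv j) trivial trivial) ha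

/-- Moving F_i past E_j leaves a commutator made of K_j and K_j'. The K_j term is already in order,
and the K_j' term is covered by `K'_mul_mem`; past the torus, F_i only picks up a scalar. -/
lemma F_mul_mem (i : Fin (n - 1)) (a : BPos v t n) :
    of v t (.F i) * (a : QAlg v t n) ∈ LinearMap.range (mulMap v t n) := by
  refine mul_coe_mem_range_mulMap (neg v t (.E i)) (fun g a ha => ?_) a
  have h := sat_of v t (n := n)
  cases g with
  | E j =>
    change of v t (.F i) * (of v t (.E j) * (a : QAlg v t n)) ∈
      LinearMap.range (mulMap v t n)
    have h1 : of v t (.F i) * of v t (.E j) = of v t (.E j) * of v t (.F i) -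
        (of v t (.E j) * of v t (.F i) - of v t (.F i) * of v t (.E j)) := by abel
    rw [← mul_assoc, h1, sub_mul, mul_assoc]
    refine sub_mem (mul_mem_range_mulMap (pos v t (.E j)) ha) ?_
    rw [h.E_F]
    split_ifs
    · rw [smul_mul_assoc, sub_mul]
      refine Submodule.smul_mem _ _ (sub_mem ?_ (K'_mul_mem j a))
      exact ⟨(pos v t (.K j) * a) ⊗ₜ 1, by simp [mulMap_tmul, pos, posGen]⟩
    · rw [zero_mul]
      exact zero_mem _
  | K j =>
    refine skew_mul_mem_range_mulMap (g := .K j)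
      (c := (((v ^ (-dot j i) * t ^ (Om i j - Om j i))⁻¹ : kˣ) : k)) ?_ ha
    change of v t (.F i) * of v t (.K j) = _ • (of v t (.K j) * of v t (.F i))
    rw [h.KF, smul_smul, Units.inv_mul, one_smul]
  | Kinv j =>
    exact skew_mul_mem_range_mulMap (g := .Kinv j)
      (inv_comm_of (h.K_Kinv j) (h.Kinv_K j) (h.KF j i)) ha

/-- The range contains 1 and is stable under left multiplication by every generator, hence is a left
ideal equal to the whole algebra. -/
lemma mulMap_surjective : Function.Surjective (mulMap v t n) := by
  -- The range is stable under right multiplication by `BNeg`, so for a generator z of `BNeg` it is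
  -- enough to move z past elements of `BPos`.
  have neg_mem {z : QAlg v t n}
      (hz : ∀ a : BPos v t n, z * (a : QAlg v t n) ∈ LinearMap.range (mulMap v t n))
      {u : QAlg v t n} (hu : u ∈ LinearMap.range (mulMap v t n)) :
      z * u ∈ LinearMap.range (mulMap v t n) := by
    obtain ⟨w, rfl⟩ := hu
    induction w with
    | zero => simp
    | add x y hx hy => rw [map_add, mul_add]; exact add_mem hx hy
    | tmul a f =>
      rw [mulMap_tmul, ← mul_assoc]
      exact mem_range_mulMap_mul f (hz a)
  have key (z u : QAlg v t n) (hu : u ∈ LinearMap.range (mulMap v t n)) :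
      z * u ∈ LinearMap.range (mulMap v t n) := by
    have hz : z ∈ Algebra.adjoin k (Set.range (of v t (n := n))) :=
      adjoin_of (v := v) (t := t) (n := n) ▸ Algebra.mem_top
    induction hz using Algebra.adjoin_induction generalizing u with
    | mem z hz =>
      obtain ⟨x, rfl⟩ := hz
      cases x with
      | E i => exact mul_mem_range_mulMap (pos v t (.E i)) hu
      | K i => exact mul_mem_range_mulMap (pos v t (.K i)) hu
      | Kinv i => exact mul_mem_range_mulMap (pos v t (.Kinv i)) hu
      | F i => exact neg_mem (F_mul_mem i) hu
      | K' i => exact neg_mem (K'_mul_mem i) hu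
      | Kinv' i => exact neg_mem (Kinv'_mul_mem i) hu
    | algebraMap r =>
      rw [← Algebra.smul_def]
      exact Submodule.smul_mem _ _ hu
    | add y z _ _ hy hz => rw [add_mul]; exact add_mem (hy u hu) (hz u hu)
    | mul y z _ _ hy hz => rw [mul_assoc]; exact hy _ (hz u hu)
  intro z
  have h := key z 1 ⟨1 ⊗ₜ 1, by simp [mulMap_tmul]⟩
  rwa [mul_one] at h

end triangular

/-! ### The double of the positive and negative parts is the quantum algebra -/

section double

variable {v t : kˣ} {n : ℕ} {p : HopfPairing k (Coop (BNeg v t n)) (BPos v t n)}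

lemma hom_coe_pos (h : DrinfeldDouble.BorelGens v t p (pos v t) (neg v t)) (a : BPos v t n) :
    h.hom (a : QAlg v t n) = DrinfeldDouble.inHAlg p a := by
  have ha : a ∈ Algebra.adjoin k (Set.range (pos v t (n := n))) :=
    adjoin_pos (v := v) (t := t) (n := n) ▸ Algebra.mem_top
  induction ha using Algebra.adjoin_induction with
  | mem a ha =>
    obtain ⟨g, rfl⟩ := ha
    refine (h.hom_of (posGen g)).trans ?_
    cases g <;> rfl
  | algebraMap r => simp only [Subalgebra.coe_algebraMap, AlgHomClass.commutes]
  | add a b _ _ ha hb => rw [Subalgebra.coe_add, map_add, map_add, ha, hb]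
  | mul a b _ _ ha hb => rw [Subalgebra.coe_mul, map_mul, map_mul, ha, hb]

lemma hom_coe_neg (h : DrinfeldDouble.BorelGens v t p (pos v t) (neg v t)) (f : BNeg v t n) :
    h.hom (f : QAlg v t n) = DrinfeldDouble.inLAlg p f := by
  have hf : f ∈ Algebra.adjoin k (Set.range (neg v t (n := n))) :=
    adjoin_neg (v := v) (t := t) (n := n) ▸ Algebra.mem_top
  induction hf using Algebra.adjoin_induction with
  | mem a ha =>
    obtain ⟨g, rfl⟩ := ha
    refine (h.hom_of (negGen g)).trans ?_
    cases g <;> rfl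
  | algebraMap r => simp only [Subalgebra.coe_algebraMap, AlgHomClass.commutes]
  | add a b _ _ ha hb => rw [Subalgebra.coe_add, map_add, map_add, ha, hb]
  | mul a b _ _ ha hb => rw [Subalgebra.coe_mul, map_mul, map_mul, ha, hb]

/-- Elements of the double are tensors, and a ⊗ f is the product (a ⊗ 1)(1 ⊗ f). So straightening in
U followed by the map to the double is the identity of the underlying space. -/
lemma hom_mulMap (h : DrinfeldDouble.BorelGens v t p (pos v t) (neg v t))
    (w : BPos v t n ⊗[k] BNeg v t n) : h.hom (mulMap v t n w) = (w : DrinfeldDouble p) := by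
  induction w with
  | zero => rw [map_zero, map_zero]; rfl
  | add x y hx hy => rw [map_add, map_add, hx, hy]; rfl
  | tmul a f =>
    rw [mulMap_tmul, map_mul, hom_coe_pos, hom_coe_neg]
    exact (DrinfeldDouble.tm_eq a f).symm

/-- Two elements of U with equal image are images under `mulMap` of the same tensor, by
`hom_mulMap`; and every tensor is hit by its own product in U. -/
lemma hom_bijective (h : DrinfeldDouble.BorelGens v t p (pos v t) (neg v t)) :
    Function.Bijective h.hom := by
  constructor
  · intro x y hxy
    obtain ⟨x, rfl⟩ := mulMap_surjective x
    obtain ⟨y, rfl⟩ := mulMap_surjective y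
    rw [hom_mulMap, hom_mulMap] at hxy
    exact congrArg _ hxy
  · intro w
    exact ⟨mulMap v t n w, hom_mulMap h w⟩

/-- The Drinfeld double of the two Borel algebras is the two-parameter quantum algebra. -/
def doubleEquiv (h : DrinfeldDouble.BorelGens v t p (pos v t) (neg v t)) :
    DrinfeldDouble p ≃ₐc[k] QAlg v t n :=
  (BialgEquiv.ofBijective h.hom (hom_bijective h)).symm

end double

end QAlg

/-! ### Specialisation to ℚ(v, t): existence, uniqueness and the isomorphism -/

lemma isBorelPairing_borelPairing (n : ℕ) : IsBorelPairing (QAlg.borelPairing vQ tQ n) where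
  F_E i j := (QAlg.borelPairing_gen (.E i) (.E j)).trans (Bor.dualDer_of vQ tQ _ _ _)
  K'_K i j := by
    refine (QAlg.borelPairing_gen (.K i) (.K j)).trans ((Bor.dualChr_of vQ tQ _ _).trans ?_)
    simp [Bor.chrGen, Bor.wt]
  F_K i j := (QAlg.borelPairing_gen (.E i) (.K j)).trans (Bor.dualDer_of vQ tQ _ _ _)
  K'_E i j := (QAlg.borelPairing_gen (.K i) (.E j)).trans (Bor.dualChr_of vQ tQ _ _)

/-- Second use of `BorelGens`, now on the actual subalgebras: the four prescribed families of values
are precisely what the cross relations consume. -/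
lemma IsBorelPairing.borelGens {n : ℕ} {p : HopfPairing Qvt (Coop (BU' n)) (BU n)}
    (h : IsBorelPairing p) :
    DrinfeldDouble.BorelGens vQ tQ p (QAlg.pos vQ tQ) (QAlg.neg vQ tQ) where
  satH := QAlg.sat_pos
  satL := QAlg.sat_neg
  comulH := QAlg.comul_pos
  comulL := QAlg.comul_neg
  counitH := QAlg.counit_pos
  counitL := QAlg.counit_neg
  E_E := h.F_E
  K_K i j := (h.K'_K i j).trans (by simp [Bor.wt])
  E_K := h.F_K
  K_E := h.K'_E

/-- The pairing lives on the co-opposite of B', whose generators have the unflipped Borel coproduct,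
so `ext_of_E_K` applies with t on one side and t⁻¹ on the other. -/
lemma IsBorelPairing.eq {n : ℕ} {p q : HopfPairing Qvt (Coop (BU' n)) (BU n)}
    (hp : IsBorelPairing p) (hq : IsBorelPairing q) : p = q :=
  HopfPairing.ext_of_E_K (x := QAlg.pos vQ tQ) (y := fun x => Coop.of Qvt (QAlg.neg vQ tQ x))
    QAlg.sat_pos (QAlg.sat_neg.map (Coop.of Qvt : BU' n ≃ₐ[Qvt] _).toAlgHom)
    QAlg.comul_pos QAlg.comul_coop_neg QAlg.counit_pos QAlg.counit_neg
    QAlg.adjoin_pos QAlg.adjoin_neg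
    (fun i j => (hp.F_E i j).trans (hq.F_E i j).symm)
    (fun i j => (hp.K'_K i j).trans (hq.K'_K i j).symm)
    (fun i j => ⟨hp.F_K i j, hq.F_K i j⟩) (fun i j => ⟨hp.K'_E i j, hq.K'_E i j⟩)

end TwoParam

end

theorem mainTheorem2 (n : ℕ) :
    ∃ p : TwoParam.HopfPairing TwoParam.Qvt (TwoParam.Coop (TwoParam.BU' n)) (TwoParam.BU n),
      TwoParam.IsBorelPairing p ∧
      (∀ q : TwoParam.HopfPairing TwoParam.Qvt (TwoParam.Coop (TwoParam.BU' n)) (TwoParam.BU n),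
        TwoParam.IsBorelPairing q → q = p) ∧
      ∃ φ : TwoParam.DrinfeldDouble p ≃ₐc[TwoParam.Qvt] TwoParam.Uvt n,
        ∀ x, φ (HopfAlgebra.antipode TwoParam.Qvt x) = HopfAlgebra.antipode TwoParam.Qvt (φ x) := by
  have h := TwoParam.isBorelPairing_borelPairing n
  -- Compatibility with the antipodes needs no computation: it holds for every bialgebra map between
  -- Hopf algebras.
  exact ⟨_, h, fun q hq => hq.eq h, TwoParam.QAlg.doubleEquiv h.borelGens,
    TwoParam.map_antipode (TwoParam.QAlg.doubleEquiv h.borelGens).toBialgHom⟩
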